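/- Let $G$ be a connected linearly reductive complex algebraic group with maximal torus $T$ and a choice of positive roots, with simple roots $\alpha_1,\dots,\alpha_r$ and root lattice $\mathfrak{W}=\langle\alpha_1,\dots,\alpha_r\rangle$. For a character $\lambda$ of $T$ let $\mathbb{C}[G]_\lambda\subset\mathbb{C}[G]$ be the span of the matrix coefficients of the irreducible representation of $G$ with highest weight $\lambda$ (zero if $\lambda$ is not dominant). Let $G_{\mathrm{enh}}=(G\times T)/Z_G$, with the center $Z_G$ embedded anti-diagonally, and let $\mathbb{C}[G_{\mathrm{enh}}]_{(\lambda,\mu)}\subset \mathbb{C}[G_{\mathrm{enh}}]$ be the span of the matrix coefficients of the irreducible representation of $G_{\mathrm{enh}}$ with highest weight $(\lambda,\mu)$. The Vinberg monoid is $S_G=\operatorname{Spec}\mathbb{C}[S_G]$, where $$\mathbb{C}[S_G]=\bigoplus_{(\lambda,\mu)}\mathbb{C}[G_{\mathrm{enh}}]_{(\lambda,\mu)},$$ the sum being over the pairs with $\lambda$ dominant, $\mu-\lambda\in\mathfrak{W}$ and $\mu-\lambda=\sum_i m_i\alpha_i$ with all $m_i\in[0,\infty)$. Its abelization is the affine GIT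 quotient $\pi_G:S_G\to\mathbb{A}_G:=S_G/\!\!/(G\times G)=\operatorname{Spec}\mathbb{C}[S_G]^{G\times G}$. Let $h:\mathbb{C}^\times\to T$ be a dominant cocharacter, i.e. $\alpha(h)\geq 0$ for all positive roots $\alpha$, where $\lambda(h)\in\mathbb{Z}$ denotes the integer with $\lambda(h(z))=z^{\lambda(h)}$. For $m\in\mathbb{Z}$ put $\mathcal{F}^h_{\leq m}=\bigoplus_{\lambda(h)\leq m}\mathbb{C}[G]_\lambda$, and let $R_h=\bigoplus_{m\in\mathbb{Z}}\mathcal{F}^h_{\leq m}\,t^m\subset\mathbb{C}[G][t,t^{-1}]$ be the Rees algebra, a $\mathbb{C}[t]$-algebra. Then $\mathbb{C}[S_G]$ and $R_h$ are indeed subalgebras of the algebras of functions on $G_{\mathrm{enh}}$ and of Laurent polynomials over $\mathbb{C}[G]$, respectively; the map $\mathbb{C}^\times\to\mathbb{A}_G$, $z\mapsto\pi_G([1,h(z)])$, extends (uniquely) to a morphism of monoids $\mathbb{A}^1\to\mathbb{A}_G$; and the horospherical degeneration $\operatorname{Spec}R_h\to\mathbb{A}^1=\operatorname{Spec}\mathbb{C}[t]$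 is isomorphic, over $\mathbb{A}^1$, to the base change $\pi_h:\mathbb{A}^1\times_{\mathbb{A}_G}S_G\to\mathbb{A}^1$ of $\pi_G$ along this morphism. -/

import Mathlib

noncomputable section

open Matrix Polynomial
open scoped TensorProduct NNReal

namespace Vinberg

/-! ### Linear algebraic groups over `ℂ` -/

section LinearAlgebraicGroups

variable {n : ℕ}

/-- The value of a polynomial in the `n²` matrix entries at a matrix. -/
def evalMatrix (p : MvPolynomial (Fin n × Fin n) ℂ) (M : Matrix (Fin n) (Fin n) ℂ) : ℂ :=
  MvPolynomial.eval (fun ij => M ij.1 ij.2) p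

/-- A subgroup of `GL_n(ℂ)` is Zariski closed if it is cut out by polynomials in the entries. -/
def IsZariskiClosed (H : Subgroup (GL (Fin n) ℂ)) : Prop :=
  ∃ I : Set (MvPolynomial (Fin n × Fin n) ℂ),
    ∀ g : GL (Fin n) ℂ, g ∈ H ↔ ∀ p ∈ I, evalMatrix p (g : Matrix (Fin n) (Fin n) ℂ) = 0

/-- The algebra of regular functions on a group `H` that is embedded in `GL_n(ℂ)` by `ι`: it is
generated by the matrix entries and by `det⁻¹`. -/
def regularFunctions {H : Type} [Group H] (ι : H →* GL (Fin n) ℂ) : Subalgebra ℂ (H → ℂ) :=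
  Algebra.adjoin ℂ
    (Set.range (fun (ij : Fin n × Fin n) (g : H) => (ι g : Matrix (Fin n) (Fin n) ℂ) ij.1 ij.2) ∪
      {fun g : H => ((ι g : Matrix (Fin n) (Fin n) ℂ).det)⁻¹})

/-- The coordinate ring `ℂ[G]`. -/
abbrev coordRing (G : Subgroup (GL (Fin n) ℂ)) : Subalgebra ℂ (G → ℂ) :=
  regularFunctions G.subtype

/-- Connectedness. For algebraic groups this is the same as irreducibility, i.e. the coordinate
ring being an integral domain. -/
def IsConnectedGroup (G : Subgroup (GL (Fin n) ℂ)) : Prop :=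
  IsDomain (coordRing G)

/-- The Lie algebra of `G` as a subset of `gl_n`: the Zariski tangent space at the identity. -/
def lieAlgebra (G : Subgroup (GL (Fin n) ℂ)) : Set (Matrix (Fin n) (Fin n) ℂ) :=
  {X | ∀ p : MvPolynomial (Fin n × Fin n) ℂ,
    (∀ g ∈ G, evalMatrix p (g : Matrix (Fin n) (Fin n) ℂ) = 0) →
      ∑ ij : Fin n × Fin n, X ij.1 ij.2 * evalMatrix (MvPolynomial.pderiv ij p) 1 = 0}

end LinearAlgebraicGroups

/-! ### Rational representations, weights, matrix coefficients -/

section Weights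

/-- The group of characters `S → ℂˣ` of a group `S`, written additively. It is applied to tori,
where only regular characters will occur: all weights of rational representations are regular. -/
def Weight (S : Type) [Group S] : Type := Additive (S →* ℂˣ)

variable {S : Type} [Group S]

instance : AddCommGroup (Weight S) := inferInstanceAs (AddCommGroup (Additive (S →* ℂˣ)))

/-- The character underlying a weight. -/
def Weight.toHom (χ : Weight S) : S →* ℂˣ := Additive.toMul (χ : Additive (S →* ℂˣ))

/-- A character as a weight. -/
def Weight.ofHom (χ : S →* ℂˣ) : Weight S := Additive.ofMul χ

theorem Weight.toHom_zero (s : S) : (0 : Weight S).toHom s = 1 := rfl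

end Weights

section Representations

variable {H : Type} [Group H] {V : Type} [AddCommGroup V] [Module ℂ V]

/-- The matrix coefficient `g ↦ φ (ρ(g) v)`. -/
def matrixCoeff (ρ : Representation ℂ H V) (φ : Module.Dual ℂ V) (v : V) : H → ℂ :=
  fun g => φ (ρ g v)

/-- A finite-dimensional representation of `H` is rational with respect to an algebra `O` of
functions on `H` if its matrix coefficients lie in `O`. -/
def IsRational (O : Subalgebra ℂ (H → ℂ)) (ρ : Representation ℂ H V) : Prop :=
  FiniteDimensional ℂ V ∧ ∀ (φ : Module.Dual ℂ V) (v : V), matrixCoeff ρ φ v ∈ O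

/-- `χ` is a weight of `ρ` for the (image under `j` of the) torus `S`. -/
def IsWeight {S : Type} [Group S] (j : S →* H) (ρ : Representation ℂ H V) (χ : Weight S) : Prop :=
  ∃ v : V, v ≠ 0 ∧ ∀ s : S, ρ (j s) v = (χ.toHom s : ℂ) • v

/-- `χ` is the highest weight of `ρ` with respect to the set `P` of positive roots: it is a weight,
and for every weight `ψ` the difference of `χ` and `ψ` is a sum of positive roots. -/
def IsHighestWeight {S : Type} [Group S] (j : S →* H) (P : Set (Weight S))
    (ρ : Representation ℂ H V) (χ : Weight S) : Prop :=
  IsWeight j ρ χ ∧ ∀ ψ : Weight S, IsWeight j ρ ψ → χ - ψ ∈ AddSubmonoid.closure P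

/-- The space of functions on `H` spanned by the matrix coefficients of the irreducible rational
representations with highest weight `χ`. It is zero if `χ` is not the highest weight of an
irreducible representation, i.e. if `χ` is not dominant. -/
def matrixCoeffs (O : Subalgebra ℂ (H → ℂ)) {S : Type} [Group S] (j : S →* H)
    (P : Set (Weight S)) (χ : Weight S) : Submodule ℂ (H → ℂ) :=
  Submodule.span ℂ
    {f | ∃ (V : Type) (_ : AddCommGroup V) (_ : Module ℂ V) (ρ : Representation ℂ H V)
        (φ : Module.Dual ℂ V) (v : V),
      IsRational O ρ ∧ ρ.IsIrreducible ∧ IsHighestWeight j P ρ χ ∧ f = matrixCoeff ρ φ v}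

/-- The constant function `1` is a matrix coefficient of the trivial representation. -/
theorem one_mem_matrixCoeffs (O : Subalgebra ℂ (H → ℂ)) {S : Type} [Group S] (j : S →* H)
    (P : Set (Weight S)) : (1 : H → ℂ) ∈ matrixCoeffs O j P 0 := by
  refine Submodule.subset_span ⟨ℂ, inferInstance, inferInstance,
    Representation.trivial ℂ H ℂ, LinearMap.id, 1, ⟨inferInstance, ?_⟩, ?_, ⟨?_, ?_⟩, ?_⟩
  · intro φ v
    exact O.algebraMap_mem (φ v)
  · refine { exists_pair_ne := ⟨⊥, ⊤, ?_⟩, eq_bot_or_eq_top := ?_ }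
    · intro h
      have h1 : (1 : ℂ) ∈ (⊥ : Subrepresentation (Representation.trivial ℂ H ℂ)) := by
        rw [h]; trivial
      exact one_ne_zero (show (1 : ℂ) = 0 from h1)
    · intro W
      rcases eq_bot_or_eq_top W.toSubmodule with h | h
      · left
        exact Subrepresentation.toSubmodule_injective h
      · right
        exact Subrepresentation.toSubmodule_injective h
  · exact ⟨1, one_ne_zero, fun s => by simp [Weight.toHom_zero]⟩
  · rintro ψ ⟨v, hv, h⟩
    have h0 : ψ = 0 := by
      refine MonoidHom.ext (M := S) (N := ℂˣ) (f := ψ.toHom) (g := (0 : Weight S).toHom) fun s => ?_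
      have h2 : v = (ψ.toHom s : ℂ) * v := by simpa using h s
      have h3 : ((ψ.toHom s : ℂ) - 1) * v = 0 := by rw [sub_mul, ← h2]; ring
      rw [Weight.toHom_zero]
      simpa [sub_eq_zero, hv] using h3
    rw [h0, sub_zero]
    exact AddSubmonoid.zero_mem _
  · rfl

end Representations

/-! ### Reductive groups, roots, cocharacters -/

section Roots

variable {n : ℕ}

/-- Linear reductivity: every rational representation is completely reducible. -/
def IsLinearlyReductive (G : Subgroup (GL (Fin n) ℂ)) : Prop :=
  ∀ (V : Type) [AddCommGroup V] [Module ℂ V] (ρ : Representation ℂ G V),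
    IsRational (coordRing G) ρ → ρ.IsSemisimpleRepresentation

variable {G : Subgroup (GL (Fin n) ℂ)}

/-- A torus in `G`: a Zariski closed connected subgroup that can be diagonalized. -/
def IsTorus (T : Subgroup G) : Prop :=
  IsZariskiClosed (T.map G.subtype) ∧ IsConnectedGroup (T.map G.subtype) ∧
    ∃ Q : GL (Fin n) ℂ, ∀ t : G, t ∈ T →
      ((Q * (t : GL (Fin n) ℂ) * Q⁻¹ : GL (Fin n) ℂ) : Matrix (Fin n) (Fin n) ℂ).IsDiag

/-- A maximal torus of `G`. -/
def IsMaximalTorus (T : Subgroup G) : Prop :=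
  IsTorus T ∧ ∀ T' : Subgroup G, IsTorus T' → T ≤ T' → T' = T

/-- The roots of `G` with respect to `T`: the non-trivial weights of `T` on the Lie algebra. -/
def roots (T : Subgroup G) : Set (Weight T) :=
  {α | α ≠ 0 ∧ ∃ X ∈ lieAlgebra G, X ≠ 0 ∧ ∀ t : T,
    (((t : G) : GL (Fin n) ℂ) : Matrix (Fin n) (Fin n) ℂ) * X *
      ((((t : G) : GL (Fin n) ℂ)⁻¹ : GL (Fin n) ℂ) : Matrix (Fin n) (Fin n) ℂ) = (α.toHom t : ℂ) • X}

/-- A cocharacter of `T`: a homomorphism `ℂˣ → T` whose entries are Laurent polynomials. -/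
def IsCocharacter {T : Subgroup G} (h : ℂˣ →* T) : Prop :=
  ∀ i k : Fin n, ∃ p : LaurentPolynomial ℂ, ∀ z : ℂˣ,
    (((h z : G) : GL (Fin n) ℂ) : Matrix (Fin n) (Fin n) ℂ) i k =
      LaurentPolynomial.eval₂ (RingHom.id ℂ) z p

open Classical in
/-- The pairing `χ(h)` of a character and a cocharacter, the integer `k` with `χ(h(z)) = z ^ k`.
It exists for all regular characters and all cocharacters. -/
def pairing {T : Subgroup G} (χ : Weight T) (h : ℂˣ →* T) : ℤ :=
  if H : ∃ k : ℤ, ∀ z : ℂˣ, χ.toHom (h z) = z ^ k then H.choose else 0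

theorem pairing_zero {T : Subgroup G} (h : ℂˣ →* T) : pairing 0 h = 0 := by
  have H : ∃ k : ℤ, ∀ z : ℂˣ, (0 : Weight T).toHom (h z) = z ^ k :=
    ⟨0, fun z => by simp [Weight.toHom_zero]⟩
  have hk := H.choose_spec (Units.mk0 2 two_ne_zero)
  rw [pairing, dif_pos H]
  have h2 : (2 : ℝ) ^ H.choose = 1 := by
    have := congrArg (fun u : ℂˣ => ‖(u : ℂ)‖) hk
    simpa [Weight.toHom_zero] using this.symm
  exact (zpow_eq_one_iff_right₀ (by norm_num) (by norm_num)).1 h2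

/-- A system of positive roots, i.e. the choice of a Weyl chamber: the roots that are positive on
some regular cocharacter. -/
def IsPositiveSystem (T : Subgroup G) (P : Set (Weight T)) : Prop :=
  ∃ c : ℂˣ →* T, IsCocharacter c ∧ (∀ α ∈ roots T, pairing α c ≠ 0) ∧
    P = {α ∈ roots T | 0 < pairing α c}

/-- The cocharacter `h` lies in the closed dual Weyl chamber. -/
def IsDominant {T : Subgroup G} (P : Set (Weight T)) (h : ℂˣ →* T) : Prop :=
  ∀ α ∈ P, 0 ≤ pairing α h

/-- The simple roots: the positive roots that are not the sum of two positive roots. -/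
def simpleRoots {T : Subgroup G} (P : Set (Weight T)) : Set (Weight T) :=
  {α ∈ P | ¬ ∃ β ∈ P, ∃ γ ∈ P, α = β + γ}

/-- The root lattice. -/
def rootLattice {T : Subgroup G} (P : Set (Weight T)) : AddSubgroup (Weight T) :=
  AddSubgroup.closure (simpleRoots P)

/-- The image of a character in the real vector space spanned by the characters. -/
def realWeight {T : Subgroup G} (χ : Weight T) : ℝ ⊗[ℤ] Weight T :=
  (1 : ℝ) ⊗ₜ[ℤ] χ

/-- `χ` lies in the cone of combinations of simple roots with coefficients in `[0, ∞)`. -/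
def InRootCone {T : Subgroup G} (P : Set (Weight T)) (χ : Weight T) : Prop :=
  realWeight χ ∈ Submodule.span ℝ≥0 (realWeight '' simpleRoots P)

end Roots

/-! ### The horospherical degeneration -/

section Rees

variable {n : ℕ} {G : Subgroup (GL (Fin n) ℂ)} {T : Subgroup G}

/-- `ℂ[G]_λ`, spanned by the matrix coefficients of the irreducible representation of `G` with
highest weight `lam`. -/
def isotypic (P : Set (Weight T)) (lam : Weight T) : Submodule ℂ (G → ℂ) :=
  matrixCoeffs (coordRing G) T.subtype P lam

/-- The filtration `F^h` on `ℂ[G]`: the sum of the `ℂ[G]_λ` with `λ(h) ≤ m`. -/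
def filtration (P : Set (Weight T)) (h : ℂˣ →* T) (m : ℤ) : Submodule ℂ (G → ℂ) :=
  ⨆ (lam : Weight T) (_ : pairing lam h ≤ m), isotypic P lam

/-- The Rees module `⨁_{m ∈ ℤ} F^h_{≤ m}`, as the space of Laurent polynomials with function
coefficients whose `m`-th coefficient lies in `F^h_{≤ m}`. -/
def reesModule (P : Set (Weight T)) (h : ℂˣ →* T) :
    Submodule ℂ (LaurentPolynomial (G → ℂ)) where
  carrier := {p | ∀ m : ℤ, p.coeff m ∈ filtration P h m}
  zero_mem' := fun m => (filtration P h m).zero_mem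
  add_mem' := fun hp hq m => (filtration P h m).add_mem (hp m) (hq m)
  smul_mem' := fun c _ hp m => (filtration P h m).smul_mem c (hp m)

/-- The Rees algebra of `F^h`: the subalgebra with underlying space `reesModule P h` (in general
one would have to generate a subalgebra by this space; here nothing is added, which is part of
the theorem). -/
def reesAlgebra (P : Set (Weight T)) (h : ℂˣ →* T) :
    Subalgebra ℂ (LaurentPolynomial (G → ℂ)) :=
  Algebra.adjoin ℂ (reesModule P h : Set (LaurentPolynomial (G → ℂ)))

theorem T_mem_reesAlgebra (P : Set (Weight T)) (h : ℂˣ →* T) :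
    (LaurentPolynomial.T 1 : LaurentPolynomial (G → ℂ)) ∈ reesAlgebra P h := by
  refine Algebra.subset_adjoin ?_
  intro m
  by_cases hm : m = 1
  · subst hm
    have h1 : (LaurentPolynomial.T 1 : LaurentPolynomial (G → ℂ)).coeff 1 = 1 := by
      simp [LaurentPolynomial.T, -LaurentPolynomial.single_eq_C_mul_T]
    rw [h1]
    refine Submodule.mem_iSup_of_mem 0 (Submodule.mem_iSup_of_mem ?_ ?_)
    · rw [pairing_zero]; norm_num
    · exact one_mem_matrixCoeffs _ _ _
  · have h0 : (LaurentPolynomial.T 1 : LaurentPolynomial (G → ℂ)).coeff m = 0 := by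
      simp [LaurentPolynomial.T, -LaurentPolynomial.single_eq_C_mul_T, Ne.symm hm]
    rw [h0]
    exact Submodule.zero_mem _

/-- The `ℂ[t]`-algebra structure of the Rees algebra: `t` maps the copy of `F^h_{≤ m}` in degree
`m` identically into degree `m + 1`. -/
def reesStructureMap (P : Set (Weight T)) (h : ℂˣ →* T) : ℂ[X] →ₐ[ℂ] reesAlgebra P h :=
  Polynomial.aeval ⟨LaurentPolynomial.T 1, T_mem_reesAlgebra P h⟩

end Rees

/-! ### The Vinberg monoid and its abelization -/

section VinbergMonoid

variable {n : ℕ} {G : Subgroup (GL (Fin n) ℂ)}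

/-- The center of `G`, embedded anti-diagonally in `G × T`. -/
def antidiagonalCenter (T : Subgroup G) : Subgroup (G × T) where
  carrier := {x | x.1 ∈ Subgroup.center G ∧ x.1 * (x.2 : G) = 1}
  one_mem' := ⟨Subgroup.one_mem _, by simp⟩
  mul_mem' := by
    rintro ⟨a, s⟩ ⟨b, t⟩ ⟨ha, hs⟩ ⟨hb, ht⟩
    refine ⟨Subgroup.mul_mem _ ha hb, ?_⟩
    simp only [Prod.mk_mul_mk, Subgroup.coe_mul] at *
    have hc := Subgroup.mem_center_iff.1 hb (s : G)
    rw [mul_assoc, ← mul_assoc b, ← hc, mul_assoc (s : G), ht, mul_one, hs]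
  inv_mem' := by
    rintro ⟨a, s⟩ ⟨ha, hs⟩
    refine ⟨Subgroup.inv_mem _ ha, ?_⟩
    simp only [Prod.inv_mk, Subgroup.coe_inv] at *
    rw [← _root_.mul_inv_rev, Subgroup.mem_center_iff.1 ha (s : G), hs, inv_one]

instance (T : Subgroup G) : (antidiagonalCenter T).Normal where
  conj_mem := by
    rintro ⟨a, s⟩ ⟨ha, hs⟩ ⟨g, t⟩
    simp only at hs ha
    have hsa : (s : G) = a⁻¹ := eq_inv_of_mul_eq_one_right hs
    have hg : g * a * g⁻¹ = a := by rw [Subgroup.mem_center_iff.1 ha g]; simp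
    refine ⟨?_, ?_⟩
    · simpa [hg] using ha
    · have ht : (t : G) * a⁻¹ * (t : G)⁻¹ = a⁻¹ := by
        rw [Subgroup.mem_center_iff.1 (Subgroup.inv_mem _ ha) (t : G)]; simp
      simp [hg, hsa, ht]

/-- The enhanced group `G_enh = (G × T) / Z_G`. -/
abbrev EnhancedGroup (T : Subgroup G) : Type := (G × T) ⧸ antidiagonalCenter T

/-- The quotient map `G × T → G_enh`. -/
abbrev toEnhanced (T : Subgroup G) : G × T →* EnhancedGroup T :=
  QuotientGroup.mk' (antidiagonalCenter T)

/-- The coordinate ring `ℂ[G × T]`, generated by the regular functions on the two factors. -/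
def prodCoordRing (T : Subgroup G) : Subalgebra ℂ (G × T → ℂ) :=
  Algebra.adjoin ℂ
    ({f | ∃ a ∈ coordRing G, f = fun x => a x.1} ∪
      {f | ∃ b ∈ regularFunctions (G.subtype.comp T.subtype), f = fun x => b x.2})

/-- The coordinate ring of `G_enh`: the functions whose pullback to `G × T` is regular. -/
def enhancedCoordRing (T : Subgroup G) : Subalgebra ℂ (EnhancedGroup T → ℂ) where
  carrier := {f | f ∘ toEnhanced T ∈ prodCoordRing T}
  mul_mem' := fun ha hb => (prodCoordRing T).mul_mem ha hb
  add_mem' := fun ha hb => (prodCoordRing T).add_mem ha hb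
  algebraMap_mem' := fun c => (prodCoordRing T).algebraMap_mem c

variable {T : Subgroup G}

/-- The character `(s, t) ↦ λ(s) μ(t)` of `T × T`. -/
def pairWeight (lam mu : Weight T) : Weight (T × T) :=
  Weight.ofHom (MonoidHom.coprod lam.toHom mu.toHom)

/-- The homomorphism from `T × T` onto the maximal torus `(T × T) / Z_G` of `G_enh`. -/
def enhancedTorus (T : Subgroup G) : T × T →* EnhancedGroup T :=
  (toEnhanced T).comp (MonoidHom.prodMap T.subtype (MonoidHom.id T))

/-- `ℂ[G_enh]_{(λ, μ)}`, spanned by the matrix coefficients of the irreducible representation of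
`G_enh` with highest weight `(λ, μ)`. The positive roots of `G_enh` are the `(α, 0)` with `α` a
positive root of `G`. -/
def enhancedIsotypic (P : Set (Weight T)) (lam mu : Weight T) :
    Submodule ℂ (EnhancedGroup T → ℂ) :=
  matrixCoeffs (enhancedCoordRing T) (enhancedTorus T) ((fun α => pairWeight α 0) '' P)
    (pairWeight lam mu)

/-- The sum of the `ℂ[G_enh]_{(λ, μ)}` for which `μ - λ` lies in the root lattice and is a
combination of simple roots with non-negative coefficients. -/
def vinbergModule (P : Set (Weight T)) : Submodule ℂ (EnhancedGroup T → ℂ) :=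
  ⨆ (lam : Weight T) (mu : Weight T) (_ : mu - lam ∈ rootLattice P)
    (_ : InRootCone P (mu - lam)), enhancedIsotypic P lam mu

/-- The coordinate ring `ℂ[S_G]` of the Vinberg monoid: the subalgebra of `ℂ[G_enh]` with
underlying space `vinbergModule P` (again, that the generated subalgebra is not larger than this
space is part of the theorem). -/
def vinbergAlgebra (P : Set (Weight T)) : Subalgebra ℂ (EnhancedGroup T → ℂ) :=
  Algebra.adjoin ℂ (vinbergModule P : Set (EnhancedGroup T → ℂ))

/-- The coordinate ring `ℂ[𝔸_G]` of the affine GIT quotient `S_G // (G × G)`: the functions in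
`ℂ[S_G]` that are invariant under left and right multiplication by `G`. -/
def abelizationAlgebra (P : Set (Weight T)) : Subalgebra ℂ (vinbergAlgebra P) where
  carrier := {F | ∀ (a b : G) (x : EnhancedGroup T),
    (F : EnhancedGroup T → ℂ) (toEnhanced T (a, 1) * x * toEnhanced T (b, 1)) =
      (F : EnhancedGroup T → ℂ) x}
  mul_mem' := fun hF hF' a b x => congrArg₂ (· * ·) (hF a b x) (hF' a b x)
  add_mem' := fun hF hF' a b x => congrArg₂ (· + ·) (hF a b x) (hF' a b x)
  algebraMap_mem' := fun _ _ _ _ => rfl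

/-- The value at a point of `G_enh ⊆ S_G` of a function on `𝔸_G`, pulled back to `S_G`. -/
def abelEval {P : Set (Weight T)} (F : abelizationAlgebra P) (x : EnhancedGroup T) : ℂ :=
  ((F : vinbergAlgebra P) : EnhancedGroup T → ℂ) x

/-- The morphism `𝔸¹ → 𝔸_G` with comorphism `θ` extends the morphism `ℂˣ → T → T / Z_G ⊆ 𝔸_G`
given by `h`. There is at most one such `θ`, as `ℂˣ` is dense in `𝔸¹`. -/
def IsInducedBy {P : Set (Weight T)} (h : ℂˣ →* T) (θ : abelizationAlgebra P →ₐ[ℂ] ℂ[X]) : Prop :=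
  ∀ (F : abelizationAlgebra P) (z : ℂˣ), (θ F).eval (z : ℂ) = abelEval F (toEnhanced T (1, h z))

/-- The morphism `𝔸¹ → 𝔸_G` with comorphism `θ` is a homomorphism of monoids, for multiplication
on `𝔸¹` and for the multiplication on `𝔸_G` that is induced by the one of `S_G`. -/
def IsMonoidMorphism {P : Set (Weight T)} (θ : abelizationAlgebra P →ₐ[ℂ] ℂ[X]) : Prop :=
  ∀ F : abelizationAlgebra P, (θ F).eval 1 = abelEval F 1 ∧
    ∃ (d : ℕ) (a b : Fin d → abelizationAlgebra P),
      (∀ x y : EnhancedGroup T, abelEval F (x * y) = ∑ i, abelEval (a i) x * abelEval (b i) y) ∧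
      ∀ z w : ℂ, (θ F).eval (z * w) = ∑ i, (θ (a i)).eval z * (θ (b i)).eval w

end VinbergMonoid

/-! ### The families over the affine line -/

section Families

open AlgebraicGeometry CategoryTheory

variable {n : ℕ} {G : Subgroup (GL (Fin n) ℂ)} {T : Subgroup G}

/-- The affine line over `ℂ`. -/
abbrev affineLine : Scheme.{0} := Spec (CommRingCat.of ℂ[X])

/-- The horospherical degeneration of `G` given by `h`: the spectrum of the Rees algebra, as a
family over the affine line. -/
def reesFamily (P : Set (Weight T)) (h : ℂˣ →* T) :
    Spec (CommRingCat.of (reesAlgebra P h)) ⟶ affineLine :=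
  Spec.map (CommRingCat.ofHom (reesStructureMap P h).toRingHom)

/-- The Vinberg monoid `S_G`. -/
abbrev vinbergMonoid (P : Set (Weight T)) : Scheme.{0} :=
  Spec (CommRingCat.of (vinbergAlgebra P))

/-- The base `𝔸_G = S_G // (G × G)`. -/
abbrev abelBase (P : Set (Weight T)) : Scheme.{0} :=
  Spec (CommRingCat.of (abelizationAlgebra P))

/-- The abelization `π_G : S_G → 𝔸_G`. -/
def abelization (P : Set (Weight T)) : vinbergMonoid P ⟶ abelBase P :=
  Spec.map (CommRingCat.ofHom (abelizationAlgebra P).val.toRingHom)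

/-- The morphism `𝔸¹ → 𝔸_G` with comorphism `θ`. -/
def lineMap {P : Set (Weight T)} (θ : abelizationAlgebra P →ₐ[ℂ] ℂ[X]) :
    affineLine ⟶ abelBase P :=
  Spec.map (CommRingCat.ofHom θ.toRingHom)

end Families

end Vinberg

end

noncomputable section

open Matrix Polynomial
open scoped TensorProduct NNReal

namespace Vinberg

/-! ### The Lie algebra as the space of velocities of one-parameter subgroups -/

section LieAlgebra

variable {n : ℕ}

/-- The matrix underlying an element of `G`. -/
def toMat {G : Subgroup (GL (Fin n) ℂ)} (g : G) : Matrix (Fin n) (Fin n) ℂ :=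
  ((g : GL (Fin n) ℂ) : Matrix (Fin n) (Fin n) ℂ)

theorem toMat_mul {G : Subgroup (GL (Fin n) ℂ)} (a b : G) : toMat (a * b) = toMat a * toMat b := rfl

theorem toMat_one {G : Subgroup (GL (Fin n) ℂ)} : toMat (1 : G) = 1 := rfl

theorem toMat_mul_inv {G : Subgroup (GL (Fin n) ℂ)} (a : G) : toMat a * toMat a⁻¹ = 1 := by
  rw [← toMat_mul, mul_inv_cancel, toMat_one]

theorem toMat_inv_mul {G : Subgroup (GL (Fin n) ℂ)} (a : G) : toMat a⁻¹ * toMat a = 1 := by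
  rw [← toMat_mul, inv_mul_cancel, toMat_one]

theorem isUnit_det_toMat {G : Subgroup (GL (Fin n) ℂ)} (a : G) : IsUnit (toMat a).det :=
  (Matrix.isUnit_iff_isUnit_det _).1 (Units.isUnit (a : GL (Fin n) ℂ))

/-- A matrix-valued curve has entrywise derivative `X` at `t`. -/
def HasMatDeriv (M : ℂ → Matrix (Fin n) (Fin n) ℂ) (X : Matrix (Fin n) (Fin n) ℂ) (t : ℂ) : Prop :=
  ∀ i j, HasDerivAt (fun s => M s i j) (X i j) t

theorem HasMatDeriv.const_mul {M : ℂ → Matrix (Fin n) (Fin n) ℂ} {X : Matrix (Fin n) (Fin n) ℂ}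
    {t : ℂ} (h : HasMatDeriv M X t) (A : Matrix (Fin n) (Fin n) ℂ) :
    HasMatDeriv (fun s => A * M s) (A * X) t := fun i j => by
  simp only [Matrix.mul_apply]
  exact HasDerivAt.fun_sum fun k _ => (h k j).const_mul _

theorem HasMatDeriv.mul_const {M : ℂ → Matrix (Fin n) (Fin n) ℂ} {X : Matrix (Fin n) (Fin n) ℂ}
    {t : ℂ} (h : HasMatDeriv M X t) (A : Matrix (Fin n) (Fin n) ℂ) :
    HasMatDeriv (fun s => M s * A) (X * A) t := fun i j => by
  simp only [Matrix.mul_apply]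
  exact HasDerivAt.fun_sum fun k _ => (h i k).mul_const _

theorem HasMatDeriv.mul {M N : ℂ → Matrix (Fin n) (Fin n) ℂ} {X Y : Matrix (Fin n) (Fin n) ℂ}
    {t : ℂ} (hM : HasMatDeriv M X t) (hN : HasMatDeriv N Y t) :
    HasMatDeriv (fun s => M s * N s) (X * N t + M t * Y) t := fun i j => by
  simp only [Matrix.mul_apply, Matrix.add_apply, ← Finset.sum_add_distrib]
  exact HasDerivAt.fun_sum fun k _ => (hM i k).mul (hN k j)

theorem hasDerivAt_evalMatrix {M : ℂ → Matrix (Fin n) (Fin n) ℂ} {X : Matrix (Fin n) (Fin n) ℂ}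
    {t : ℂ} (h : HasMatDeriv M X t) (p : MvPolynomial (Fin n × Fin n) ℂ) :
    HasDerivAt (fun s => evalMatrix p (M s))
      (∑ ij : Fin n × Fin n, X ij.1 ij.2 * evalMatrix (MvPolynomial.pderiv ij p) (M t)) t := by
  classical
  induction p using MvPolynomial.induction_on with
  | C a => simpa [evalMatrix] using hasDerivAt_const t a
  | add p q hp hq =>
    simpa [evalMatrix, mul_add, Finset.sum_add_distrib] using hp.fun_add hq
  | mul_X p kl hp =>
    have := hp.mul (h kl.1 kl.2)
    simp only [evalMatrix, map_mul, MvPolynomial.eval_X] at this ⊢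
    refine this.congr_deriv ?_
    simp only [MvPolynomial.pderiv_mul, map_add, map_mul, MvPolynomial.eval_X,
      MvPolynomial.pderiv_X,
      mul_add, Finset.sum_add_distrib, Finset.sum_mul]
    congr 1
    · exact Finset.sum_congr rfl fun _ _ => by ring
    · rw [Finset.sum_eq_single kl]
      · simp [mul_comm]
      · intro b _ hb; simp [hb.symm]
      · simp

/-- The derivative of `p` along the left-invariant vector field given by `X`. -/
def vectorField (X : Matrix (Fin n) (Fin n) ℂ) (p : MvPolynomial (Fin n × Fin n) ℂ) :
    MvPolynomial (Fin n × Fin n) ℂ :=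
  ∑ ij : Fin n × Fin n, (∑ k, MvPolynomial.X (ij.1, k) * MvPolynomial.C (X k ij.2)) *
    MvPolynomial.pderiv ij p

theorem evalMatrix_vectorField (X M : Matrix (Fin n) (Fin n) ℂ)
    (p : MvPolynomial (Fin n × Fin n) ℂ) :
    evalMatrix (vectorField X p) M =
      ∑ ij : Fin n × Fin n, (M * X) ij.1 ij.2 * evalMatrix (MvPolynomial.pderiv ij p) M := by
  simp [evalMatrix, vectorField, Matrix.mul_apply]

/-- The polynomial `y ↦ p (A y)`. -/
def translatePoly (A : Matrix (Fin n) (Fin n) ℂ) (p : MvPolynomial (Fin n × Fin n) ℂ) :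
    MvPolynomial (Fin n × Fin n) ℂ :=
  MvPolynomial.bind₁ (fun ij => ∑ k, MvPolynomial.C (A ij.1 k) * MvPolynomial.X (k, ij.2)) p

theorem evalMatrix_translatePoly (A M : Matrix (Fin n) (Fin n) ℂ)
    (p : MvPolynomial (Fin n × Fin n) ℂ) :
    evalMatrix (translatePoly A p) M = evalMatrix p (A * M) := by
  simp only [evalMatrix, translatePoly]
  rw [MvPolynomial.eval, MvPolynomial.eval₂Hom_bind₁]
  simp [Matrix.mul_apply]

variable {G : Subgroup (GL (Fin n) ℂ)}

/-- The polynomials that vanish on `G`. -/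
def Vanishes (G : Subgroup (GL (Fin n) ℂ)) (p : MvPolynomial (Fin n × Fin n) ℂ) : Prop :=
  ∀ g ∈ G, evalMatrix p (g : Matrix (Fin n) (Fin n) ℂ) = 0

theorem hasMatDeriv_line (X : Matrix (Fin n) (Fin n) ℂ) (t : ℂ) :
    HasMatDeriv (fun s => 1 + s • X) X t := fun i j => by
  simpa using ((hasDerivAt_id t).mul_const (X i j)).const_add ((1 : Matrix _ _ ℂ) i j)

theorem Vanishes.vectorField {p : MvPolynomial (Fin n × Fin n) ℂ} (hp : Vanishes G p)
    {X : Matrix (Fin n) (Fin n) ℂ} (hX : X ∈ lieAlgebra G) : Vanishes G (vectorField X p) := by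
  intro g hg
  set A : Matrix (Fin n) (Fin n) ℂ := (g : Matrix (Fin n) (Fin n) ℂ)
  have h1 : Vanishes G (translatePoly A p) := fun a ha => by
    rw [evalMatrix_translatePoly]
    exact hp (g * a) (G.mul_mem hg ha)
  have h2 := hasDerivAt_evalMatrix (hasMatDeriv_line X 0) (translatePoly A p)
  have h3 := hasDerivAt_evalMatrix ((hasMatDeriv_line X 0).const_mul A) p
  simp only [evalMatrix_translatePoly] at h2
  have h4 := h3.unique h2
  simp only [zero_smul, add_zero, mul_one] at h4
  rw [evalMatrix_vectorField, h4]
  exact hX _ h1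

section Exp

open scoped Matrix.Norms.Operator

theorem hasMatDeriv_exp (X : Matrix (Fin n) (Fin n) ℂ) (t : ℂ) :
    HasMatDeriv (fun s => NormedSpace.exp (s • X)) (NormedSpace.exp (t • X) * X) t := fun i j => by
  have h := hasDerivAt_exp_smul_const X t
  exact (LinearMap.toContinuousLinearMap
    (Matrix.entryLinearMap ℂ ℂ i j : Matrix (Fin n) (Fin n) ℂ →ₗ[ℂ] ℂ)).hasFDerivAt.comp_hasDerivAt
      t h

/-- The matrix exponential as an element of `GL_n`. -/
def expUnit (X : Matrix (Fin n) (Fin n) ℂ) : GL (Fin n) ℂ := (Matrix.isUnit_exp X).unit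

theorem coe_expUnit (X : Matrix (Fin n) (Fin n) ℂ) :
    (expUnit X : Matrix (Fin n) (Fin n) ℂ) = NormedSpace.exp X := rfl

theorem expUnit_add_smul (X : Matrix (Fin n) (Fin n) ℂ) (s t : ℂ) :
    expUnit ((s + t) • X) = expUnit (s • X) * expUnit (t • X) := by
  ext1
  rw [Units.val_mul, coe_expUnit, coe_expUnit, coe_expUnit, add_smul, Matrix.exp_add_of_commute]
  exact (Commute.refl X).smul_left s |>.smul_right t

theorem iteratedDeriv_evalMatrix_exp (X : Matrix (Fin n) (Fin n) ℂ) (k : ℕ)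
    (p : MvPolynomial (Fin n × Fin n) ℂ) :
    iteratedDeriv k (fun s : ℂ => evalMatrix p (NormedSpace.exp (s • X))) =
      fun s => evalMatrix ((vectorField X)^[k] p) (NormedSpace.exp (s • X)) := by
  induction k generalizing p with
  | zero => simp
  | succ k ih =>
    rw [iteratedDeriv_succ', Function.iterate_succ_apply, ← ih]
    congr 1
    ext t
    rw [(hasDerivAt_evalMatrix (hasMatDeriv_exp X t) p).deriv, evalMatrix_vectorField]

theorem expUnit_mem (hG : IsZariskiClosed G) {X : Matrix (Fin n) (Fin n) ℂ}
    (hX : X ∈ lieAlgebra G) (t : ℂ) : expUnit (t • X) ∈ G := by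
  obtain ⟨I, hI⟩ := hG
  rw [hI]
  intro p hp
  have hp' : Vanishes G p := fun g hg => (hI g).1 hg p hp
  have hk : ∀ k, Vanishes G ((vectorField X)^[k] p) := fun k => by
    induction k with
    | zero => exact hp'
    | succ k ih => rw [Function.iterate_succ_apply']; exact ih.vectorField hX
  have hd : Differentiable ℂ (fun s => evalMatrix p (NormedSpace.exp (s • X))) := fun t =>
    (hasDerivAt_evalMatrix (hasMatDeriv_exp X t) p).differentiableAt
  rw [coe_expUnit, ← Complex.taylorSeries_eq_of_entire hd 0 t]
  simp only [iteratedDeriv_evalMatrix_exp, zero_smul, NormedSpace.exp_zero]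
  have h1 : ∀ k, evalMatrix ((vectorField X)^[k] p) (1 : Matrix (Fin n) (Fin n) ℂ) = 0 :=
    fun k => hk k 1 G.one_mem
  simp [h1]

end Exp

/-- A one-parameter subgroup of `G` with velocity `X`. -/
structure IsFlow (γ : ℂ → G) (X : Matrix (Fin n) (Fin n) ℂ) : Prop where
  add : ∀ s t, γ (s + t) = γ s * γ t
  deriv : HasMatDeriv (fun s => toMat (γ s)) X 0

theorem IsFlow.zero {γ : ℂ → G} {X : Matrix (Fin n) (Fin n) ℂ} (h : IsFlow γ X) : γ 0 = 1 := by
  have := h.add 0 0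
  rw [add_zero] at this
  exact left_eq_mul.1 this

theorem IsFlow.neg {γ : ℂ → G} {X : Matrix (Fin n) (Fin n) ℂ} (h : IsFlow γ X) (t : ℂ) :
    γ (-t) = (γ t)⁻¹ := by
  rw [eq_inv_iff_mul_eq_one, ← h.add, neg_add_cancel, h.zero]

theorem exists_flow (hG : IsZariskiClosed G) {X : Matrix (Fin n) (Fin n) ℂ}
    (hX : X ∈ lieAlgebra G) : ∃ γ : ℂ → G, IsFlow γ X := by
  refine ⟨fun t => ⟨expUnit (t • X), expUnit_mem hG hX t⟩, fun s t => ?_, ?_⟩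
  · exact Subtype.ext (expUnit_add_smul X s t)
  · have := hasMatDeriv_exp X 0
    simp only [zero_smul, NormedSpace.exp_zero, one_mul] at this
    exact this

theorem mem_lieAlgebra_of_curve {γ : ℂ → G} {X : Matrix (Fin n) (Fin n) ℂ} (h0 : γ 0 = 1)
    (h : HasMatDeriv (fun s => toMat (γ s)) X 0) : X ∈ lieAlgebra G := by
  intro p hp
  have h1 := hasDerivAt_evalMatrix h p
  have h2 : (fun s => evalMatrix p (toMat (γ s))) = fun _ => 0 := funext fun s => hp _ (γ s).2
  rw [h2, h0] at h1
  exact h1.unique (hasDerivAt_const _ _)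

/-- The Lie algebra as a linear subspace. -/
def lieSubmodule (G : Subgroup (GL (Fin n) ℂ)) : Submodule ℂ (Matrix (Fin n) (Fin n) ℂ) where
  carrier := lieAlgebra G
  zero_mem' := fun p _ => by simp
  add_mem' := fun {X Y} hX hY p hp => by
    simpa [add_mul, Finset.sum_add_distrib] using congrArg₂ (· + ·) (hX p hp) (hY p hp)
  smul_mem' := fun c X hX p hp => by
    simpa [mul_assoc, ← Finset.mul_sum] using Or.inr (hX p hp)

theorem conj_mem_lieAlgebra (hG : IsZariskiClosed G) (a : G) {X : Matrix (Fin n) (Fin n) ℂ}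
    (hX : X ∈ lieAlgebra G) : toMat a * X * toMat a⁻¹ ∈ lieAlgebra G := by
  obtain ⟨γ, hγ⟩ := exists_flow hG hX
  refine mem_lieAlgebra_of_curve (γ := fun t => a * γ t * a⁻¹) (by simp [hγ.zero]) ?_
  simp only [toMat_mul]
  exact (hγ.deriv.const_mul _).mul_const _

/-- The derivative of a regular function along curves in `G` depends linearly on the velocity. -/
theorem exists_deriv_of_mem_coordRing {f : G → ℂ} (hf : f ∈ coordRing G) (g : G) :
    ∃ L : Matrix (Fin n) (Fin n) ℂ →ₗ[ℂ] ℂ, ∀ (γ : ℂ → G) (X : Matrix (Fin n) (Fin n) ℂ),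
      γ 0 = g → HasMatDeriv (fun s => toMat (γ s)) X 0 → HasDerivAt (fun s => f (γ s)) (L X) 0 := by
  induction hf using Algebra.adjoin_induction with
  | mem f hf =>
    rcases hf with ⟨ij, rfl⟩ | rfl
    · exact ⟨Matrix.entryLinearMap ℂ ℂ ij.1 ij.2, fun γ X _ h => h ij.1 ij.2⟩
    · set p : MvPolynomial (Fin n × Fin n) ℂ := (Matrix.mvPolynomialX (Fin n) (Fin n) ℂ).det with hp
      have hdet : ∀ M : Matrix (Fin n) (Fin n) ℂ, evalMatrix p M = M.det := fun M => by
        rw [evalMatrix, hp, RingHom.map_det]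
        congr 1
        ext i j
        simp
      refine ⟨-((toMat g).det ^ 2)⁻¹ • ∑ ij : Fin n × Fin n,
        (evalMatrix (MvPolynomial.pderiv ij p) (toMat g)) •
          (Matrix.entryLinearMap ℂ ℂ ij.1 ij.2 : Matrix (Fin n) (Fin n) ℂ →ₗ[ℂ] ℂ),
        fun γ X h0 h => ?_⟩
      have h1 := hasDerivAt_evalMatrix h p
      simp only [hdet, h0] at h1
      have h2 := h1.fun_inv (by rw [h0]; exact (isUnit_det_toMat g).ne_zero)
      refine h2.congr_deriv ?_
      simp only [h0, LinearMap.smul_apply, LinearMap.sum_apply, smul_eq_mul,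
        Matrix.entryLinearMap_apply]
      rw [div_eq_mul_inv, mul_comm, neg_mul_comm]
      simp only [mul_comm (X _ _)]
  | algebraMap r => exact ⟨0, fun γ X _ _ => hasDerivAt_const _ _⟩
  | add f f' _ _ h h' =>
    obtain ⟨L, hL⟩ := h
    obtain ⟨L', hL'⟩ := h'
    exact ⟨L + L', fun γ X h0 h => (hL γ X h0 h).add (hL' γ X h0 h)⟩
  | mul f f' _ _ h h' =>
    obtain ⟨L, hL⟩ := h
    obtain ⟨L', hL'⟩ := h'
    refine ⟨f' g • L + f g • L', fun γ X h0 h => ?_⟩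
    have := (hL γ X h0 h).mul (hL' γ X h0 h)
    simp only [h0] at this
    exact this.congr_deriv (by simp [mul_comm])

end LieAlgebra

/-! ### Constants of derivations -/

section Constants

theorem exists_derivation_ne_zero {F K : Type*} [Field F] [CharZero F] [Field K] [Algebra F K]
    {x : K} (hx : Transcendental F x) : ∃ D : Derivation F K K, D x ≠ 0 := by
  have h1 : AlgebraicIndepOn F id {x} := by
    rw [AlgebraicIndepOn, algebraicIndependent_singleton_iff ⟨x, rfl⟩]
    exact hx
  obtain ⟨s, hs, hb⟩ := exists_isTranscendenceBasis_superset h1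
  let i : s := ⟨x, hs rfl⟩
  let φ : MvPolynomial s F →ₐ[F] K := MvPolynomial.aeval ((↑) : s → K)
  let : Algebra (MvPolynomial s F) K := φ.toRingHom.toAlgebra
  have hφ : ∀ p, algebraMap (MvPolynomial s F) K p = φ p := fun _ => rfl
  have : IsScalarTower F (MvPolynomial s F) K :=
    IsScalarTower.of_algebraMap_eq fun r => (φ.commutes r).symm
  have : FaithfulSMul (MvPolynomial s F) K :=
    (faithfulSMul_iff_algebraMap_injective _ _).2 hb.1
  have : Algebra.IsAlgebraic (MvPolynomial s F) K := by
    have := hb.isAlgebraic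
    refine ⟨fun y => ?_⟩
    obtain ⟨p, hp0, hp⟩ := this.isAlgebraic y
    refine ⟨p.map (hb.1.aevalEquiv.symm : _ →+* MvPolynomial s F), ?_, ?_⟩
    · rwa [Ne, Polynomial.map_eq_zero_iff]
      exact hb.1.aevalEquiv.symm.injective
    · rw [Polynomial.aeval_def, Polynomial.eval₂_map, ← hp, Polynomial.aeval_def]
      congr 1
      ext z
      obtain ⟨w, rfl⟩ := hb.1.aevalEquiv.surjective z
      simp [hφ, φ]
  let := FractionRing.liftAlgebra (MvPolynomial s F) K
  have : Algebra.FormallyEtale (MvPolynomial s F) (FractionRing (MvPolynomial s F)) :=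
    Algebra.FormallyEtale.of_isLocalization (nonZeroDivisors (MvPolynomial s F))
  have : CharZero (FractionRing (MvPolynomial s F)) :=
    charZero_of_injective_algebraMap (FaithfulSMul.algebraMap_injective F _)
  have : Algebra.IsAlgebraic (FractionRing (MvPolynomial s F)) K :=
    (IsFractionRing.comap_isAlgebraic_iff (A := MvPolynomial s F)).1 inferInstance
  have : Algebra.FormallyEtale (FractionRing (MvPolynomial s F)) K :=
    Algebra.FormallyEtale.of_isSeparable _ _
  have : Algebra.FormallyEtale (MvPolynomial s F) K :=
    Algebra.FormallyEtale.comp _ (FractionRing (MvPolynomial s F)) _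
  let b := (KaehlerDifferential.mvPolynomialBasis F s).baseChange K
  let e := (KaehlerDifferential.tensorKaehlerEquivOfFormallyEtale F (MvPolynomial s F) K).symm
  let L : Ω[K⁄F] →ₗ[K] K := (b.coord i).comp e.toLinearMap
  refine ⟨L.compDer (KaehlerDifferential.D F K), ?_⟩
  have hx' : x = algebraMap (MvPolynomial s F) K (MvPolynomial.X i) := by simp [hφ, φ, i]
  have : L (KaehlerDifferential.D F K x) = 1 := by
    simp only [L, e, LinearMap.comp_apply, LinearEquiv.coe_coe]
    rw [hx', KaehlerDifferential.tensorKaehlerEquivOfFormallyEtale_symm_D_algebraMap,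
      ← KaehlerDifferential.mvPolynomialBasis_apply, ← Module.Basis.baseChange_apply]
    simp [b]
  simp [this]

theorem mem_range_algebraMap_of_derivation_eq_zero {F K : Type*} [Field F] [CharZero F]
    [IsAlgClosed F] [Field K] [Algebra F K] {x : K} (hx : ∀ D : Derivation F K K, D x = 0) :
    ∃ c : F, x = algebraMap F K c := by
  by_contra hne
  have : Transcendental F x := by
    intro hx
    have := IsAlgClosed.degree_eq_one_of_irreducible F (minpoly.irreducible hx.isIntegral)
    obtain ⟨c, hc⟩ := minpoly.mem_range_of_degree_eq_one F x this
    exact hne ⟨c, hc.symm⟩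
  obtain ⟨D, hD⟩ := exists_derivation_ne_zero this
  exact hD (hx D)

end Constants

/-! ### Left-invariant derivations of the coordinate ring -/

section LeftInvariant

variable {n : ℕ} {G : Subgroup (GL (Fin n) ℂ)}

/-- The generic matrix: the matrix of coordinate functions. -/
def genericMat (G : Subgroup (GL (Fin n) ℂ)) : Matrix (Fin n) (Fin n) (coordRing G) :=
  Matrix.of fun i j => ⟨fun g => toMat g i j, Algebra.subset_adjoin (Or.inl ⟨(i, j), rfl⟩)⟩

/-- The inverse of the determinant as a regular function. -/
def detInv (G : Subgroup (GL (Fin n) ℂ)) : coordRing G :=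
  ⟨fun g => ((toMat g).det)⁻¹, Algebra.subset_adjoin (Or.inr rfl)⟩

/-- Evaluation at a point. -/
def evalAt (g : G) : coordRing G →ₐ[ℂ] ℂ :=
  (Pi.evalAlgHom ℂ (fun _ : G => ℂ) g).comp (coordRing G).val

theorem evalAt_apply (g : G) (f : coordRing G) : evalAt g f = (f : G → ℂ) g := rfl

theorem coordRing_ext {f f' : coordRing G} (h : ∀ g, evalAt g f = evalAt g f') : f = f' :=
  Subtype.ext (funext h)

theorem evalAt_genericMat (g : G) (i j : Fin n) : evalAt g (genericMat G i j) = toMat g i j := rfl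

theorem map_evalAt_genericMat (g : G) : (genericMat G).map (evalAt g) = toMat g := rfl

theorem evalAt_det_genericMat (g : G) : evalAt g (genericMat G).det = (toMat g).det := by
  rw [AlgHom.map_det, AlgHom.mapMatrix_apply, map_evalAt_genericMat]

theorem det_genericMat_mul_detInv : (genericMat G).det * detInv G = 1 :=
  coordRing_ext fun g => by
    rw [map_mul, evalAt_det_genericMat, map_one]
    exact mul_inv_cancel₀ (isUnit_det_toMat g).ne_zero

theorem det_genericMat_mem :
    (genericMat G).det ∈ Algebra.adjoin ℂ (Set.range fun ij : Fin n × Fin n =>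
      genericMat G ij.1 ij.2) := by
  rw [Matrix.det_apply]
  refine Subalgebra.sum_mem _ fun σ _ => ?_
  rw [Units.smul_def]
  refine zsmul_mem (Subalgebra.prod_mem _ fun i _ => ?_) _
  exact Algebra.subset_adjoin ⟨(σ i, i), rfl⟩

/-- The inverse of the generic matrix. -/
def genericInv (G : Subgroup (GL (Fin n) ℂ)) : Matrix (Fin n) (Fin n) (coordRing G) :=
  detInv G • (genericMat G).adjugate

theorem genericInv_mul : genericInv G * genericMat G = 1 := by
  rw [genericInv, Matrix.smul_mul, Matrix.adjugate_mul, smul_smul, mul_comm,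
    det_genericMat_mul_detInv, one_smul]

theorem genericMat_mul_inv : genericMat G * genericInv G = 1 :=
  mul_eq_one_comm.1 genericInv_mul

theorem map_evalAt_genericInv (g : G) : (genericInv G).map (evalAt g) = toMat g⁻¹ := by
  have h : (genericInv G).map (evalAt g) * toMat g = 1 := by
    rw [← map_evalAt_genericMat, ← Matrix.map_mul, genericInv_mul]
    exact Matrix.map_one _ (map_zero _) (map_one _)
  calc _ = (genericInv G).map (evalAt g) * (toMat g * toMat g⁻¹) := by rw [toMat_mul_inv, mul_one]
    _ = _ := by rw [← mul_assoc, h, one_mul]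

theorem coordRing_derivation_ext {M : Type*} [AddCommGroup M] [Module ℂ M] [Module (coordRing G) M]
    {D D' : Derivation ℂ (coordRing G) M}
    (h : ∀ i j, D (genericMat G i j) = D' (genericMat G i j)) : D = D' := by
  have h1 : Set.EqOn D D' (Algebra.adjoin ℂ (Set.range fun ij : Fin n × Fin n =>
      genericMat G ij.1 ij.2)) := Derivation.eqOn_adjoin (by rintro _ ⟨ij, rfl⟩; exact h _ _)
  have h2 : D (detInv G) = D' (detInv G) := by
    have e : detInv G * (genericMat G).det = 1 := by rw [mul_comm, det_genericMat_mul_detInv]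
    rw [Derivation.leibniz_of_mul_eq_one _ e, Derivation.leibniz_of_mul_eq_one _ e,
      h1 det_genericMat_mem]
  ext ⟨f, hf⟩
  induction hf using Algebra.adjoin_induction with
  | mem f hf =>
    rcases hf with ⟨ij, rfl⟩ | rfl
    · exact h ij.1 ij.2
    · exact h2
  | algebraMap r => exact (D.map_algebraMap r).trans (D'.map_algebraMap r).symm
  | add f f' hf hf' e e' =>
    have := congrArg₂ (· + ·) e e'
    simp only [← map_add] at this
    exact this
  | mul f f' hf hf' e e' =>
    have : D (⟨f, hf⟩ * ⟨f', hf'⟩) = D' (⟨f, hf⟩ * ⟨f', hf'⟩) := by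
      rw [Derivation.leibniz, Derivation.leibniz, e, e']
    exact this

theorem exists_leftDeriv {X : Matrix (Fin n) (Fin n) ℂ} {γ : ℂ → G} (hγ : IsFlow γ X) :
    ∃ D : Derivation ℂ (coordRing G) (coordRing G), ∀ (f : coordRing G) (g : G),
      HasDerivAt (fun t => evalAt (g * γ t) f) (evalAt g (D f)) 0 := by
  let D₀ : (G → ℂ) → G → ℂ := fun f g => deriv (fun t => f (g * γ t)) 0
  have hD₀ : ∀ f ∈ coordRing G, ∀ g, HasDerivAt (fun t => f (g * γ t)) (D₀ f g) 0 := by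
    intro f hf g
    obtain ⟨L, hL⟩ := exists_deriv_of_mem_coordRing hf g
    have := hL (fun t => g * γ t) (toMat g * X) (by simp [hγ.zero]) (by
      simp only [toMat_mul]; exact hγ.deriv.const_mul _)
    exact this.differentiableAt.hasDerivAt
  have hadd : ∀ f ∈ coordRing G, ∀ f' ∈ coordRing G, D₀ (f + f') = D₀ f + D₀ f' :=
    fun f hf f' hf' => funext fun g => ((hD₀ f hf g).add (hD₀ f' hf' g)).deriv
  have hmul : ∀ f ∈ coordRing G, ∀ f' ∈ coordRing G, D₀ (f * f') = f * D₀ f' + f' * D₀ f :=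
    fun f hf f' hf' => funext fun g => by
      have := ((hD₀ f hf g).mul (hD₀ f' hf' g)).deriv
      simp only [hγ.zero, mul_one] at this
      refine this.trans ?_
      simp only [Pi.add_apply, Pi.mul_apply]
      ring
  have hconst : ∀ c : ℂ, D₀ (algebraMap ℂ (G → ℂ) c) = 0 := fun c => funext fun g =>
    (hasDerivAt_const (0 : ℂ) c).deriv
  let S : Subalgebra ℂ (G → ℂ) :=
    { carrier := {f | f ∈ coordRing G ∧ D₀ f ∈ coordRing G}
      mul_mem' := fun {f f'} hf hf' => ⟨mul_mem hf.1 hf'.1, by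
        rw [hmul f hf.1 f' hf'.1]
        exact add_mem (mul_mem hf.1 hf'.2) (mul_mem hf'.1 hf.2)⟩
      add_mem' := fun {f f'} hf hf' => ⟨add_mem hf.1 hf'.1, by
        rw [hadd f hf.1 f' hf'.1]; exact add_mem hf.2 hf'.2⟩
      algebraMap_mem' := fun c => ⟨Subalgebra.algebraMap_mem _ c, by
        rw [hconst]; exact zero_mem _⟩ }
  have hentry : ∀ i j, ((genericMat G i j : coordRing G) : G → ℂ) ∈ S := fun i j => by
    refine ⟨(genericMat G i j).2, ?_⟩
    have : D₀ (genericMat G i j : coordRing G) =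
        ((∑ k, (X k j) • genericMat G i k : coordRing G) : G → ℂ) := by
      ext g
      have h : HasMatDeriv (fun t => toMat (g * γ t)) (toMat g * X) 0 := by
        simp only [toMat_mul]; exact hγ.deriv.const_mul _
      refine (h i j).deriv.trans ?_
      rw [Matrix.mul_apply, ← evalAt_apply, map_sum]
      exact Finset.sum_congr rfl fun k _ => by
        rw [map_smul, evalAt_genericMat, smul_eq_mul, mul_comm]
    rw [this]
    exact Subtype.mem _
  have hdet : (((genericMat G).det : coordRing G) : G → ℂ) ∈ S := by
    have : Algebra.adjoin ℂ (Set.range fun ij : Fin n × Fin n => genericMat G ij.1 ij.2) ≤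
        S.comap (coordRing G).val := Algebra.adjoin_le (by rintro _ ⟨ij, rfl⟩; exact hentry _ _)
    exact this det_genericMat_mem
  have hle : coordRing G ≤ S := by
    refine Algebra.adjoin_le ?_
    rintro f (⟨ij, rfl⟩ | rfl)
    · exact hentry ij.1 ij.2
    · refine ⟨(detInv G).2, ?_⟩
      have h1 := hmul _ hdet.1 _ (detInv G).2
      have h2 : (((genericMat G).det : coordRing G) : G → ℂ) * (detInv G : G → ℂ) =
          algebraMap ℂ (G → ℂ) 1 := by
        rw [map_one]; exact congrArg Subtype.val det_genericMat_mul_detInv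
      rw [h2, hconst] at h1
      have h3 : D₀ (detInv G) = -((detInv G : G → ℂ) * (detInv G) *
          D₀ ((genericMat G).det : coordRing G)) := by
        calc D₀ (detInv G) = (algebraMap ℂ (G → ℂ) 1) * D₀ (detInv G) := by rw [map_one, one_mul]
          _ = (detInv G : G → ℂ) * ((((genericMat G).det : coordRing G) : G → ℂ) *
              D₀ (detInv G)) := by rw [← h2]; ring
          _ = _ := by
            rw [← sub_eq_zero, sub_neg_eq_add]
            linear_combination (-(detInv G : G → ℂ)) * h1
      change D₀ (detInv G) ∈ _
      rw [h3]
      exact neg_mem (mul_mem (mul_mem (detInv G).2 (detInv G).2) hdet.2)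
  refine ⟨Derivation.mk' ⟨⟨fun f => ⟨D₀ f, (hle f.2).2⟩, fun f f' => ?_⟩, fun c f => ?_⟩
    fun f f' => ?_, fun f g => hD₀ f f.2 g⟩
  · exact Subtype.ext (hadd f f.2 f' f'.2)
  · refine Subtype.ext (funext fun g => ?_)
    exact ((hD₀ f f.2 g).const_mul c).deriv
  · exact Subtype.ext (hmul f f.2 f' f'.2)

theorem derivation_aeval {σ B M : Type*} [Fintype σ] [CommRing B] [Algebra ℂ B] [AddCommGroup M]
    [Module ℂ M] [Module B M] [IsScalarTower ℂ B M] (D : Derivation ℂ B M) (N : σ → B)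
    (p : MvPolynomial σ ℂ) :
    D (MvPolynomial.aeval N p) =
      ∑ i, MvPolynomial.aeval N (MvPolynomial.pderiv i p) • D (N i) := by
  classical
  induction p using MvPolynomial.induction_on with
  | C a => simp
  | add p q hp hq => simp [hp, hq, add_smul, Finset.sum_add_distrib]
  | mul_X p k hp =>
    simp only [map_mul, MvPolynomial.aeval_X, Derivation.leibniz, hp, smul_eq_mul,
      map_add, add_smul, Finset.sum_add_distrib, Finset.smul_sum, MvPolynomial.pderiv_X]
    congr 1
    · rw [Finset.sum_eq_single k]
      · simp
      · intro b _ hb; simp [hb.symm]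
      · simp
    · exact Finset.sum_congr rfl fun i _ => by rw [smul_smul]

/-- An element of `ℂ[G] ⊗ K` vanishes if all its values at points of `G` do. -/
theorem eq_zero_of_evalAt {K : Type*} [CommRing K] [Algebra ℂ K]
    {e : coordRing G ⊗[ℂ] K}
    (he : ∀ g, Algebra.TensorProduct.lift ((Algebra.ofId ℂ K).comp (evalAt g)) (AlgHom.id ℂ K)
      (fun _ _ => Commute.all _ _) e = 0) : e = 0 := by
  let β := Module.Basis.ofVectorSpace ℂ K
  let B := Algebra.TensorProduct.basis (coordRing G) β
  apply B.repr.injective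
  rw [map_zero]
  ext1 b
  refine coordRing_ext fun g => ?_
  have key : ∀ e : coordRing G ⊗[ℂ] K, evalAt g (B.repr e b) =
      β.repr (Algebra.TensorProduct.lift ((Algebra.ofId ℂ K).comp (evalAt g)) (AlgHom.id ℂ K)
      (fun _ _ => Commute.all _ _) e) b := by
    intro e
    induction e using TensorProduct.induction_on with
    | zero => simp
    | add x y hx hy => simp only [map_add, Finsupp.add_apply, hx, hy]
    | tmul a k =>
      simp only [B, Algebra.TensorProduct.basis_repr_tmul, Algebra.TensorProduct.lift_tmul,
        Finsupp.smul_apply, Finsupp.mapRange_apply, smul_eq_mul, map_mul, AlgHom.commutes,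
        AlgHom.comp_apply, AlgHom.id_apply, Algebra.ofId_apply, ← Algebra.smul_def, map_smul]
      rfl
  rw [key, he, map_zero]
  simp

theorem sum_pderiv_eq_zero {K : Type*} [Field K] [Algebra ℂ K] [Algebra (coordRing G) K]
    [IsScalarTower ℂ (coordRing G) K] (D : Derivation ℂ (coordRing G) K)
    {p : MvPolynomial (Fin n × Fin n) ℂ} (hp : Vanishes G p) :
    ∑ ij : Fin n × Fin n, (∑ k, genericInv G ij.1 k • D (genericMat G k ij.2)) *
      algebraMap ℂ K (evalMatrix (MvPolynomial.pderiv ij p) 1) = 0 := by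
  let ιA : coordRing G →ₐ[ℂ] K := IsScalarTower.toAlgHom ℂ (coordRing G) K
  let N : Fin n × Fin n → coordRing G ⊗[ℂ] K := fun kl =>
    ∑ i, genericInv G kl.1 i ⊗ₜ ιA (genericMat G i kl.2)
  let e : coordRing G ⊗[ℂ] K := ∑ kl : Fin n × Fin n,
    MvPolynomial.aeval N (MvPolynomial.pderiv kl p) *
      ∑ i, genericInv G kl.1 i ⊗ₜ D (genericMat G i kl.2)
  have he : e = 0 := by
    refine eq_zero_of_evalAt fun h => ?_
    set ev := Algebra.TensorProduct.lift ((Algebra.ofId ℂ K).comp (evalAt h)) (AlgHom.id ℂ K)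
      (fun _ _ => Commute.all _ _)
    let Nh : Fin n × Fin n → coordRing G := fun kl =>
      ∑ i, (toMat h⁻¹ kl.1 i) • genericMat G i kl.2
    have hinv : ∀ k i, evalAt h (genericInv G k i) = toMat h⁻¹ k i := fun k i => by
      rw [← map_evalAt_genericInv]; rfl
    have hN : ∀ kl, ev (N kl) = ιA (Nh kl) := fun kl => by
      simp only [N, Nh, map_sum, map_smul]
      refine Finset.sum_congr rfl fun i _ => ?_
      simp only [ev, Algebra.TensorProduct.lift_tmul, AlgHom.comp_apply, AlgHom.id_apply,
        Algebra.ofId_apply, hinv, Algebra.smul_def]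
    have hz : MvPolynomial.aeval Nh p = 0 := by
      refine coordRing_ext fun g => ?_
      rw [map_zero, MvPolynomial.comp_aeval_apply, MvPolynomial.aeval_eq_eval]
      have : (fun kl => evalAt g (Nh kl)) = fun kl => toMat (h⁻¹ * g) kl.1 kl.2 := by
        ext kl
        simp only [Nh, map_sum, map_smul, evalAt_genericMat, toMat_mul, Matrix.mul_apply,
          smul_eq_mul]
      rw [this]
      exact hp _ (h⁻¹ * g).2
    have hd := derivation_aeval D Nh p
    rw [hz, map_zero] at hd
    rw [hd, map_sum]
    refine Finset.sum_congr rfl fun kl _ => ?_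
    rw [map_mul, MvPolynomial.comp_aeval_apply, Algebra.smul_def]
    congr 1
    · simp only [hN]
      exact (MvPolynomial.comp_aeval_apply Nh ιA _).symm
    · simp only [Nh, map_sum, Derivation.map_smul]
      refine Finset.sum_congr rfl fun i _ => ?_
      simp only [ev, Algebra.TensorProduct.lift_tmul, AlgHom.comp_apply, AlgHom.id_apply,
        Algebra.ofId_apply, hinv, Algebra.smul_def]
  have hμ := congrArg (Algebra.TensorProduct.lift ιA (AlgHom.id ℂ K)
      (fun _ _ => Commute.all _ _)) he
  rw [map_zero] at hμ
  rw [← hμ, map_sum]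
  refine Finset.sum_congr rfl fun kl _ => ?_
  rw [map_mul, MvPolynomial.comp_aeval_apply, mul_comm]
  congr 1
  · have : ∀ kl, (Algebra.TensorProduct.lift ιA (AlgHom.id ℂ K) (fun _ _ => Commute.all _ _)) (N kl)
        = algebraMap ℂ K ((1 : Matrix (Fin n) (Fin n) ℂ) kl.1 kl.2) := fun kl => by
      simp only [N, map_sum, Algebra.TensorProduct.lift_tmul, AlgHom.id_apply, ← map_mul]
      rw [← map_sum, ← Matrix.mul_apply, genericInv_mul]
      rw [Matrix.one_apply, Matrix.one_apply]
      split_ifs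
      · rw [map_one, map_one]
      · rw [map_zero, map_zero]
    simp only [this]
    rw [evalMatrix, ← MvPolynomial.aeval_eq_eval]
    exact MvPolynomial.comp_aeval_apply _ (Algebra.ofId ℂ K) _
  · simp only [map_sum, Algebra.TensorProduct.lift_tmul, AlgHom.id_apply, Algebra.smul_def]
    rfl

end LeftInvariant

/-! ### Subspaces stable under the Lie algebra -/

section Stable

variable {n : ℕ} {G : Subgroup (GL (Fin n) ℂ)}

/-- A one-parameter subgroup with given velocity in the Lie algebra. -/
def flow (hG : IsZariskiClosed G) (X : lieSubmodule G) : ℂ → G := (exists_flow hG X.2).choose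

theorem isFlow_flow (hG : IsZariskiClosed G) (X : lieSubmodule G) : IsFlow (flow hG X) X.1 :=
  (exists_flow hG X.2).choose_spec

/-- The left-invariant derivation given by an element of the Lie algebra. -/
def leftDeriv (hG : IsZariskiClosed G) (X : lieSubmodule G) :
    Derivation ℂ (coordRing G) (coordRing G) :=
  (exists_leftDeriv (isFlow_flow hG X)).choose

theorem hasDerivAt_leftDeriv (hG : IsZariskiClosed G) (X : lieSubmodule G) (f : coordRing G)
    (g : G) : HasDerivAt (fun t => evalAt (g * flow hG X t) f) (evalAt g (leftDeriv hG X f)) 0 :=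
  (exists_leftDeriv (isFlow_flow hG X)).choose_spec f g

theorem leftDeriv_genericMat (hG : IsZariskiClosed G) (X : lieSubmodule G) (i j : Fin n) :
    leftDeriv hG X (genericMat G i j) = ∑ k, (X.1 k j) • genericMat G i k := by
  refine coordRing_ext fun g => ?_
  have h : HasMatDeriv (fun t => toMat (g * flow hG X t)) (toMat g * X.1) 0 := by
    simp only [toMat_mul]
    exact (isFlow_flow hG X).deriv.const_mul _
  rw [(hasDerivAt_leftDeriv hG X _ g).unique (h i j), Matrix.mul_apply, map_sum]
  exact Finset.sum_congr rfl fun k _ => by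
    rw [map_smul, evalAt_genericMat, smul_eq_mul, mul_comm]

/-- The left-invariant derivations generate all derivations. -/
theorem exists_eq_sum_leftDeriv (hG : IsZariskiClosed G) {K : Type} [Field K] [Algebra ℂ K]
    [Algebra (coordRing G) K] [IsScalarTower ℂ (coordRing G) K]
    (D : Derivation ℂ (coordRing G) K) :
    ∃ (ι : Type) (s : Finset ι) (κ : ι → K) (Y : ι → lieSubmodule G),
      ∀ f, D f = ∑ b ∈ s, κ b * algebraMap (coordRing G) K (leftDeriv hG (Y b) f) := by
  classical
  let β := Module.Basis.ofVectorSpace ℂ K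
  let M : Fin n → Fin n → K := fun i j => ∑ k, genericInv G i k • D (genericMat G k j)
  let Y : Module.Basis.ofVectorSpaceIndex ℂ K → lieSubmodule G := fun b =>
    ⟨Matrix.of fun i j => β.repr (M i j) b, fun p hp => by
      have h := congrArg (fun x => β.repr x b) (sum_pderiv_eq_zero D hp)
      simp only [map_zero, Finsupp.coe_zero, Pi.zero_apply, map_sum, Finsupp.finsetSum_apply] at h
      rw [← h]
      refine Finset.sum_congr rfl fun ij _ => ?_
      rw [mul_comm _ (algebraMap ℂ K _), ← Algebra.smul_def, map_smul, Finsupp.smul_apply,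
        smul_eq_mul, mul_comm]
      rfl⟩
  let s : Finset (Module.Basis.ofVectorSpaceIndex ℂ K) :=
    Finset.univ.biUnion fun ij : Fin n × Fin n => (β.repr (M ij.1 ij.2)).support
  have hM : ∀ i j, M i j = ∑ b ∈ s, ((Y b).1 i j) • β b := fun i j => by
    conv_lhs => rw [← β.linearCombination_repr (M i j), Finsupp.linearCombination_apply,
      Finsupp.sum]
    refine Finset.sum_subset (fun b hb => ?_) fun b _ hb => ?_
    · exact Finset.mem_biUnion.2 ⟨(i, j), Finset.mem_univ _, hb⟩
    · rw [Finsupp.notMem_support_iff.1 hb, zero_smul]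
  have hD : ∀ i j, D (genericMat G i j) = ∑ k, genericMat G i k • M k j := fun i j => by
    simp only [M, Finset.smul_sum, smul_smul]
    rw [Finset.sum_comm]
    simp only [← Finset.sum_smul, ← Matrix.mul_apply, genericMat_mul_inv, Matrix.one_apply,
      ite_smul, one_smul, zero_smul]
    simp
  refine ⟨_, s, β, Y, fun f => ?_⟩
  let D' : Derivation ℂ (coordRing G) K :=
    ∑ b ∈ s, β b • (Algebra.linearMap (coordRing G) K).compDer (leftDeriv hG (Y b))
  have hD' : ∀ f, D' f = ∑ b ∈ s, β b * algebraMap (coordRing G) K (leftDeriv hG (Y b) f) :=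
    fun f => by
      have := congrArg (fun u : (coordRing G) → K => u f)
        (map_sum (Derivation.coeFnAddMonoidHom (R := ℂ) (A := coordRing G) (M := K))
          (fun b => β b • (Algebra.linearMap (coordRing G) K).compDer (leftDeriv hG (Y b))) s)
      refine this.trans ?_
      simp [Finset.sum_apply]
  rw [← hD']
  congr 1
  refine coordRing_derivation_ext fun i j => ?_
  rw [hD', hD]
  simp only [hM, leftDeriv_genericMat, Finset.smul_sum]
  rw [Finset.sum_comm]
  refine Finset.sum_congr rfl fun b _ => ?_
  rw [map_sum, Finset.mul_sum]
  refine Finset.sum_congr rfl fun k _ => ?_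
  rw [Algebra.smul_def, Algebra.smul_def, Algebra.smul_def, map_mul,
    ← IsScalarTower.algebraMap_apply]
  ring

theorem exists_const_of_derivation {K : Type} [Field K] [Algebra ℂ K] {d : ℕ}
    {F₁ : Matrix (Fin d) (Fin d) K} (hu : IsUnit F₁.det) {F₂ : Fin d → K}
    (h : ∀ D : Derivation ℂ K K, ∃ N : Matrix (Fin d) (Fin d) K,
      (∀ i j, D (F₁ i j) = ∑ k, F₁ i k * N k j) ∧ ∀ j, D (F₂ j) = ∑ k, F₂ k * N k j) :
    ∃ x : Fin d → ℂ, ∀ j, F₂ j = ∑ i, algebraMap ℂ K (x i) * F₁ i j := by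
  let c : Fin d → K := F₂ ᵥ* F₁⁻¹
  have hc : c ᵥ* F₁ = F₂ := by
    simp only [c, Matrix.vecMul_vecMul, Matrix.nonsing_inv_mul _ hu, Matrix.vecMul_one]
  have hconst : ∀ i, ∃ x : ℂ, c i = algebraMap ℂ K x := by
    intro i
    refine mem_range_algebraMap_of_derivation_eq_zero fun D => ?_
    obtain ⟨N, e1, e2⟩ := h D
    have hz : (fun i => D (c i)) ᵥ* F₁ = 0 := by
      ext j
      have h1 := congrArg D (congrFun hc j)
      simp only [Matrix.vecMul, dotProduct, map_sum, Derivation.leibniz, smul_eq_mul,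
        Finset.sum_add_distrib] at h1
      have h2 : ∑ x, c x * D (F₁ x j) = D (F₂ j) := by
        simp only [e1, e2, Finset.mul_sum]
        rw [Finset.sum_comm]
        refine Finset.sum_congr rfl fun k _ => ?_
        rw [← congrFun hc k, Matrix.vecMul, dotProduct, Finset.sum_mul]
        exact Finset.sum_congr rfl fun x _ => by ring
      rw [h2, add_eq_left] at h1
      rw [Pi.zero_apply, ← h1, Matrix.vecMul, dotProduct]
      exact Finset.sum_congr rfl fun x _ => by ring
    have := congrArg (fun v => v ᵥ* F₁⁻¹) hz
    simp only [Matrix.vecMul_vecMul, Matrix.mul_nonsing_inv _ hu, Matrix.vecMul_one,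
      Matrix.zero_vecMul] at this
    exact congrFun this i
  choose x hx using hconst
  refine ⟨x, fun j => ?_⟩
  rw [← congrFun hc j]
  simp only [Matrix.vecMul, dotProduct, hx]

variable {V : Type} [AddCommGroup V] [Module ℂ V]

/-- For connected `G`, a subspace that is stable under the Lie algebra is stable under `G`. -/
theorem stable_of_lie_stable (hG : IsZariskiClosed G) (hconn : IsConnectedGroup G)
    {ρ : Representation ℂ G V} (hρ : IsRational (coordRing G) ρ) {W : Submodule ℂ V}
    (hW : ∀ (X : lieSubmodule G), ∀ w ∈ W, ∃ w' ∈ W, ∀ φ : Module.Dual ℂ V,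
      HasDerivAt (fun t => φ (ρ (flow hG X t) w)) (φ w') 0) (g : G) {w : V} (hw : w ∈ W) :
    ρ g w ∈ W := by
  classical
  have : IsDomain (coordRing G) := hconn
  have := hρ.1
  by_contra hcon
  obtain ⟨φ, hφ, hφW⟩ := Submodule.exists_le_ker_of_notMem hcon
  let b := Module.finBasis ℂ W
  let d := Module.finrank ℂ W
  choose ψ hψ using fun i : Fin d => (b.coord i).exists_extend
  have hψb : ∀ i j, ψ i (b j) = if i = j then 1 else 0 := fun i j => by
    have := LinearMap.congr_fun (hψ i) (b j)
    simp only [LinearMap.comp_apply, Submodule.subtype_apply] at this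
    rw [this, Module.Basis.coord_apply, Module.Basis.repr_self, Finsupp.single_apply]
    simp only [eq_comm]
  let coef : Module.Dual ℂ V → V → coordRing G := fun φ v => ⟨matrixCoeff ρ φ v, hρ.2 φ v⟩
  choose w' hw'W hw' using fun (X : lieSubmodule G) (j : Fin d) => hW X (b j) (b j).2
  have hcoef : ∀ (φ : Module.Dual ℂ V) (X : lieSubmodule G) (j : Fin d),
      leftDeriv hG X (coef φ (b j)) = ∑ k, b.repr ⟨w' X j, hw'W X j⟩ k • coef φ (b k) := by
    intro φ X j
    refine coordRing_ext fun g => ?_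
    have h1 := hasDerivAt_leftDeriv hG X (coef φ (b j)) g
    have h2 := hw' X j (φ.comp (ρ g))
    have h3 : (fun t => evalAt (g * flow hG X t) (coef φ (b j))) =
        fun t => (φ.comp (ρ g)) (ρ (flow hG X t) (b j)) := by
      ext t
      simp [coef, evalAt_apply, matrixCoeff]
    rw [h3] at h1
    rw [h1.unique h2]
    have h4 : w' X j = ∑ k, b.repr ⟨w' X j, hw'W X j⟩ k • (b k : V) := by
      have := congrArg Subtype.val (b.sum_repr ⟨w' X j, hw'W X j⟩)
      rw [Submodule.coe_sum] at this
      exact this.symm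
    conv_lhs => rw [h4]
    simp [coef, evalAt_apply, matrixCoeff]
  let F₁ : Matrix (Fin d) (Fin d) (coordRing G) := Matrix.of fun i j => coef (ψ i) (b j)
  let F₂ : Fin d → coordRing G := fun j => coef φ (b j)
  have hF₁ : F₁.det ≠ 0 := fun h => by
    have h1 := congrArg (evalAt 1) h
    rw [AlgHom.map_det, map_zero, AlgHom.mapMatrix_apply] at h1
    have : F₁.map (evalAt 1) = 1 := by
      ext i j
      simp [F₁, coef, evalAt_apply, matrixCoeff, hψb, Matrix.one_apply]
    rw [this, Matrix.det_one] at h1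
    exact one_ne_zero h1
  let ι : coordRing G →+* FractionRing (coordRing G) := algebraMap _ _
  have hι : Function.Injective ι := IsFractionRing.injective _ _
  have hu : IsUnit (F₁.map ι).det := by
    rw [isUnit_iff_ne_zero]
    have : (F₁.map ι).det = ι F₁.det := (RingHom.map_det ι F₁).symm
    rw [this, Ne, map_eq_zero_iff _ hι]
    exact hF₁
  obtain ⟨x, hx⟩ := exists_const_of_derivation hu (F₂ := fun j => ι (F₂ j)) (by
    intro D
    obtain ⟨I, s, κ, Y, hD⟩ := exists_eq_sum_leftDeriv hG (D.compAlgebraMap (coordRing G))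
    have hDN : ∀ (φ : Module.Dual ℂ V) (j : Fin d),
        D (ι (coef φ (b j))) = ∑ k, ι (coef φ (b k)) *
          ∑ y ∈ s, κ y * algebraMap ℂ (FractionRing (coordRing G))
            (b.repr ⟨w' (Y y) j, hw'W (Y y) j⟩ k) := by
      intro φ j
      refine (hD (coef φ (b j))).trans ?_
      simp only [hcoef, Finset.mul_sum, map_sum]
      rw [Finset.sum_comm]
      refine Finset.sum_congr rfl fun k _ => Finset.sum_congr rfl fun y _ => ?_
      rw [Algebra.smul_def, map_mul, ← IsScalarTower.algebraMap_apply]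
      ring
    exact ⟨Matrix.of fun k j => ∑ y ∈ s, κ y * algebraMap ℂ (FractionRing (coordRing G))
            (b.repr ⟨w' (Y y) j, hw'W (Y y) j⟩ k), fun i j => hDN (ψ i) j, fun j => hDN φ j⟩)
  have hF₂ : ∀ j, F₂ j = ∑ i, x i • F₁ i j := fun j => by
    apply hι
    rw [hx j, map_sum]
    refine Finset.sum_congr rfl fun i _ => ?_
    rw [Algebra.smul_def, map_mul]
    rfl
  have hx0 : ∀ j, x j = 0 := fun j => by
    have h1 := congrArg (evalAt 1) (hF₂ j)
    simp only [map_sum, map_smul] at h1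
    have h2 : ∀ i, evalAt 1 (F₁ i j) = if i = j then 1 else 0 := fun i => by
      simp [F₁, coef, evalAt_apply, matrixCoeff, hψb]
    have h3 : evalAt 1 (F₂ j) = 0 := by
      simpa [F₂, coef, evalAt_apply, matrixCoeff] using hφW (b j).2
    simp only [h2, h3, smul_eq_mul, mul_ite, mul_one, mul_zero, Finset.sum_ite_eq',
      Finset.mem_univ, if_true] at h1
    exact h1.symm
  apply hφ
  have h1 : w = ∑ k, b.repr ⟨w, hw⟩ k • (b k : V) := by
    have := congrArg Subtype.val (b.sum_repr ⟨w, hw⟩)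
    rw [Submodule.coe_sum] at this
    exact this.symm
  have h2 : ∀ k, φ (ρ g (b k)) = 0 := fun k => by
    have := congrArg (evalAt g) (hF₂ k)
    simp only [hx0, zero_smul, Finset.sum_const_zero, map_zero] at this
    exact this
  rw [h1]
  simp [h2]

end Stable

/-! ### The differential of a rational representation -/

section Differential

variable {n : ℕ} {G : Subgroup (GL (Fin n) ℂ)}

theorem HasMatDeriv.linear {M : ℂ → Matrix (Fin n) (Fin n) ℂ} {X : Matrix (Fin n) (Fin n) ℂ}
    {t : ℂ} (h : HasMatDeriv M X t) (L : Matrix (Fin n) (Fin n) ℂ →ₗ[ℂ] ℂ) :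
    HasDerivAt (fun s => L (M s)) (L X) t := by
  have hL : ∀ A : Matrix (Fin n) (Fin n) ℂ, L A = ∑ i, ∑ j, A i j * L (Matrix.single i j 1) := by
    intro A
    conv_lhs => rw [Matrix.matrix_eq_sum_single A]
    simp only [map_sum]
    refine Finset.sum_congr rfl fun i _ => Finset.sum_congr rfl fun j _ => ?_
    rw [← smul_eq_mul, ← map_smul, Matrix.smul_single, smul_eq_mul, mul_one]
  have hM : (fun s => L (M s)) = fun s => ∑ i, ∑ j, M s i j * L (Matrix.single i j 1) :=
    funext fun s => hL (M s)
  rw [hM, hL X]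
  exact HasDerivAt.fun_sum fun i _ => HasDerivAt.fun_sum fun j _ => (h i j).mul_const _

theorem mem_of_hasMatDeriv {M : ℂ → Matrix (Fin n) (Fin n) ℂ} {X : Matrix (Fin n) (Fin n) ℂ}
    {t : ℂ} (h : HasMatDeriv M X t) {W : Submodule ℂ (Matrix (Fin n) (Fin n) ℂ)}
    (hM : ∀ s, M s ∈ W) : X ∈ W := by
  by_contra hX
  obtain ⟨L, hL, hLW⟩ := Submodule.exists_le_ker_of_notMem hX
  have h1 := h.linear L
  have h2 : (fun s => L (M s)) = fun _ => 0 := funext fun s => hLW (hM s)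
  rw [h2] at h1
  exact hL (h1.unique (hasDerivAt_const _ _))

theorem IsFlow.hasMatDeriv_conj {γ : ℂ → G} {X : Matrix (Fin n) (Fin n) ℂ} (h : IsFlow γ X)
    (Y : Matrix (Fin n) (Fin n) ℂ) :
    HasMatDeriv (fun s => toMat (γ s) * Y * toMat (γ s)⁻¹) (X * Y - Y * X) 0 := by
  have h1 : HasMatDeriv (fun s => toMat (γ s)⁻¹) (-X) 0 := fun i j => by
    have h2 : HasDerivAt (fun s => toMat (γ s) i j) (X i j) (-0 : ℂ) := by
      rw [neg_zero]; exact h.deriv i j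
    have := h2.comp (0 : ℂ) (hasDerivAt_neg (0 : ℂ))
    simp only [Function.comp_def, h.neg] at this
    exact this.congr_deriv (by simp)
  have := (h.deriv.mul_const Y).mul h1
  simp only [h.zero, inv_one, toMat_one, mul_one, one_mul, mul_neg, ← sub_eq_add_neg] at this
  exact this

/-- Conjugation by an element of `G` on the Lie algebra. -/
def adjoint (hG : IsZariskiClosed G) (a : G) (X : lieSubmodule G) : lieSubmodule G :=
  ⟨toMat a * X.1 * toMat a⁻¹, conj_mem_lieAlgebra hG a X.2⟩

theorem bracket_mem_of_conj_mem (hG : IsZariskiClosed G)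
    {W : Submodule ℂ (Matrix (Fin n) (Fin n) ℂ)} {Y : Matrix (Fin n) (Fin n) ℂ}
    (hW : ∀ a : G, toMat a * Y * toMat a⁻¹ ∈ W) (X : lieSubmodule G) :
    X.1 * Y - Y * X.1 ∈ W :=
  mem_of_hasMatDeriv ((isFlow_flow hG X).hasMatDeriv_conj Y) fun _ => hW _

/-- The Lie bracket. -/
def bracket (hG : IsZariskiClosed G) (X Y : lieSubmodule G) : lieSubmodule G :=
  ⟨X.1 * Y.1 - Y.1 * X.1,
    bracket_mem_of_conj_mem hG (W := lieSubmodule G) (fun a => conj_mem_lieAlgebra hG a Y.2) X⟩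

variable {V : Type} [AddCommGroup V] [Module ℂ V]

theorem eq_of_forall_dual {v w : V} (h : ∀ φ : Module.Dual ℂ V, φ v = φ w) : v = w := by
  rw [← sub_eq_zero, ← Module.forall_dual_apply_eq_zero_iff ℂ]
  intro φ
  rw [map_sub, h, sub_self]

theorem exists_differential (hG : IsZariskiClosed G) {ρ : Representation ℂ G V}
    (hρ : IsRational (coordRing G) ρ) :
    ∃ d : lieSubmodule G →ₗ[ℂ] Module.End ℂ V, ∀ (φ : Module.Dual ℂ V) (v : V),
      ∃ L : Matrix (Fin n) (Fin n) ℂ →ₗ[ℂ] ℂ, ∀ X : lieSubmodule G, φ (d X v) = L X.1 ∧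
        ∀ γ : ℂ → G, γ 0 = 1 → HasMatDeriv (fun s => toMat (γ s)) X.1 0 →
          HasDerivAt (fun t => φ (ρ (γ t) v)) (φ (d X v)) 0 := by
  have := hρ.1
  choose L hL using fun (φ : Module.Dual ℂ V) (v : V) =>
    exists_deriv_of_mem_coordRing (hρ.2 φ v) 1
  have hflow : ∀ φ v (X : lieSubmodule G),
      HasDerivAt (fun t => φ (ρ (flow hG X t) v)) (L φ v X.1) 0 := fun φ v X =>
    hL φ v _ _ (isFlow_flow hG X).zero (isFlow_flow hG X).deriv
  have hadd : ∀ φ v v' (X : lieSubmodule G), L φ (v + v') X.1 = L φ v X.1 + L φ v' X.1 :=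
    fun φ v v' X => by
      refine (hflow φ (v + v') X).unique ?_
      simpa using (hflow φ v X).fun_add (hflow φ v' X)
  have hsmul : ∀ φ (c : ℂ) v (X : lieSubmodule G), L φ (c • v) X.1 = c * L φ v X.1 :=
    fun φ c v X => by
      refine (hflow φ (c • v) X).unique ?_
      simpa using (hflow φ v X).const_mul c
  let b := Module.finBasis ℂ V
  let d : lieSubmodule G →ₗ[ℂ] Module.End ℂ V := LinearMap.mk₂ ℂ
    (fun X v => ∑ i, L (b.coord i) v X.1 • b i)
    (fun X Y v => by simp [add_smul, Finset.sum_add_distrib])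
    (fun c X v => by simp [Finset.smul_sum, smul_smul])
    (fun X v w => by simp [hadd, add_smul, Finset.sum_add_distrib])
    (fun c X v => by simp [hsmul, Finset.smul_sum, smul_smul])
  have hd : ∀ φ v (X : lieSubmodule G), φ (d X v) = L φ v X.1 := fun φ v X => by
    refine HasDerivAt.unique ?_ (hflow φ v X)
    have h1 : ∀ w, φ w = ∑ i, b.coord i w * φ (b i) := fun w => by
      conv_lhs => rw [← b.sum_repr w]
      rw [map_sum]
      exact Finset.sum_congr rfl fun i _ => by rw [map_smul, smul_eq_mul, b.coord_apply]
    have h2 : (fun t => φ (ρ (flow hG X t) v)) =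
        fun t => ∑ i, b.coord i (ρ (flow hG X t) v) * φ (b i) := funext fun t => h1 _
    rw [h2]
    have h3 : φ (d X v) = ∑ i, L (b.coord i) v X.1 * φ (b i) := by simp [d]
    rw [h3]
    exact HasDerivAt.fun_sum fun i _ => (hflow _ _ _).mul_const _
  refine ⟨d, fun φ v => ⟨L φ v, fun X => ⟨hd φ v X, fun γ h0 h => ?_⟩⟩⟩
  rw [hd]
  exact hL φ v γ X.1 h0 h

/-- The differential of a rational representation. -/
def differential (hG : IsZariskiClosed G) {ρ : Representation ℂ G V}
    (hρ : IsRational (coordRing G) ρ) : lieSubmodule G →ₗ[ℂ] Module.End ℂ V :=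
  (exists_differential hG hρ).choose

theorem exists_differential_eq (hG : IsZariskiClosed G) {ρ : Representation ℂ G V}
    (hρ : IsRational (coordRing G) ρ) (φ : Module.Dual ℂ V) (v : V) :
    ∃ L : Matrix (Fin n) (Fin n) ℂ →ₗ[ℂ] ℂ, ∀ X : lieSubmodule G,
      φ (differential hG hρ X v) = L X.1 := by
  obtain ⟨L, hL⟩ := (exists_differential hG hρ).choose_spec φ v
  exact ⟨L, fun X => (hL X).1⟩

theorem hasDerivAt_differential (hG : IsZariskiClosed G) {ρ : Representation ℂ G V}
    (hρ : IsRational (coordRing G) ρ) {γ : ℂ → G} {X : lieSubmodule G} (h0 : γ 0 = 1)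
    (h : HasMatDeriv (fun s => toMat (γ s)) X.1 0) (φ : Module.Dual ℂ V) (v : V) :
    HasDerivAt (fun t => φ (ρ (γ t) v)) (φ (differential hG hρ X v)) 0 := by
  obtain ⟨L, hL⟩ := (exists_differential hG hρ).choose_spec φ v
  exact (hL X).2 γ h0 h

theorem differential_conj (hG : IsZariskiClosed G) {ρ : Representation ℂ G V}
    (hρ : IsRational (coordRing G) ρ) (a : G) (X : lieSubmodule G) (v : V) :
    ρ a (differential hG hρ X v) = differential hG hρ (adjoint hG a X) (ρ a v) := by
  have := hρ.1
  refine eq_of_forall_dual fun φ => ?_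
  have hX := isFlow_flow hG X
  have h1 := hasDerivAt_differential hG hρ hX.zero hX.deriv (φ.comp (ρ a)) v
  have h2 := hasDerivAt_differential hG hρ (γ := fun t => a * flow hG X t * a⁻¹)
    (X := adjoint hG a X) (by simp [hX.zero]) (by
      simp only [toMat_mul]; exact (hX.deriv.const_mul _).mul_const _) φ (ρ a v)
  have h3 : (fun t => φ (ρ (a * flow hG X t * a⁻¹) (ρ a v))) =
      fun t => (φ.comp (ρ a)) (ρ (flow hG X t) v) := by
    ext t
    rw [← Module.End.mul_apply, ← map_mul, inv_mul_cancel_right, map_mul]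
    rfl
  rw [h3] at h2
  exact h1.unique h2

theorem differential_bracket (hG : IsZariskiClosed G) {ρ : Representation ℂ G V}
    (hρ : IsRational (coordRing G) ρ) (X Y : lieSubmodule G) (v : V) :
    differential hG hρ X (differential hG hρ Y v) =
      differential hG hρ Y (differential hG hρ X v) +
        differential hG hρ (bracket hG X Y) v := by
  have := hρ.1
  refine eq_of_forall_dual fun φ => ?_
  have hX := isFlow_flow hG X
  let b := Module.finBasis ℂ V
  choose L hL using fun i => exists_differential_eq hG hρ φ (b i)
  have hB : ∀ (Z : lieSubmodule G) (w : V),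
      φ (differential hG hρ Z w) = ∑ i, b.coord i w * L i Z.1 := fun Z w => by
    conv_lhs => rw [← b.sum_repr w]
    rw [map_sum, map_sum]
    exact Finset.sum_congr rfl fun i _ => by
      rw [map_smul, map_smul, smul_eq_mul, b.coord_apply, hL]
  have h1 := hasDerivAt_differential hG hρ hX.zero hX.deriv φ (differential hG hρ Y v)
  have h2 : (fun t => φ (ρ (flow hG X t) (differential hG hρ Y v))) = fun t =>
      ∑ i, b.coord i (ρ (flow hG X t) v) * L i (adjoint hG (flow hG X t) Y).1 := by
    ext t
    rw [differential_conj, hB]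
  rw [h2] at h1
  refine h1.unique ?_
  have h3 : HasDerivAt (fun t => ∑ i, b.coord i (ρ (flow hG X t) v) *
      L i (adjoint hG (flow hG X t) Y).1)
      (∑ i, (b.coord i (differential hG hρ X v) * L i (adjoint hG (flow hG X 0) Y).1 +
        b.coord i (ρ (flow hG X 0) v) * L i (bracket hG X Y).1)) 0 :=
    HasDerivAt.fun_sum fun i _ => (hasDerivAt_differential hG hρ hX.zero hX.deriv _ _).mul
      ((hX.hasMatDeriv_conj Y.1).linear (L i))
  refine h3.congr_deriv ?_
  have h4 : adjoint hG (flow hG X 0) Y = Y := by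
    rw [hX.zero]
    exact Subtype.ext (by simp [adjoint, toMat_one])
  rw [h4, hX.zero]
  simp only [Finset.sum_add_distrib, map_one, Module.End.one_apply]
  simp [hB]

theorem stable_of_differential_stable (hG : IsZariskiClosed G) (hconn : IsConnectedGroup G)
    {ρ : Representation ℂ G V} (hρ : IsRational (coordRing G) ρ) {W : Submodule ℂ V}
    (hW : ∀ (X : lieSubmodule G), ∀ w ∈ W, differential hG hρ X w ∈ W) (g : G) {w : V}
    (hw : w ∈ W) : ρ g w ∈ W :=
  stable_of_lie_stable hG hconn hρ (fun X w hw => ⟨_, hW X w hw, fun φ =>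
    hasDerivAt_differential hG hρ (isFlow_flow hG X).zero (isFlow_flow hG X).deriv φ w⟩) g hw

end Differential

/-! ### Weight spaces -/

section WeightSpaces

variable {S : Type} [Group S] {V : Type} [AddCommGroup V] [Module ℂ V]

theorem Weight.ext {χ ψ : Weight S} (h : ∀ s, (χ.toHom s : ℂ) = ψ.toHom s) : χ = ψ :=
  MonoidHom.ext (f := χ.toHom) (g := ψ.toHom) fun s => Units.ext (h s)

theorem Weight.toHom_add (χ ψ : Weight S) (s : S) :
    (χ + ψ).toHom s = χ.toHom s * ψ.toHom s := rfl

theorem Weight.toHom_neg (χ : Weight S) (s : S) : (-χ).toHom s = (χ.toHom s)⁻¹ := rfl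

/-- Distinct characters are linearly independent functions. -/
theorem linearIndependent_weight :
    LinearIndependent ℂ (fun (χ : Weight S) (s : S) => (χ.toHom s : ℂ)) := by
  have h := linearIndependent_monoidHom S ℂ
  exact h.comp (fun χ : Weight S => (Units.coeHom ℂ).comp χ.toHom) fun χ ψ hχ =>
    Weight.ext fun s => DFunLike.congr_fun hχ s

/-- The weight space of `σ` for the character `χ`. -/
def weightSpace (σ : Representation ℂ S V) (χ : Weight S) : Submodule ℂ V where
  carrier := {v | ∀ s, σ s v = (χ.toHom s : ℂ) • v}
  zero_mem' := fun s => by simp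
  add_mem' := fun hv hw s => by simp [hv s, hw s]
  smul_mem' := fun c v hv s => by simp [hv s, smul_comm c]

/-- A stable subspace contains the weight components of its elements. -/
theorem component_mem {σ : Representation ℂ S V} {W : Submodule ℂ V}
    (hW : ∀ s, ∀ w ∈ W, σ s w ∈ W) {f : Weight S →₀ V} (hf : ∀ χ, f χ ∈ weightSpace σ χ)
    (hs : (f.sum fun _ v => v) ∈ W) (χ : Weight S) : f χ ∈ W := by
  by_contra hχ
  obtain ⟨φ, hφ, hφW⟩ := Submodule.exists_le_ker_of_notMem hχ
  have h1 : ∑ ψ ∈ f.support, φ (f ψ) • (fun s : S => (ψ.toHom s : ℂ)) = 0 := by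
    ext s
    have h2 : φ (σ s (f.sum fun _ v => v)) = 0 := hφW (hW s _ hs)
    rw [Finsupp.sum, map_sum, map_sum] at h2
    rw [Finset.sum_apply, Pi.zero_apply, ← h2]
    refine Finset.sum_congr rfl fun ψ _ => ?_
    rw [hf ψ s, map_smul, Pi.smul_apply, smul_eq_mul, smul_eq_mul, mul_comm]
  have h2 := linearIndependent_iff'.1 linearIndependent_weight f.support (fun ψ => φ (f ψ)) h1 χ
  by_cases hχs : χ ∈ f.support
  · exact hφ (h2 hχs)
  · rw [Finsupp.notMem_support_iff.1 hχs] at hφ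
    exact hφ (map_zero _)

theorem component_eq_zero {σ : Representation ℂ S V} {f : Weight S →₀ V}
    (hf : ∀ χ, f χ ∈ weightSpace σ χ) (hs : (f.sum fun _ v => v) = 0) (χ : Weight S) : f χ = 0 :=
  component_mem (W := ⊥) (fun s w hw => by
    rw [(Submodule.mem_bot ℂ).1 hw, map_zero]; exact zero_mem _) hf hs χ

theorem exists_components {σ : Representation ℂ S V} {Q : Set (Weight S)} {v : V}
    (hv : v ∈ ⨆ χ ∈ Q, weightSpace σ χ) : ∃ f : Weight S →₀ V, (∀ χ, f χ ∈ weightSpace σ χ) ∧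
      (∀ χ ∉ Q, f χ = 0) ∧ (f.sum fun _ v => v) = v := by
  obtain ⟨f, hf, hs⟩ := (Submodule.mem_iSup_iff_exists_finsupp _ _).1 hv
  refine ⟨f, fun χ => ?_, fun χ hχ => ?_, hs⟩
  · exact (iSup_le fun _ => le_rfl : ⨆ (_ : χ ∈ Q), weightSpace σ χ ≤ weightSpace σ χ) (hf χ)
  · have := hf χ
    simpa [hχ] using this

/-- If `v ≠ 0` of weight `ψ` is a sum of vectors with weights in `Q`, then `ψ ∈ Q`. -/
theorem weight_mem_of_mem_iSup {σ : Representation ℂ S V} {Q : Set (Weight S)} {v : V}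
    (hv : v ∈ ⨆ χ ∈ Q, weightSpace σ χ) (h0 : v ≠ 0) {ψ : Weight S} (hψ : v ∈ weightSpace σ ψ) :
    ψ ∈ Q := by
  classical
  obtain ⟨f, hf, hfQ, hs⟩ := exists_components hv
  by_contra hn
  have h1 := component_eq_zero (σ := σ) (f := f - Finsupp.single ψ v) (fun χ => by
    rw [Finsupp.sub_apply]
    refine sub_mem (hf χ) ?_
    by_cases h : χ = ψ
    · subst h; simpa using hψ
    · simp [Ne.symm h]) (by
    rw [Finsupp.sum_sub_index (fun _ _ _ => rfl), hs, Finsupp.sum_single_index rfl, sub_self]) ψ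
  rw [Finsupp.sub_apply, hfQ ψ hn, Finsupp.single_eq_same, zero_sub, neg_eq_zero] at h1
  exact h0 h1

end WeightSpaces

/-! ### Regular characters and the pairing -/

section Pairing

variable {n : ℕ} {G : Subgroup (GL (Fin n) ℂ)} {T : Subgroup G}

theorem pairing_eq {χ : Weight T} {h : ℂˣ →* T} {k : ℤ}
    (hk : ∀ z : ℂˣ, χ.toHom (h z) = z ^ k) : pairing χ h = k := by
  have H : ∃ k : ℤ, ∀ z : ℂˣ, χ.toHom (h z) = z ^ k := ⟨k, hk⟩
  rw [pairing, dif_pos H]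
  have h1 := H.choose_spec (Units.mk0 2 two_ne_zero)
  rw [hk] at h1
  have h2 : (2 : ℝ) ^ k = (2 : ℝ) ^ H.choose := by
    have := congrArg (fun u : ℂˣ => ‖(u : ℂ)‖) h1
    simpa using this
  exact (zpow_right_injective₀ (by norm_num) (by norm_num) h2).symm

theorem laurent_eval₂_eq_sum {R S : Type*} [CommSemiring R] [CommSemiring S] (f : R →+* S) (x : Sˣ)
    (p : LaurentPolynomial R) :
    LaurentPolynomial.eval₂ f x p = p.coeff.sum fun k a => f a * ((x ^ k : Sˣ) : S) := by
  induction p using LaurentPolynomial.induction_on' with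
  | add p q hp hq =>
    rw [map_add, hp, hq, AddMonoidAlgebra.coeff_add, Finsupp.sum_add_index']
    · intro k; simp
    · intro k a b; rw [map_add, add_mul]
  | C_mul_T k a =>
    rw [LaurentPolynomial.eval₂_C_mul_T, ← LaurentPolynomial.single_eq_C_mul_T,
      AddMonoidAlgebra.coeff_single, Finsupp.sum_single_index]
    simp

theorem exists_zpow_of_laurent (f : ℂˣ →* ℂˣ) {p : LaurentPolynomial ℂ}
    (hp : ∀ z, (f z : ℂ) = LaurentPolynomial.eval₂ (RingHom.id ℂ) z p) :
    ∃ k : ℤ, ∀ z, f z = z ^ k := by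
  classical
  by_contra! hne
  let w : ℤ → Weight ℂˣ := fun k => Weight.ofHom (zpowGroupHom k)
  have hw : ∀ k z, (w k).toHom z = z ^ k := fun _ _ => rfl
  have hwinj : Function.Injective w := fun k l hkl => by
    have h1 : (w k).toHom (Units.mk0 2 two_ne_zero) = (w l).toHom (Units.mk0 2 two_ne_zero) := by
      rw [hkl]
    rw [hw, hw] at h1
    have h2 : (2 : ℝ) ^ k = (2 : ℝ) ^ l := by
      have := congrArg (fun u : ℂˣ => ‖(u : ℂ)‖) h1
      simpa using this
    exact zpow_right_injective₀ (by norm_num) (by norm_num) h2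
  let F : Weight ℂˣ := Weight.ofHom f
  have hF : ∀ k, w k ≠ F := fun k hk => by
    obtain ⟨z, hz⟩ := hne k
    apply hz
    change F.toHom z = _
    rw [← hk, hw]
  have hsum : ∀ z, (f z : ℂ) = ∑ k ∈ p.coeff.support, p.coeff k * ((w k).toHom z : ℂ) := fun z => by
    rw [hp z, laurent_eval₂_eq_sum]
    rfl
  have hmem : (fun z => (F.toHom z : ℂ)) ∈ Submodule.span ℂ
      ((fun (χ : Weight ℂˣ) (s : ℂˣ) => (χ.toHom s : ℂ)) '' (Set.range w)) := by
    have : (fun z => (F.toHom z : ℂ)) =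
        ∑ k ∈ p.coeff.support, p.coeff k • (fun z => ((w k).toHom z : ℂ)) := by
      ext z
      rw [Finset.sum_apply]
      exact hsum z
    rw [this]
    exact Submodule.sum_mem _ fun k _ => Submodule.smul_mem _ _
      (Submodule.subset_span ⟨w k, ⟨k, rfl⟩, rfl⟩)
  have := linearIndependent_weight.notMem_span_image (s := Set.range w) (x := F) (by
    rintro ⟨k, hk⟩; exact hF k hk)
  exact this hmem

theorem exists_laurent_of_mem_coordRing {h : ℂˣ →* T} (hh : IsCocharacter h) {f : G → ℂ}
    (hf : f ∈ coordRing G) : ∃ p : LaurentPolynomial ℂ, ∀ z : ℂˣ,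
      f (h z : G) = LaurentPolynomial.eval₂ (RingHom.id ℂ) z p := by
  induction hf using Algebra.adjoin_induction with
  | mem f hf =>
    rcases hf with ⟨ij, rfl⟩ | rfl
    · exact hh ij.1 ij.2
    · choose p hp using hh
      let q : LaurentPolynomial ℂ := (Matrix.of p).det
      have hq : ∀ z : ℂˣ, (toMat (h z : G)).det = LaurentPolynomial.eval₂ (RingHom.id ℂ) z q :=
        fun z => by
          rw [RingHom.map_det]
          congr 1
          ext i j
          exact hp i j z
      obtain ⟨k, hk⟩ := exists_zpow_of_laurent
        ((Matrix.GeneralLinearGroup.det.comp G.subtype).comp (T.subtype.comp h)) hq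
      refine ⟨LaurentPolynomial.T (-k), fun z => ?_⟩
      have h1 := congrArg Units.val (hk z)
      change (toMat (h z : G)).det = _ at h1
      change ((toMat (h z : G)).det)⁻¹ = _
      rw [h1, LaurentPolynomial.eval₂_T, ← Units.val_inv_eq_inv_val, _root_.zpow_neg]
  | algebraMap r => exact ⟨LaurentPolynomial.C r, fun z => by simp⟩
  | add f f' _ _ e e' =>
    obtain ⟨p, hp⟩ := e
    obtain ⟨q, hq⟩ := e'
    exact ⟨p + q, fun z => by rw [map_add, ← hp, ← hq]; rfl⟩
  | mul f f' _ _ e e' =>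
    obtain ⟨p, hp⟩ := e
    obtain ⟨q, hq⟩ := e'
    exact ⟨p * q, fun z => by rw [map_mul, ← hp, ← hq]; rfl⟩

theorem comp_inv_mem_coordRing {f : G → ℂ} (hf : f ∈ coordRing G) :
    (fun g => f g⁻¹) ∈ coordRing G := by
  induction hf using Algebra.adjoin_induction with
  | mem f hf =>
    rcases hf with ⟨ij, rfl⟩ | rfl
    · have : (fun g : G => toMat g⁻¹ ij.1 ij.2) = (genericInv G ij.1 ij.2 : coordRing G) := by
        ext g
        rw [← map_evalAt_genericInv]
        rfl
      change (fun g : G => toMat g⁻¹ ij.1 ij.2) ∈ _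
      rw [this]
      exact Subtype.mem _
    · have : (fun g : G => ((toMat g⁻¹).det)⁻¹) = ((genericMat G).det : coordRing G) := by
        ext g
        rw [← evalAt_apply, evalAt_det_genericMat]
        refine inv_eq_of_mul_eq_one_right ?_
        rw [← Matrix.det_mul, toMat_inv_mul, Matrix.det_one]
      change (fun g : G => ((toMat g⁻¹).det)⁻¹) ∈ _
      rw [this]
      exact Subtype.mem _
  | algebraMap r => exact Subalgebra.algebraMap_mem _ r
  | add f f' _ _ hf hf' => exact add_mem hf hf'
  | mul f f' _ _ hf hf' => exact mul_mem hf hf'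

/-- The characters of `T` that are restrictions of regular functions on `G`. -/
def regularWeights (T : Subgroup G) : AddSubgroup (Weight T) where
  carrier := {χ | ∃ f ∈ coordRing G, ∀ t : T, (χ.toHom t : ℂ) = f t}
  zero_mem' := ⟨1, one_mem _, fun t => by simp [Weight.toHom_zero]⟩
  add_mem' := by
    rintro χ ψ ⟨f, hf, hfχ⟩ ⟨f', hf', hfψ⟩
    exact ⟨f * f', mul_mem hf hf', fun t => by
      rw [Weight.toHom_add, Units.val_mul, hfχ, hfψ]; rfl⟩
  neg_mem' := by
    rintro χ ⟨f, hf, hfχ⟩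
    refine ⟨fun g => f g⁻¹, comp_inv_mem_coordRing hf, fun t => ?_⟩
    rw [Weight.toHom_neg, ← map_inv, hfχ]
    rfl

theorem pairing_spec {h : ℂˣ →* T} (hh : IsCocharacter h) {χ : Weight T}
    (hχ : χ ∈ regularWeights T) (z : ℂˣ) : χ.toHom (h z) = z ^ pairing χ h := by
  obtain ⟨f, hf, hfχ⟩ := hχ
  obtain ⟨p, hp⟩ := exists_laurent_of_mem_coordRing hh hf
  obtain ⟨k, hk⟩ := exists_zpow_of_laurent (χ.toHom.comp h) (p := p) fun z => by
    rw [← hp]; exact hfχ _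
  rw [pairing_eq hk]
  exact hk z

theorem pairing_add {h : ℂˣ →* T} (hh : IsCocharacter h) {χ ψ : Weight T}
    (hχ : χ ∈ regularWeights T) (hψ : ψ ∈ regularWeights T) :
    pairing (χ + ψ) h = pairing χ h + pairing ψ h :=
  pairing_eq fun z => by
    rw [Weight.toHom_add, pairing_spec hh hχ, pairing_spec hh hψ, _root_.zpow_add]

theorem pairing_neg {h : ℂˣ →* T} (hh : IsCocharacter h) {χ : Weight T}
    (hχ : χ ∈ regularWeights T) : pairing (-χ) h = -pairing χ h :=
  pairing_eq fun z => by rw [Weight.toHom_neg, pairing_spec hh hχ, _root_.zpow_neg]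

theorem pairing_sub {h : ℂˣ →* T} (hh : IsCocharacter h) {χ ψ : Weight T}
    (hχ : χ ∈ regularWeights T) (hψ : ψ ∈ regularWeights T) :
    pairing (χ - ψ) h = pairing χ h - pairing ψ h := by
  rw [sub_eq_add_neg, pairing_add hh hχ (neg_mem hψ), pairing_neg hh hψ, sub_eq_add_neg]

variable {V : Type} [AddCommGroup V] [Module ℂ V]

theorem IsWeight.mem_regularWeights {ρ : Representation ℂ G V}
    (hρ : IsRational (coordRing G) ρ) {χ : Weight T} (hχ : IsWeight T.subtype ρ χ) :
    χ ∈ regularWeights T := by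
  obtain ⟨v, hv, h⟩ := hχ
  have := hρ.1
  obtain ⟨φ, hφ⟩ : ∃ φ : Module.Dual ℂ V, φ v ≠ 0 := by
    by_contra! hc
    exact hv ((Module.forall_dual_apply_eq_zero_iff ℂ v).1 hc)
  refine ⟨matrixCoeff ρ ((φ v)⁻¹ • φ) v, hρ.2 _ _, fun t => ?_⟩
  have := h t
  rw [Subgroup.subtype_apply] at this
  simp only [matrixCoeff, LinearMap.smul_apply, this, map_smul, smul_eq_mul]
  field_simp

/-- The representation of `G` on matrices by conjugation. -/
def conjRep (G : Subgroup (GL (Fin n) ℂ)) : Representation ℂ G (Matrix (Fin n) (Fin n) ℂ) where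
  toFun a := LinearMap.mulRight ℂ (toMat a⁻¹) ∘ₗ LinearMap.mulLeft ℂ (toMat a)
  map_one' := by ext1 X; simp [toMat_one]
  map_mul' a b := by
    ext1 X
    simp [toMat_mul, mul_assoc]

theorem conjRep_apply (a : G) (X : Matrix (Fin n) (Fin n) ℂ) :
    conjRep G a X = toMat a * X * toMat a⁻¹ := rfl

theorem isRational_conjRep : IsRational (coordRing G) (conjRep G) := by
  refine ⟨inferInstance, fun φ X => ?_⟩
  have h1 : ∀ A : Matrix (Fin n) (Fin n) ℂ, φ A = ∑ i, ∑ j, A i j * φ (Matrix.single i j 1) := by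
    intro A
    conv_lhs => rw [Matrix.matrix_eq_sum_single A]
    simp only [map_sum]
    refine Finset.sum_congr rfl fun i _ => Finset.sum_congr rfl fun j _ => ?_
    rw [← smul_eq_mul, ← map_smul, Matrix.smul_single, smul_eq_mul, mul_one]
  have h2 : matrixCoeff (conjRep G) φ X = ((∑ i, ∑ j, (∑ k, (∑ l, genericMat G i l *
      algebraMap ℂ _ (X l k)) * genericInv G k j) * algebraMap ℂ _ (φ (Matrix.single i j 1)) :
        coordRing G) : G → ℂ) := by
    ext g
    rw [← evalAt_apply]
    have h3 : ∀ k j, evalAt g (genericInv G k j) = toMat g⁻¹ k j := fun k i => by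
      rw [← map_evalAt_genericInv]; rfl
    simp only [map_sum, map_mul, evalAt_genericMat, h3, AlgHom.commutes]
    rw [matrixCoeff, h1, conjRep_apply]
    simp only [Matrix.mul_apply]
    rfl
  rw [h2]
  exact Subtype.mem _

end Pairing

/-! ### Nilpotent matrices -/

section Nilpotent

theorem isNilpotent_commutator {R : Type*} [Ring R] [Algebra ℂ R] {A B C : R}
    (hC : A * B - B * A = C) (hAC : Commute A C) (hA : IsNilpotent A) : IsNilpotent C := by
  have hpow : ∀ m : ℕ, A ^ (m + 1) * B - B * A ^ (m + 1) = ((m : ℂ) + 1) • (A ^ m * C) := by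
    intro m
    induction m with
    | zero => simp [hC]
    | succ m ih =>
      have h1 : A ^ (m + 2) * B - B * A ^ (m + 2) =
          A * (A ^ (m + 1) * B - B * A ^ (m + 1)) + (A * B - B * A) * A ^ (m + 1) := by
        rw [pow_succ' A (m + 1)]; noncomm_ring
      rw [h1, ih, hC, ← (hAC.pow_left (m + 1)).eq, mul_smul_comm, ← mul_assoc, ← pow_succ']
      push_cast
      simp only [add_smul, one_smul]
  have key : ∀ (m e : ℕ), A ^ m * C ^ e = 0 → IsNilpotent C := by
    intro m
    induction m with
    | zero => intro e he; exact ⟨e, by simpa using he⟩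
    | succ m ih =>
      intro e he
      refine ih (e + (1 + e)) ?_
      have hcomm : C ^ e * A ^ (m + 1) = 0 := by rw [← (hAC.pow_pow (m + 1) e).eq, he]
      have h1 := congrArg (fun x => C ^ e * x * C ^ e) (hpow m)
      have h2 : C ^ e * (A ^ (m + 1) * B - B * A ^ (m + 1)) * C ^ e =
          (C ^ e * A ^ (m + 1)) * B * C ^ e - C ^ e * B * (A ^ (m + 1) * C ^ e) := by noncomm_ring
      simp only [h2, hcomm, he, zero_mul, mul_zero, sub_zero] at h1
      have h3 : (0 : R) = ((m : ℂ) + 1) • (C ^ e * (A ^ m * C) * C ^ e) := by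
        rw [h1, mul_smul_comm, smul_mul_assoc]
      have h4 := (smul_eq_zero.1 h3.symm).resolve_left (by exact_mod_cast Nat.succ_ne_zero m)
      rw [pow_add, pow_add, pow_one, ← mul_assoc, (hAC.pow_pow m e).eq, ← h4]
      noncomm_ring
  obtain ⟨N, hN⟩ := hA
  exact key N 0 (by simp [hN])

theorem trace_mul_eq_zero_of_commute {V : Type*} [AddCommGroup V] [Module ℂ V]
    [FiniteDimensional ℂ V] {A B C : Module.End ℂ V} (hC : A * B - B * A = C)
    (hAC : Commute A C) (hA : IsNilpotent A) : LinearMap.trace ℂ V (A * B) = 0 := by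
  have hCn := isNilpotent_commutator hC hAC hA
  have hAB : A * B = B * A + C := by rw [← hC]; abel
  have hstep : ∀ k : ℕ, A * (A * B + (k : ℂ) • C) = (A * B + ((k : ℂ) + 1) • C) * A := by
    intro k
    have h1 : A * (A * B) = A * B * A + C * A := by
      conv_lhs => rw [hAB]
      rw [mul_add, hAC.eq, mul_assoc]
    rw [mul_add, h1, mul_smul_comm, hAC.eq, add_mul, smul_mul_assoc, add_smul, one_smul]
    abel
  have hroot : ∀ μ ∈ (A * B).charpoly.roots, μ = 0 := by
    intro μ hμ
    by_contra hμ0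
    have hev : (A * B).HasEigenvalue μ :=
      (Module.End.hasEigenvalue_iff_isRoot_charpoly _ _).2 (Polynomial.isRoot_of_mem_roots hμ)
    obtain ⟨v, hv⟩ := hev.exists_hasEigenvector
    have h1 : ∀ k : ℕ, (A * B + (k : ℂ) • C) ((A ^ k) v) = μ • (A ^ k) v := by
      intro k
      induction k with
      | zero => simpa using hv.apply_eq_smul
      | succ k ih =>
        have := congrArg A ih
        rw [← Module.End.mul_apply, hstep, Module.End.mul_apply, map_smul] at this
        push_cast
        rw [pow_succ', Module.End.mul_apply, this]
    have h2 : ∀ k : ℕ, (A ^ k) v ≠ 0 := by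
      intro k
      induction k with
      | zero => simpa using hv.2
      | succ k ih =>
        intro h0
        rw [pow_succ', Module.End.mul_apply] at h0
        have h3 := h1 k
        rw [hAB] at h3
        simp only [LinearMap.add_apply, Module.End.mul_apply, h0, map_zero, zero_add,
          LinearMap.smul_apply] at h3
        have h4 : C.HasEigenvector (μ / ((k : ℂ) + 1)) ((A ^ k) v) := by
          refine ⟨Module.End.mem_eigenspace_iff.2 ?_, ih⟩
          have hk : (k : ℂ) + 1 ≠ 0 := by exact_mod_cast Nat.succ_ne_zero k
          have h5 : ((k : ℂ) + 1) • C ((A ^ k) v) = μ • (A ^ k) v := by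
            rw [← h3, add_smul, one_smul, add_comm]
          rw [div_eq_inv_mul, mul_smul, ← h5, smul_smul, inv_mul_cancel₀ hk, one_smul]
        have h6 := Module.End.HasEigenvalue.isNilpotent_of_isNilpotent hCn
          (Module.End.hasEigenvalue_of_hasEigenvector h4)
        rw [isNilpotent_iff_eq_zero, div_eq_zero_iff] at h6
        rcases h6 with h6 | h6
        · exact hμ0 h6
        · exact Nat.cast_add_one_ne_zero k h6
    obtain ⟨N, hN⟩ := hA
    exact h2 N (by rw [hN]; rfl)
  rw [Module.End.trace_eq_sum_roots_charpoly_of_splits (IsAlgClosed.splits _)]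
  exact Multiset.sum_eq_zero hroot

/-- A nilpotent matrix lies in the image of the square of its adjoint action. -/
theorem exists_double_bracket_eq {n : ℕ} {A : Matrix (Fin n) (Fin n) ℂ} (hA : IsNilpotent A) :
    ∃ Y, A * (A * Y - Y * A) - (A * Y - Y * A) * A = A := by
  let ad : Matrix (Fin n) (Fin n) ℂ →ₗ[ℂ] Matrix (Fin n) (Fin n) ℂ :=
    LinearMap.mulLeft ℂ A - LinearMap.mulRight ℂ A
  have had : ∀ Y, ad Y = A * Y - Y * A := fun _ => rfl
  by_contra! hne
  have hmem : A ∉ LinearMap.range (ad ∘ₗ ad) := by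
    rintro ⟨Y, hY⟩
    exact hne Y (by simpa [had] using hY)
  obtain ⟨φ, hφ, hφr⟩ := Submodule.exists_le_ker_of_notMem hmem
  let Z : Matrix (Fin n) (Fin n) ℂ := Matrix.of fun i j => φ (Matrix.single j i 1)
  have hZ : ∀ M, φ M = (Z * M).trace := by
    intro M
    conv_lhs => rw [Matrix.matrix_eq_sum_single M]
    simp only [map_sum, Matrix.trace, Matrix.diag_apply, Matrix.mul_apply, Z, Matrix.of_apply]
    rw [Finset.sum_comm]
    refine Finset.sum_congr rfl fun j _ => Finset.sum_congr rfl fun i _ => ?_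
    rw [mul_comm, ← smul_eq_mul, ← map_smul, Matrix.smul_single, smul_eq_mul, mul_one]
  have hskew : ∀ U W, (U * ad W).trace = -(ad U * W).trace := by
    intro U W
    simp only [had, mul_sub, sub_mul, Matrix.trace_sub]
    rw [← mul_assoc U W A, Matrix.trace_mul_comm (U * W) A]
    simp only [mul_assoc]
    ring
  have hcomm : ad (ad Z) = 0 := by
    have h1 : ∀ W, (ad (ad Z) * W).trace = 0 := by
      intro W
      have : φ (ad (ad W)) = 0 := hφr ⟨W, rfl⟩
      rw [hZ, hskew, hskew, neg_neg] at this
      exact this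
    ext i j
    have := h1 (Matrix.single j i 1)
    simpa [Matrix.trace_mul_single] using this
  apply hφ
  rw [hZ, Matrix.trace_mul_comm]
  let e := Matrix.toLinAlgEquiv' (R := ℂ) (n := Fin n)
  have h2 : LinearMap.trace ℂ _ (e A * e Z) = 0 := by
    refine trace_mul_eq_zero_of_commute (C := e (ad Z)) ?_ ?_ (hA.map e)
    · rw [had, map_sub, map_mul, map_mul]
    · have : A * ad Z = ad Z * A := by rw [← sub_eq_zero, ← had, hcomm]
      change e A * e (ad Z) = e (ad Z) * e A
      rw [← map_mul, this, map_mul]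
  rw [← map_mul] at h2
  rw [← h2]
  exact (Matrix.trace_toLin'_eq _).symm

end Nilpotent

/-! ### Roots -/

section RootFacts

variable {n : ℕ} {G : Subgroup (GL (Fin n) ℂ)} {T : Subgroup G}

/-- The action of `T` on matrices by conjugation. -/
abbrev torusConj (T : Subgroup G) : Representation ℂ T (Matrix (Fin n) (Fin n) ℂ) :=
  MonoidHom.comp (conjRep G) T.subtype

theorem torusConj_apply (t : T) (X : Matrix (Fin n) (Fin n) ℂ) :
    torusConj T t X = toMat (t : G) * X * toMat (t : G)⁻¹ := rfl

theorem mem_roots {α : Weight T} : α ∈ roots T ↔ α ≠ 0 ∧ ∃ X ∈ lieAlgebra G, X ≠ 0 ∧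
    X ∈ weightSpace (torusConj T) α := Iff.rfl

theorem roots_subset_regularWeights : roots T ⊆ (regularWeights T : Set (Weight T)) := by
  rintro α ⟨_, X, _, hX0, hX⟩
  exact IsWeight.mem_regularWeights isRational_conjRep ⟨X, hX0, hX⟩

theorem mem_iSup_weightSpace_torusConj (hT : IsTorus T) (M : Matrix (Fin n) (Fin n) ℂ) :
    M ∈ ⨆ χ ∈ (Set.univ : Set (Weight T)), weightSpace (torusConj T) χ := by
  obtain ⟨_, _, Q, hQ⟩ := hT
  let D : T → Matrix (Fin n) (Fin n) ℂ := fun t =>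
    (Q : Matrix (Fin n) (Fin n) ℂ) * toMat (t : G) * ((Q⁻¹ : GL (Fin n) ℂ) : Matrix _ _ ℂ)
  have hQQ : (Q : Matrix (Fin n) (Fin n) ℂ) * ((Q⁻¹ : GL (Fin n) ℂ) : Matrix _ _ ℂ) = 1 :=
    Units.mul_inv Q
  have hQQ' : ((Q⁻¹ : GL (Fin n) ℂ) : Matrix (Fin n) (Fin n) ℂ) * (Q : Matrix _ _ ℂ) = 1 :=
    Units.inv_mul Q
  have hD : ∀ t, (D t).IsDiag := fun t => hQ t t.2
  have hDmul : ∀ s t, D (s * t) = D s * D t := fun s t => by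
    have : D s * D t = (Q : Matrix (Fin n) (Fin n) ℂ) * toMat (s : G) *
        (((Q⁻¹ : GL (Fin n) ℂ) : Matrix (Fin n) (Fin n) ℂ) * (Q : Matrix _ _ ℂ)) * toMat (t : G) *
        ((Q⁻¹ : GL (Fin n) ℂ) : Matrix _ _ ℂ) := by simp only [D, mul_assoc]
    rw [this, hQQ', mul_one]
    simp only [D, Subgroup.coe_mul, toMat_mul, mul_assoc]
  have hDone : D 1 = 1 := by simp [D, toMat_one]
  have hdd : ∀ t, D t = Matrix.diagonal fun i => D t i i := fun t => (hD t).diagonal_diag.symm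
  let e : Fin n → (T →* ℂ) := fun i =>
    { toFun := fun t => D t i i
      map_one' := by rw [hDone, Matrix.one_apply_eq]
      map_mul' := fun s t => by
        rw [hDmul, hdd s, hdd t, Matrix.diagonal_mul_diagonal]
        simp }
  let w : Fin n → Weight T := fun i => Weight.ofHom (e i).toHomUnits
  have hw : ∀ i t, ((w i).toHom t : ℂ) = D t i i := fun _ _ => rfl
  have key : ∀ i j, ((Q⁻¹ : GL (Fin n) ℂ) : Matrix (Fin n) (Fin n) ℂ) *
      Matrix.single i j 1 * (Q : Matrix _ _ ℂ) ∈ weightSpace (torusConj T) (w i - w j) := by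
    intro i j t
    rw [torusConj_apply]
    have h1 : toMat (t : G) * ((Q⁻¹ : GL (Fin n) ℂ) : Matrix (Fin n) (Fin n) ℂ) =
        ((Q⁻¹ : GL (Fin n) ℂ) : Matrix (Fin n) (Fin n) ℂ) * D t := by
      simp only [D, ← mul_assoc, hQQ', one_mul]
    have h2 : (Q : Matrix (Fin n) (Fin n) ℂ) * toMat (t : G)⁻¹ =
        D t⁻¹ * (Q : Matrix (Fin n) (Fin n) ℂ) := by
      simp only [D, mul_assoc, hQQ', mul_one]
      rfl
    have h3 : D t * Matrix.single i j 1 * D t⁻¹ =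
        ((w i - w j).toHom t : ℂ) • Matrix.single i j 1 := by
      rw [hdd t, hdd t⁻¹]
      have h4 : ((w i - w j).toHom t : ℂ) = D t i i * D t⁻¹ j j := by
        rw [sub_eq_add_neg, Weight.toHom_add, Weight.toHom_neg, ← map_inv, Units.val_mul, hw, hw]
      rw [h4]
      ext a b
      rw [Matrix.mul_diagonal, Matrix.diagonal_mul, Matrix.smul_apply, Matrix.single_apply]
      split_ifs with h
      · obtain ⟨rfl, rfl⟩ := h
        simp
      · simp
    calc _ = (toMat (t : G) * ((Q⁻¹ : GL (Fin n) ℂ) : Matrix (Fin n) (Fin n) ℂ)) *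
          Matrix.single i j 1 * ((Q : Matrix (Fin n) (Fin n) ℂ) * toMat (t : G)⁻¹) := by
            simp only [mul_assoc]
      _ = ((Q⁻¹ : GL (Fin n) ℂ) : Matrix (Fin n) (Fin n) ℂ) *
          (D t * Matrix.single i j 1 * D t⁻¹) * (Q : Matrix (Fin n) (Fin n) ℂ) := by
            rw [h1, h2]; simp only [mul_assoc]
      _ = _ := by rw [h3, Matrix.mul_smul, Matrix.smul_mul]
  have hM : M = ∑ i, ∑ j, ((Q : Matrix (Fin n) (Fin n) ℂ) * M *
      ((Q⁻¹ : GL (Fin n) ℂ) : Matrix (Fin n) (Fin n) ℂ)) i j •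
      (((Q⁻¹ : GL (Fin n) ℂ) : Matrix (Fin n) (Fin n) ℂ) *
      Matrix.single i j 1 * (Q : Matrix _ _ ℂ)) := by
    set N := (Q : Matrix (Fin n) (Fin n) ℂ) * M *
      ((Q⁻¹ : GL (Fin n) ℂ) : Matrix (Fin n) (Fin n) ℂ) with hN
    have h1 : M = ((Q⁻¹ : GL (Fin n) ℂ) : Matrix (Fin n) (Fin n) ℂ) * N *
        (Q : Matrix (Fin n) (Fin n) ℂ) := by
      rw [hN, mul_assoc, mul_assoc, mul_assoc, hQQ', mul_one, ← mul_assoc, hQQ', one_mul]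
    conv_lhs => rw [h1, Matrix.matrix_eq_sum_single N]
    simp only [Matrix.mul_sum, Matrix.sum_mul]
    refine Finset.sum_congr rfl fun i _ => Finset.sum_congr rfl fun j _ => ?_
    rw [← Matrix.smul_mul, ← Matrix.mul_smul, Matrix.smul_single, smul_eq_mul, mul_one]
  rw [hM]
  exact Submodule.sum_mem _ fun i _ => Submodule.sum_mem _ fun j _ => Submodule.smul_mem _ _
    (Submodule.mem_iSup_of_mem (w i - w j) (Submodule.mem_iSup_of_mem (Set.mem_univ _) (key i j)))

/-- The decomposition of an element of the Lie algebra into weight vectors. -/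
theorem exists_lie_components (hG : IsZariskiClosed G) (hT : IsTorus T) (X : lieSubmodule G) :
    ∃ f : Weight T →₀ Matrix (Fin n) (Fin n) ℂ, (∀ χ, f χ ∈ weightSpace (torusConj T) χ) ∧
      (∀ χ, f χ ∈ lieAlgebra G) ∧ (f.sum fun _ v => v) = X.1 := by
  obtain ⟨f, hf, _, hs⟩ := exists_components (mem_iSup_weightSpace_torusConj hT X.1)
  refine ⟨f, hf, fun χ => ?_, hs⟩
  have hmem : (f.sum fun _ v => v) ∈ lieSubmodule G := hs ▸ X.2
  exact component_mem (σ := torusConj T) (W := lieSubmodule G)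
    (fun (t : T) w hw => conj_mem_lieAlgebra hG (t : G) hw) hf hmem χ

theorem finite_setOf_zpow_eigenvalue {V : Type*} [AddCommGroup V] [Module ℂ V]
    [FiniteDimensional ℂ V] (f : Module.End ℂ V) :
    {k : ℤ | f.HasEigenvalue ((2 : ℂ) ^ k)}.Finite := by
  have hinj : Function.Injective fun k : ℤ => (2 : ℂ) ^ k := fun k l hkl => by
    have h2 : (2 : ℝ) ^ k = (2 : ℝ) ^ l := by
      have := congrArg (fun u : ℂ => ‖u‖) hkl
      simpa using this
    exact zpow_right_injective₀ (by norm_num) (by norm_num) h2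
  exact (Module.End.finite_hasEigenvalue f).preimage hinj.injOn

theorem weightSpace_mul {χ ψ : Weight T} {X Y : Matrix (Fin n) (Fin n) ℂ}
    (hX : X ∈ weightSpace (torusConj T) χ) (hY : Y ∈ weightSpace (torusConj T) ψ) :
    X * Y ∈ weightSpace (torusConj T) (χ + ψ) := fun t => by
  have h1 := hX t
  have h2 := hY t
  rw [torusConj_apply] at h1 h2 ⊢
  have h3 : toMat (t : G) * (X * Y) * toMat (t : G)⁻¹ = toMat (t : G) * X *
      (toMat (t : G)⁻¹ * toMat (t : G)) * Y * toMat (t : G)⁻¹ := by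
    rw [toMat_inv_mul, mul_one]; simp only [mul_assoc]
  have h4 : toMat (t : G) * X * (toMat (t : G)⁻¹ * toMat (t : G)) * Y * toMat (t : G)⁻¹ =
      (toMat (t : G) * X * toMat (t : G)⁻¹) * (toMat (t : G) * Y * toMat (t : G)⁻¹) := by
    simp only [mul_assoc]
  rw [h3, h4, h1, h2, Weight.toHom_add, Units.val_mul, Matrix.smul_mul, Matrix.mul_smul, smul_smul]

theorem isNilpotent_of_mem_weightSpace {c : ℂˣ →* T} (hc : IsCocharacter c) {α : Weight T}
    (hα : α ∈ regularWeights T) (hne : pairing α c ≠ 0) {X : Matrix (Fin n) (Fin n) ℂ}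
    (hX : X ∈ weightSpace (torusConj T) α) : IsNilpotent X := by
  by_contra hnil
  have hpow : ∀ m : ℕ, X ^ (m + 1) ∈ weightSpace (torusConj T) ((m + 1) • α) := fun m => by
    induction m with
    | zero => simpa using hX
    | succ m ih =>
      rw [pow_succ, succ_nsmul]
      exact weightSpace_mul ih hX
  have hpair : ∀ m : ℕ, ∀ z, (m • α).toHom (c z) = z ^ ((m : ℤ) * pairing α c) := fun m z => by
    induction m with
    | zero => simp [Weight.toHom_zero]
    | succ m ih =>
      rw [succ_nsmul, Weight.toHom_add, ih, pairing_spec hc hα, ← _root_.zpow_add]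
      congr 1
      push_cast
      ring
  let two : ℂˣ := Units.mk0 2 two_ne_zero
  have hfin := finite_setOf_zpow_eigenvalue (torusConj T (c two))
  refine (Set.infinite_of_injective_forall_mem (f := fun m : ℕ => ((m + 1 : ℕ) : ℤ) * pairing α c)
    ?_ ?_) hfin
  · intro a b hab
    have := mul_right_cancel₀ hne hab
    exact_mod_cast Nat.succ_injective (by exact_mod_cast this)
  · intro m
    refine Module.End.hasEigenvalue_of_hasEigenvector (x := X ^ (m + 1))
      ⟨Module.End.mem_eigenspace_iff.2 ?_, fun h => hnil ⟨m + 1, h⟩⟩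
    rw [hpow m (c two), hpair]
    simp [two]

theorem neg_mem_roots (hG : IsZariskiClosed G) (hred : IsLinearlyReductive G) (hT : IsTorus T)
    {c : ℂˣ →* T} (hc : IsCocharacter c) {α : Weight T} (hα : α ∈ roots T)
    (hne : pairing α c ≠ 0) : -α ∈ roots T := by
  obtain ⟨hα0, X, hXg, hX0, hX⟩ := mem_roots.1 hα
  have hnil := isNilpotent_of_mem_weightSpace hc (roots_subset_regularWeights hα) hne hX
  obtain ⟨Y, hY⟩ := exists_double_bracket_eq hnil
  have hss : (conjRep G).IsSemisimpleRepresentation := hred _ _ isRational_conjRep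
  let L : Subrepresentation (conjRep G) :=
    ⟨lieSubmodule G, fun a X hX => conj_mem_lieAlgebra hG a hX⟩
  obtain ⟨M, hM⟩ := hss.exists_isCompl L
  have hinf : lieSubmodule G ⊓ M.toSubmodule = ⊥ := by
    have := congrArg Subrepresentation.toSubmodule hM.inf_eq_bot
    exact this
  have hsup : lieSubmodule G ⊔ M.toSubmodule = ⊤ := by
    have := congrArg Subrepresentation.toSubmodule hM.sup_eq_top
    exact this
  obtain ⟨Y₁, hY₁, Y₂, hY₂, rfl⟩ := Submodule.mem_sup.1 (hsup ▸ Submodule.mem_top (x := Y))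
  let ad : Matrix (Fin n) (Fin n) ℂ →ₗ[ℂ] Matrix (Fin n) (Fin n) ℂ :=
    LinearMap.mulLeft ℂ X - LinearMap.mulRight ℂ X
  have had : ∀ Y, ad Y = X * Y - Y * X := fun _ => rfl
  have hadM : ∀ Y ∈ M.toSubmodule, ad Y ∈ M.toSubmodule := fun Y hY =>
    bracket_mem_of_conj_mem hG (fun a => M.apply_mem_toSubmodule a hY) ⟨X, hXg⟩
  have hadL : ∀ Y ∈ lieSubmodule G, ad Y ∈ lieSubmodule G := fun Y hY =>
    bracket_mem_of_conj_mem hG (fun a => L.apply_mem_toSubmodule a hY) ⟨X, hXg⟩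
  have hY' : ad (ad (Y₁ + Y₂)) = X := hY
  have hY₂0 : ad (ad Y₂) = 0 := by
    rw [← Submodule.mem_bot ℂ, ← hinf]
    refine ⟨?_, hadM _ (hadM _ hY₂)⟩
    have : ad (ad Y₂) = X - ad (ad Y₁) := by rw [← hY', map_add, map_add]; abel
    rw [this]
    exact sub_mem hXg (hadL _ (hadL _ hY₁))
  have hY₁X : ad (ad Y₁) = X := by rw [← hY', map_add, map_add, hY₂0, add_zero]
  obtain ⟨f, hf, hfg, hs⟩ := exists_lie_components hG hT ⟨Y₁, hY₁⟩
  replace hs : (f.sum fun _ v => v) = Y₁ := hs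
  have hadw : ∀ χ Z, Z ∈ weightSpace (torusConj T) χ → ad Z ∈ weightSpace (torusConj T) (χ + α) :=
    fun χ Z hZ => by
      rw [had]
      refine sub_mem ?_ (weightSpace_mul hZ hX)
      rw [add_comm]
      exact weightSpace_mul hX hZ
  refine mem_roots.2 ⟨neg_ne_zero.2 hα0, f (-α), hfg _, fun h0 => ?_, hf _⟩
  have hmem : X ∈ ⨆ χ ∈ {ψ : Weight T | ψ ≠ α}, weightSpace (torusConj T) χ := by
    rw [← hY₁X, ← hs, Finsupp.sum, map_sum, map_sum]
    refine Submodule.sum_mem _ fun χ hχ => ?_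
    refine Submodule.mem_iSup_of_mem (χ + α + α) (Submodule.mem_iSup_of_mem ?_
      (hadw _ _ (hadw _ _ (hf χ))))
    intro h
    have h1 : χ = -α := by rw [add_eq_right] at h; exact eq_neg_of_add_eq_zero_left h
    rw [h1] at hχ
    exact Finsupp.mem_support_iff.1 hχ h0
  exact weight_mem_of_mem_iSup hmem hX0 hX rfl

theorem root_toHom_eq_one_of_mem_center (hG : IsZariskiClosed G) {α : Weight T} (hα : α ∈ roots T)
    {t : T} (ht : (t : G) ∈ Subgroup.center G) : α.toHom t = 1 := by
  obtain ⟨_, X, hXg, hX0, hX⟩ := mem_roots.1 hα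
  obtain ⟨γ, hγ⟩ := exists_flow hG hXg
  have h1 : HasMatDeriv (fun s => toMat (t : G) * toMat (γ s) * toMat (t : G)⁻¹)
      (toMat (t : G) * X * toMat (t : G)⁻¹) 0 := (hγ.deriv.const_mul _).mul_const _
  have h2 : ∀ s, toMat (t : G) * toMat (γ s) * toMat (t : G)⁻¹ = toMat (γ s) := fun s => by
    rw [← toMat_mul, ← toMat_mul, ← Subgroup.mem_center_iff.1 ht (γ s), mul_inv_cancel_right]
  simp only [h2] at h1
  have h3 : (α.toHom t : ℂ) • X = X := by
    rw [← hX t, torusConj_apply]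
    ext i j
    exact (h1 i j).unique (hγ.deriv i j)
  have h4 : ((α.toHom t : ℂ) - 1) • X = 0 := by rw [sub_smul, h3, one_smul, sub_self]
  exact Units.ext (sub_eq_zero.1 ((smul_eq_zero.1 h4).resolve_right hX0))

end RootFacts

/-! ### Positive roots -/

section PositiveRoots

variable {n : ℕ} {G : Subgroup (GL (Fin n) ℂ)} {T : Subgroup G} {P : Set (Weight T)}

theorem IsPositiveSystem.subset_roots (hP : IsPositiveSystem T P) : P ⊆ roots T := by
  obtain ⟨c, _, _, rfl⟩ := hP
  exact fun α hα => hα.1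

theorem IsPositiveSystem.closure_le_regularWeights (hP : IsPositiveSystem T P) {γ : Weight T}
    (hγ : γ ∈ AddSubmonoid.closure P) : γ ∈ regularWeights T := by
  have : AddSubmonoid.closure P ≤ (regularWeights T).toAddSubmonoid :=
    AddSubmonoid.closure_le.2 fun α hα => roots_subset_regularWeights (hP.subset_roots hα)
  exact this hγ

theorem IsPositiveSystem.pairing_nonneg (hP : IsPositiveSystem T P) {h : ℂˣ →* T}
    (hh : IsCocharacter h) (hdom : IsDominant P h) {γ : Weight T}
    (hγ : γ ∈ AddSubmonoid.closure P) : 0 ≤ pairing γ h := by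
  induction hγ using AddSubmonoid.closure_induction with
  | mem α hα => exact hdom α hα
  | zero => rw [pairing_zero]
  | add α β hα hβ h1 h2 =>
    rw [pairing_add hh (hP.closure_le_regularWeights hα) (hP.closure_le_regularWeights hβ)]
    exact add_nonneg h1 h2

theorem IsPositiveSystem.antisymm (hP : IsPositiveSystem T P) {γ : Weight T}
    (hγ : γ ∈ AddSubmonoid.closure P) (hγ' : -γ ∈ AddSubmonoid.closure P) : γ = 0 := by
  obtain ⟨c, hc, _, hPc⟩ := id hP
  have key : ∀ δ ∈ AddSubmonoid.closure P, δ = 0 ∨ 0 < pairing δ c := by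
    intro δ hδ
    induction hδ using AddSubmonoid.closure_induction with
    | mem α hα => rw [hPc] at hα; exact Or.inr hα.2
    | zero => exact Or.inl rfl
    | add α β hα hβ h1 h2 =>
      rcases h1 with rfl | h1
      · rw [zero_add]; exact h2
      rcases h2 with rfl | h2
      · rw [add_zero]; exact Or.inr h1
      right
      rw [pairing_add hc (hP.closure_le_regularWeights hα) (hP.closure_le_regularWeights hβ)]
      exact add_pos h1 h2
  rcases key γ hγ with h | h
  · exact h
  rcases key _ hγ' with h' | h'
  · exact neg_eq_zero.1 h'
  rw [pairing_neg hc (hP.closure_le_regularWeights hγ)] at h'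
  omega

theorem IsPositiveSystem.mem_or_neg_mem (hP : IsPositiveSystem T P) (hG : IsZariskiClosed G)
    (hred : IsLinearlyReductive G) (hT : IsTorus T) {α : Weight T} (hα : α ∈ roots T) :
    α ∈ P ∨ -α ∈ P := by
  obtain ⟨c, hc, hreg, rfl⟩ := hP
  rcases lt_or_gt_of_ne (hreg α hα) with h | h
  · right
    refine ⟨neg_mem_roots hG hred hT hc hα (hreg α hα), ?_⟩
    rw [pairing_neg hc (roots_subset_regularWeights hα)]
    omega
  · exact Or.inl ⟨hα, h⟩

/-- Positive roots are sums of simple roots. -/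
theorem IsPositiveSystem.closure_simpleRoots (hP : IsPositiveSystem T P) :
    AddSubmonoid.closure (simpleRoots P) = AddSubmonoid.closure P := by
  obtain ⟨c, hc, _, hPc⟩ := id hP
  refine le_antisymm (AddSubmonoid.closure_mono fun α hα => hα.1)
    (AddSubmonoid.closure_le.2 ?_)
  have hpos : ∀ α ∈ P, 0 < pairing α c := fun α hα => by rw [hPc] at hα; exact hα.2
  have hregP : ∀ α ∈ P, α ∈ regularWeights T := fun α hα =>
    roots_subset_regularWeights (hP.subset_roots hα)
  have key : ∀ (m : ℕ), ∀ α ∈ P, pairing α c ≤ m → α ∈ AddSubmonoid.closure (simpleRoots P) := by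
    intro m
    induction m with
    | zero => intro α hα hm; have := hpos α hα; push_cast at hm; omega
    | succ m ih =>
      intro α hα hm
      by_cases hs : ∃ β ∈ P, ∃ γ ∈ P, α = β + γ
      · obtain ⟨β, hβ, γ, hγ, rfl⟩ := hs
        rw [pairing_add hc (hregP β hβ) (hregP γ hγ)] at hm
        have h1 := hpos β hβ
        have h2 := hpos γ hγ
        push_cast at hm
        exact add_mem (ih β hβ (by omega)) (ih γ hγ (by omega))
      · exact AddSubmonoid.subset_closure ⟨hα, hs⟩
  intro α hα
  exact key (pairing α c).toNat α hα (by rw [Int.toNat_of_nonneg (hpos α hα).le])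

theorem IsPositiveSystem.closure_le_rootLattice (hP : IsPositiveSystem T P) {γ : Weight T}
    (hγ : γ ∈ AddSubmonoid.closure P) : γ ∈ rootLattice P := by
  rw [← hP.closure_simpleRoots] at hγ
  exact AddSubgroup.le_closure_toAddSubmonoid _ hγ

theorem realWeight_add (χ ψ : Weight T) : realWeight (χ + ψ) = realWeight χ + realWeight ψ :=
  TensorProduct.tmul_add _ _ _

theorem inRootCone_zero : InRootCone P (0 : Weight T) := by
  rw [InRootCone, realWeight, TensorProduct.tmul_zero]
  exact zero_mem _

theorem InRootCone.add {χ ψ : Weight T} (hχ : InRootCone P χ) (hψ : InRootCone P ψ) :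
    InRootCone P (χ + ψ) := by
  rw [InRootCone, realWeight_add]
  exact add_mem hχ hψ

theorem IsPositiveSystem.inRootCone (hP : IsPositiveSystem T P) {γ : Weight T}
    (hγ : γ ∈ AddSubmonoid.closure P) : InRootCone P γ := by
  rw [← hP.closure_simpleRoots] at hγ
  induction hγ using AddSubmonoid.closure_induction with
  | mem α hα => exact Submodule.subset_span ⟨α, hα, rfl⟩
  | zero => exact inRootCone_zero
  | add α β _ _ h1 h2 => exact h1.add h2

theorem IsPositiveSystem.rootLattice_le_regularWeights (hP : IsPositiveSystem T P) :
    rootLattice P ≤ regularWeights T :=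
  (AddSubgroup.closure_le _).2 fun _ hα => roots_subset_regularWeights (hP.subset_roots hα.1)

theorem IsPositiveSystem.rootLattice_toHom_eq_one (hP : IsPositiveSystem T P)
    (hG : IsZariskiClosed G) {χ : Weight T} (hχ : χ ∈ rootLattice P) {t : T}
    (ht : (t : G) ∈ Subgroup.center G) : χ.toHom t = 1 := by
  induction hχ using AddSubgroup.closure_induction with
  | mem α hα => exact root_toHom_eq_one_of_mem_center hG (hP.subset_roots hα.1) ht
  | zero => rfl
  | add α β _ _ h1 h2 => rw [Weight.toHom_add, h1, h2, mul_one]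
  | neg α _ h1 => rw [Weight.toHom_neg, h1, inv_one]

theorem IsPositiveSystem.pairing_nonneg_of_inRootCone (hP : IsPositiveSystem T P) {h : ℂˣ →* T}
    (hh : IsCocharacter h) (hdom : IsDominant P h) {χ : Weight T} (hχ : χ ∈ rootLattice P)
    (hcone : InRootCone P χ) : 0 ≤ pairing χ h := by
  let two : ℂˣ := Units.mk0 2 two_ne_zero
  let ℓ : Weight T →+ ℝ :=
    { toFun := fun χ => Real.log ‖(χ.toHom (h two) : ℂ)‖
      map_zero' := by simp [Weight.toHom_zero]
      map_add' := fun χ ψ => by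
        rw [Weight.toHom_add, Units.val_mul, norm_mul, Real.log_mul] <;> simp }
  have hℓ : ∀ χ ∈ regularWeights T, ℓ χ = pairing χ h * Real.log 2 := fun χ hχ => by
    change Real.log ‖(χ.toHom (h two) : ℂ)‖ = _
    rw [pairing_spec hh hχ]
    simp [two]
  let Λ : ℝ ⊗[ℤ] Weight T →ₗ[ℤ] ℝ := TensorProduct.lift
    (LinearMap.mk₂ ℤ (fun (r : ℝ) (χ : Weight T) => r * ℓ χ) (fun _ _ _ => add_mul _ _ _)
      (fun c r χ => by simp [mul_assoc]) (fun r χ ψ => by rw [map_add, mul_add])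
      (fun c r χ => by rw [map_zsmul, zsmul_eq_mul, zsmul_eq_mul]; ring))
  have hΛ : ∀ (r : ℝ) (χ : Weight T), Λ (r ⊗ₜ χ) = r * ℓ χ := fun _ _ => rfl
  have hΛsmul : ∀ (r : ℝ≥0) (x : ℝ ⊗[ℤ] Weight T), Λ (r • x) = r * Λ x := fun r x => by
    induction x using TensorProduct.induction_on with
    | zero => simp
    | tmul s χ =>
      have hs : r • (s ⊗ₜ[ℤ] χ : ℝ ⊗[ℤ] Weight T) = ((r : ℝ) * s) ⊗ₜ[ℤ] χ := by
        rw [NNReal.smul_def, TensorProduct.smul_tmul', smul_eq_mul]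
      rw [hs, hΛ, hΛ, mul_assoc]
    | add x y hx hy => rw [smul_add, map_add, map_add, hx, hy, mul_add]
  have hpos : ∀ x ∈ Submodule.span ℝ≥0 (realWeight '' simpleRoots P), 0 ≤ Λ x := by
    intro x hx
    induction hx using Submodule.span_induction with
    | mem x hx =>
      obtain ⟨α, hα, rfl⟩ := hx
      rw [realWeight, hΛ, one_mul, hℓ α (roots_subset_regularWeights (hP.subset_roots hα.1))]
      exact mul_nonneg (by exact_mod_cast hdom α hα.1) (Real.log_nonneg (by norm_num))
    | zero => simp
    | add x y _ _ hx hy => rw [map_add]; exact add_nonneg hx hy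
    | smul r x _ hx => rw [hΛsmul]; exact mul_nonneg r.2 hx
  have h1 := hpos _ hcone
  rw [realWeight, hΛ, one_mul, hℓ χ (hP.rootLattice_le_regularWeights hχ)] at h1
  have h2 := nonneg_of_mul_nonneg_left h1 (Real.log_pos (by norm_num))
  exact_mod_cast h2

end PositiveRoots

/-! ### Highest weights -/

section HighestWeight

variable {n : ℕ} {G : Subgroup (GL (Fin n) ℂ)} {T : Subgroup G} {P : Set (Weight T)}
variable {V : Type} [AddCommGroup V] [Module ℂ V]

theorem IsTorus.mul_comm (hT : IsTorus T) (s t : T) : s * t = t * s := by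
  obtain ⟨_, _, Q, hQ⟩ := hT
  have h1 : ∀ A B : Matrix (Fin n) (Fin n) ℂ, A.IsDiag → B.IsDiag → A * B = B * A := by
    intro A B hA hB
    rw [← hA.diagonal_diag, ← hB.diagonal_diag, Matrix.diagonal_mul_diagonal,
      Matrix.diagonal_mul_diagonal]
    congr 1
    ext i
    exact _root_.mul_comm _ _
  have h2 : (Q * ((s : G) : GL (Fin n) ℂ) * Q⁻¹) * (Q * ((t : G) : GL (Fin n) ℂ) * Q⁻¹) =
      (Q * ((t : G) : GL (Fin n) ℂ) * Q⁻¹) * (Q * ((s : G) : GL (Fin n) ℂ) * Q⁻¹) :=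
    Units.ext (h1 _ _ (hQ s s.2) (hQ t t.2))
  have h3 : ((s : G) : GL (Fin n) ℂ) * ((t : G) : GL (Fin n) ℂ) =
      ((t : G) : GL (Fin n) ℂ) * ((s : G) : GL (Fin n) ℂ) := by
    have := congrArg (fun x => Q⁻¹ * x * Q) h2
    simpa [mul_assoc] using this
  exact Subtype.ext (Subtype.ext h3)

theorem exists_weight {S : Type} [Group S] (hS : ∀ s t : S, s * t = t * s)
    [FiniteDimensional ℂ V] [Nontrivial V] (σ : Representation ℂ S V) :
    ∃ (χ : Weight S) (v : V), v ≠ 0 ∧ v ∈ weightSpace σ χ := by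
  classical
  let A : Set (Submodule ℂ V) := {W | W ≠ ⊥ ∧ ∀ s, ∀ w ∈ W, σ s w ∈ W}
  have hA : A.Nonempty := ⟨⊤, top_ne_bot, fun _ _ _ => trivial⟩
  obtain ⟨W, hW, hmin⟩ := WellFounded.has_min (wellFounded_lt (α := Submodule ℂ V)) A hA
  have hscalar : ∀ s, ∃ μ : ℂ, ∀ w ∈ W, σ s w = μ • w := by
    intro s
    have : Nontrivial W := Submodule.nontrivial_iff_ne_bot.2 hW.1
    obtain ⟨μ, hμ⟩ := Module.End.exists_eigenvalue ((σ s).restrict (hW.2 s))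
    obtain ⟨w, hw⟩ := hμ.exists_hasEigenvector
    refine ⟨μ, ?_⟩
    let W' : Submodule ℂ V := W ⊓ Module.End.eigenspace (σ s) μ
    have hW' : W' ∈ A := by
      refine ⟨?_, fun t v hv => ⟨hW.2 t v hv.1, ?_⟩⟩
      · intro h
        have h1 : (w : V) ∈ W' := ⟨w.2, by
          rw [SetLike.mem_coe, Module.End.mem_eigenspace_iff]
          exact congrArg Subtype.val hw.apply_eq_smul⟩
        rw [h] at h1
        exact hw.2 (Subtype.ext h1)
      · have h1 := Module.End.mem_eigenspace_iff.1 hv.2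
        rw [SetLike.mem_coe, Module.End.mem_eigenspace_iff, ← Module.End.mul_apply, ← map_mul,
          hS s t, map_mul, Module.End.mul_apply, h1, map_smul]
    have hle : W' = W := by
      by_contra hne
      exact hmin W' hW' (lt_of_le_of_ne inf_le_left hne)
    intro v hv
    rw [← hle] at hv
    exact Module.End.mem_eigenspace_iff.1 hv.2
  choose μ hμ using hscalar
  obtain ⟨w, hw, hw0⟩ := (Submodule.ne_bot_iff W).1 hW.1
  let e : S →* ℂ :=
    { toFun := μ
      map_one' := by
        have := hμ 1 w hw
        rw [map_one, Module.End.one_apply] at this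
        have h2 : (μ 1 - 1) • w = 0 := by rw [sub_smul, ← this, one_smul, sub_self]
        exact sub_eq_zero.1 ((smul_eq_zero.1 h2).resolve_right hw0)
      map_mul' := fun s t => by
        have h1 := hμ (s * t) w hw
        rw [map_mul, Module.End.mul_apply, hμ t w hw, map_smul, hμ s w hw, smul_smul] at h1
        have h2 : (μ t * μ s - μ (s * t)) • w = 0 := by rw [sub_smul, h1, sub_self]
        rw [← sub_eq_zero.1 ((smul_eq_zero.1 h2).resolve_right hw0), _root_.mul_comm] }
  exact ⟨Weight.ofHom e.toHomUnits, w, hw0, fun s => hμ s w hw⟩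

theorem adjoint_of_mem_weightSpace (hG : IsZariskiClosed G) {β : Weight T} {X : lieSubmodule G}
    (hX : X.1 ∈ weightSpace (torusConj T) β) (t : T) :
    adjoint hG (t : G) X = (β.toHom t : ℂ) • X :=
  Subtype.ext (hX t)

theorem differential_mem_weightSpace (hG : IsZariskiClosed G) {ρ : Representation ℂ G V}
    (hρ : IsRational (coordRing G) ρ) {β ψ : Weight T} {X : lieSubmodule G}
    (hX : X.1 ∈ weightSpace (torusConj T) β) {v : V}
    (hv : v ∈ weightSpace (MonoidHom.comp ρ T.subtype) ψ) :
    differential hG hρ X v ∈ weightSpace (MonoidHom.comp ρ T.subtype) (β + ψ) := fun t => by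
  have h1 := hv t
  rw [MonoidHom.comp_apply, Subgroup.subtype_apply] at h1 ⊢
  rw [differential_conj, h1, adjoint_of_mem_weightSpace hG hX, map_smul, map_smul,
    LinearMap.smul_apply, smul_smul, Weight.toHom_add, Units.val_mul, _root_.mul_comm]

/-- The vectors obtained from vectors of weight `χ` by repeatedly applying root vectors for
negative roots, with their weights. -/
inductive LoweredVector (hG : IsZariskiClosed G) {ρ : Representation ℂ G V}
    (hρ : IsRational (coordRing G) ρ) (P : Set (Weight T)) (χ : Weight T) : Weight T → V → Prop
  | base (v : V) (hv : v ∈ weightSpace (MonoidHom.comp ρ T.subtype) χ) :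
      LoweredVector hG hρ P χ χ v
  | step (ψ : Weight T) (w : V) (hw : LoweredVector hG hρ P χ ψ w) (β : Weight T) (hβ : β ∈ P)
      (X : lieSubmodule G) (hX : X.1 ∈ weightSpace (torusConj T) (-β)) :
      LoweredVector hG hρ P χ (-β + ψ) (differential hG hρ X w)

theorem LoweredVector.mem_weightSpace {hG : IsZariskiClosed G} {ρ : Representation ℂ G V}
    {hρ : IsRational (coordRing G) ρ} {χ ψ : Weight T} {w : V}
    (h : LoweredVector hG hρ P χ ψ w) :
    w ∈ weightSpace (MonoidHom.comp ρ T.subtype) ψ ∧ χ - ψ ∈ AddSubmonoid.closure P := by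
  induction h with
  | base v hv => exact ⟨hv, by rw [sub_self]; exact zero_mem _⟩
  | step ψ w _ β hβ X hX ih =>
    refine ⟨differential_mem_weightSpace hG hρ hX ih.1, ?_⟩
    have : χ - (-β + ψ) = (χ - ψ) + β := by abel
    rw [this]
    exact add_mem ih.2 (AddSubmonoid.subset_closure hβ)

/-- Every irreducible rational representation has a highest weight, and is spanned by weight
vectors. -/
theorem exists_highestWeight (hG : IsZariskiClosed G) (hconn : IsConnectedGroup G)
    (hred : IsLinearlyReductive G) (hT : IsTorus T) (hP : IsPositiveSystem T P)
    {ρ : Representation ℂ G V} (hρ : IsRational (coordRing G) ρ) (hirr : ρ.IsIrreducible) :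
    ∃ χ : Weight T, IsHighestWeight T.subtype P ρ χ ∧
      ∀ v, v ∈ ⨆ ψ ∈ {ψ | IsWeight T.subtype ρ ψ}, weightSpace (MonoidHom.comp ρ T.subtype) ψ := by
  have := hρ.1
  obtain ⟨c, hc, hreg, hPc⟩ := id hP
  have hnt : Nontrivial V := by
    by_contra hV
    rw [not_nontrivial_iff_subsingleton] at hV
    obtain ⟨a, b, hab⟩ := hirr.exists_pair_ne
    exact hab (Subrepresentation.toSubmodule_injective (Subsingleton.elim _ _))
  let σ : Representation ℂ T V := MonoidHom.comp ρ T.subtype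
  let K : Set ℤ := {k | ∃ χ : Weight T, IsWeight T.subtype ρ χ ∧ pairing χ c = k}
  have hKne : K.Nonempty := by
    obtain ⟨χ, v, hv, h⟩ := exists_weight hT.mul_comm σ
    exact ⟨_, χ, ⟨v, hv, h⟩, rfl⟩
  have hKfin : K.Finite := by
    let two : ℂˣ := Units.mk0 2 two_ne_zero
    refine (finite_setOf_zpow_eigenvalue (σ (c two))).subset ?_
    rintro k ⟨χ, hχ, rfl⟩
    have h1 := pairing_spec hc (hχ.mem_regularWeights hρ) two
    obtain ⟨v, hv, h⟩ := hχ
    refine Module.End.hasEigenvalue_of_hasEigenvector (x := v)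
      ⟨Module.End.mem_eigenspace_iff.2 ?_, hv⟩
    refine (h (c two)).trans ?_
    rw [h1]
    simp [two]
  obtain ⟨k, ⟨χ, hχ, hk⟩, hmax⟩ := Set.exists_max_image K id hKfin hKne
  let d := differential hG hρ
  let W : Submodule ℂ V := Submodule.span ℂ {w | ∃ ψ, LoweredVector hG hρ P χ ψ w}
  have hlow : ∀ β ∈ P, ∀ X : lieSubmodule G, X.1 ∈ weightSpace (torusConj T) (-β) →
      ∀ w ∈ W, d X w ∈ W := by
    intro β hβ X hX w hw
    induction hw using Submodule.span_induction with
    | mem w hw =>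
      obtain ⟨ψ, hψ⟩ := hw
      exact Submodule.subset_span ⟨_, LoweredVector.step ψ w hψ β hβ X hX⟩
    | zero => rw [map_zero]; exact zero_mem _
    | add x y _ _ hx hy => rw [map_add]; exact add_mem hx hy
    | smul a x _ hx => rw [map_smul]; exact Submodule.smul_mem _ _ hx
  have hwords : ∀ ψ w, LoweredVector hG hρ P χ ψ w → ∀ X, d X w ∈ W := by
    intro ψ w hw
    induction hw with
    | base v hv =>
      intro X
      obtain ⟨f, hf, hfg, hs⟩ := exists_lie_components hG hT X
      have hX : X = ∑ β ∈ f.support, (⟨f β, hfg β⟩ : lieSubmodule G) := by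
        refine Subtype.ext ?_
        rw [← hs, Finsupp.sum, Submodule.coe_sum]
      rw [hX, map_sum, LinearMap.sum_apply]
      refine Submodule.sum_mem _ fun β hβ => ?_
      have hfβ : f β ≠ 0 := Finsupp.mem_support_iff.1 hβ
      have hmem : d ⟨f β, hfg β⟩ v ∈ weightSpace σ (β + χ) :=
        differential_mem_weightSpace hG hρ (X := ⟨f β, hfg β⟩) (hf β) hv
      by_cases hβ0 : β = 0
      · rw [hβ0, zero_add] at hmem
        subst hβ0
        exact Submodule.subset_span ⟨χ, LoweredVector.base _ hmem⟩
      have hβr : β ∈ roots T := mem_roots.2 ⟨hβ0, f β, hfg β, hfβ, hf β⟩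
      rcases hP.mem_or_neg_mem hG hred hT hβr with hβP | hβP
      · have : d ⟨f β, hfg β⟩ v = 0 := by
          by_contra hne
          have h1 : IsWeight T.subtype ρ (β + χ) := ⟨_, hne, hmem⟩
          have h2 := hmax _ ⟨_, h1, rfl⟩
          rw [pairing_add hc (roots_subset_regularWeights hβr) (hχ.mem_regularWeights hρ), ← hk]
            at h2
          rw [hPc] at hβP
          have h3 : 0 < pairing β c := hβP.2
          simp only [id] at h2
          omega
        rw [this]
        exact zero_mem _
      · refine Submodule.subset_span ⟨_, LoweredVector.step χ v (LoweredVector.base v hv) (-β) hβP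
          ⟨f β, hfg β⟩ ?_⟩
        rw [neg_neg]
        exact hf β
    | step ψ w hw β hβ Y hY ih =>
      intro X
      have := differential_bracket hG hρ X Y w
      change d X (d Y w) = _ at this
      rw [this]
      exact add_mem (hlow β hβ Y hY _ (ih X)) (ih _)
  have hWd : ∀ (X : lieSubmodule G), ∀ w ∈ W, d X w ∈ W := by
    intro X w hw
    induction hw using Submodule.span_induction with
    | mem w hw =>
      obtain ⟨ψ, hψ⟩ := hw
      exact hwords ψ w hψ X
    | zero => rw [map_zero]; exact zero_mem _
    | add x y _ _ hx hy => rw [map_add]; exact add_mem hx hy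
    | smul a x _ hx => rw [map_smul]; exact Submodule.smul_mem _ _ hx
  let U : Subrepresentation ρ :=
    ⟨W, fun g w hw => stable_of_differential_stable hG hconn hρ hWd g hw⟩
  have hUtop : W = ⊤ := by
    rcases hirr.eq_bot_or_eq_top U with h | h
    · exfalso
      obtain ⟨v, hv, hvχ⟩ := hχ
      have h1 : v ∈ W := Submodule.subset_span ⟨χ, LoweredVector.base v hvχ⟩
      have h2 : W = ⊥ := congrArg Subrepresentation.toSubmodule h
      rw [h2] at h1
      exact hv h1
    · exact congrArg Subrepresentation.toSubmodule h
  have hle : W ≤ ⨆ ψ ∈ {ψ | IsWeight T.subtype ρ ψ ∧ χ - ψ ∈ AddSubmonoid.closure P},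
      weightSpace σ ψ := by
    refine Submodule.span_le.2 ?_
    rintro w ⟨ψ, hψ⟩
    by_cases hw : w = 0
    · rw [hw]; exact zero_mem _
    · exact Submodule.mem_iSup_of_mem ψ (Submodule.mem_iSup_of_mem
        ⟨⟨w, hw, hψ.mem_weightSpace.1⟩, hψ.mem_weightSpace.2⟩ hψ.mem_weightSpace.1)
  refine ⟨χ, ⟨hχ, fun ψ hψ => ?_⟩, fun v => ?_⟩
  · obtain ⟨v, hv, hvψ⟩ := hψ
    exact (weight_mem_of_mem_iSup (hle (hUtop ▸ Submodule.mem_top (x := v))) hv hvψ).2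
  · have hmono : (⨆ ψ ∈ {ψ | IsWeight T.subtype ρ ψ ∧ χ - ψ ∈ AddSubmonoid.closure P},
        weightSpace σ ψ) ≤ ⨆ ψ ∈ {ψ | IsWeight T.subtype ρ ψ}, weightSpace σ ψ :=
      biSup_mono fun ψ hψ => hψ.1
    exact hmono (hle (hUtop ▸ Submodule.mem_top (x := v)))

end HighestWeight

/-! ### Matrix coefficients of completely reducible representations -/

section Coefficients

variable {H : Type} [Group H] {V W : Type} [AddCommGroup V] [Module ℂ V] [AddCommGroup W]
  [Module ℂ W] {O : Subalgebra ℂ (H → ℂ)}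

theorem IsRational.toRepresentation {ρ : Representation ℂ H V} (hρ : IsRational O ρ)
    (U : Subrepresentation ρ) : IsRational O U.toRepresentation := by
  have := hρ.1
  refine ⟨inferInstance, fun φ v => ?_⟩
  obtain ⟨Φ, hΦ⟩ := LinearMap.exists_extend φ
  have h : matrixCoeff U.toRepresentation φ v = matrixCoeff ρ Φ v := by
    ext g
    rw [← hΦ]
    rfl
  rw [h]
  exact hρ.2 Φ v

theorem IsRational.tprod {ρ : Representation ℂ H V} {σ : Representation ℂ H W}
    (hρ : IsRational O ρ) (hσ : IsRational O σ) : IsRational O (ρ.tprod σ) := by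
  have := hρ.1
  have := hσ.1
  refine ⟨inferInstance, fun φ x => ?_⟩
  induction x using TensorProduct.induction_on with
  | zero =>
    have h : matrixCoeff (ρ.tprod σ) φ 0 = 0 := by ext g; simp [matrixCoeff]
    rw [h]; exact zero_mem _
  | add x y hx hy =>
    have h : matrixCoeff (ρ.tprod σ) φ (x + y) =
        matrixCoeff (ρ.tprod σ) φ x + matrixCoeff (ρ.tprod σ) φ y := by
      ext g; simp [matrixCoeff]
    rw [h]; exact add_mem hx hy
  | tmul v w =>
    let b := Module.finBasis ℂ V
    have h : matrixCoeff (ρ.tprod σ) φ (v ⊗ₜ w) = ∑ i, matrixCoeff ρ (b.coord i) v *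
        matrixCoeff σ (φ ∘ₗ TensorProduct.mk ℂ V W (b i)) w := by
      ext g
      simp only [matrixCoeff, Representation.tprod_apply, TensorProduct.map_tmul, Finset.sum_apply,
        Pi.mul_apply, LinearMap.comp_apply, TensorProduct.mk_apply]
      conv_lhs => rw [← b.sum_repr (ρ g v)]
      rw [TensorProduct.sum_tmul, map_sum]
      exact Finset.sum_congr rfl fun i _ => by
        rw [← TensorProduct.smul_tmul', map_smul, smul_eq_mul, Module.Basis.coord_apply]
    rw [h]
    exact sum_mem fun i _ => mul_mem (hρ.2 _ _) (hσ.2 _ _)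

theorem isIrreducible_of_isAtom {ρ : Representation ℂ H V} {U : Subrepresentation ρ}
    (hU : IsAtom U) : U.toRepresentation.IsIrreducible := by
  refine { exists_pair_ne := ⟨⊥, ⊤, fun h => hU.1 ?_⟩, eq_bot_or_eq_top := fun X => ?_ }
  · refine (Subrepresentation.toSubmodule_injective ((Submodule.eq_bot_iff _).2 fun u hu => ?_))
    have h1 : (⟨u, hu⟩ : U.toSubmodule) ∈ (⊥ : Subrepresentation U.toRepresentation) := by
      rw [h]; trivial
    exact congrArg Subtype.val (show (⟨u, hu⟩ : U.toSubmodule) = 0 from h1)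
  · let Y : Subrepresentation ρ :=
      { toSubmodule := X.toSubmodule.map U.toSubmodule.subtype
        apply_mem_toSubmodule := by
          rintro g _ ⟨x, hx, rfl⟩
          exact ⟨U.toRepresentation g x, X.apply_mem_toSubmodule g hx, rfl⟩ }
    have hY : Y ≤ U := by
      rintro _ ⟨x, hx, rfl⟩
      exact x.2
    rcases hU.le_iff.1 hY with h | h
    · left
      refine Subrepresentation.toSubmodule_injective ((Submodule.eq_bot_iff _).2 fun x hx => ?_)
      have h1 : (x : V) ∈ Y := ⟨x, hx, rfl⟩
      rw [h] at h1
      exact Subtype.ext (show (x : V) = 0 from h1)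
    · right
      refine Subrepresentation.toSubmodule_injective ((Submodule.eq_top_iff').2 fun x => ?_)
      have h1 : (x : V) ∈ Y := by rw [h]; exact x.2
      obtain ⟨y, hy, hyx⟩ := h1
      rw [← Subtype.ext (show (y : V) = x from hyx)]
      exact hy

theorem mem_iSup_irreducible {ρ : Representation ℂ H V} (hρ : ρ.IsSemisimpleRepresentation)
    (v : V) : v ∈ ⨆ (U : Subrepresentation ρ) (_ : U.toRepresentation.IsIrreducible),
      U.toSubmodule := by
  have hs := (Representation.isSemisimpleRepresentation_iff_isSemisimpleModule_asModule ρ).1 hρ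
  have htop := IsSemisimpleModule.sSup_simples_eq_top (MonoidAlgebra ℂ H) ρ.asModule
  have hv : ρ.asModuleEquiv.symm v ∈ sSup {m : Submodule (MonoidAlgebra ℂ H) ρ.asModule |
      IsSimpleModule (MonoidAlgebra ℂ H) m} := by rw [htop]; trivial
  rw [sSup_eq_iSup'] at hv
  refine Submodule.iSup_induction _ (motive := fun x : ρ.asModule => ρ.asModuleEquiv x ∈
    ⨆ (U : Subrepresentation ρ) (_ : U.toRepresentation.IsIrreducible), U.toSubmodule)
    hv ?_ (zero_mem _) (fun x y hx hy => add_mem hx hy)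
  rintro ⟨N, hN⟩ x hx
  have hatom : IsAtom (Subrepresentation.ofSubmodule' N) :=
    (Subrepresentation.subrepresentationSubmoduleOrderIso.symm.isAtom_iff N).2
      (isSimpleModule_iff_isAtom.1 hN)
  exact Submodule.mem_iSup_of_mem (Subrepresentation.ofSubmodule' N)
    (Submodule.mem_iSup_of_mem (isIrreducible_of_isAtom hatom) hx)

end Coefficients

section Isotypic

variable {n : ℕ} {G : Subgroup (GL (Fin n) ℂ)} {T : Subgroup G} {P : Set (Weight T)}
  {V W : Type} [AddCommGroup V] [Module ℂ V] [AddCommGroup W] [Module ℂ W]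

theorem matrixCoeff_mem_iSup_isotypic (hG : IsZariskiClosed G) (hconn : IsConnectedGroup G)
    (hred : IsLinearlyReductive G) (hT : IsTorus T) (hP : IsPositiveSystem T P)
    {ρ : Representation ℂ G V} (hρ : IsRational (coordRing G) ρ) (φ : Module.Dual ℂ V) (v : V) :
    matrixCoeff ρ φ v ∈ ⨆ (ν : Weight T) (_ : IsWeight T.subtype ρ ν), isotypic P ν := by
  let L : V →ₗ[ℂ] (G → ℂ) :=
    { toFun := matrixCoeff ρ φ
      map_add' := fun x y => by ext g; simp [matrixCoeff]
      map_smul' := fun c x => by ext g; simp [matrixCoeff] }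
  suffices h : (⨆ (U : Subrepresentation ρ) (_ : U.toRepresentation.IsIrreducible),
      U.toSubmodule) ≤ (⨆ (ν : Weight T) (_ : IsWeight T.subtype ρ ν), isotypic P ν).comap L from
    h (mem_iSup_irreducible (hred V ρ hρ) v)
  refine iSup₂_le fun U hU w hw => ?_
  obtain ⟨χ, hχ, -⟩ := exists_highestWeight hG hconn hred hT hP (hρ.toRepresentation U) hU
  obtain ⟨u, hu, huχ⟩ := id hχ.1
  refine Submodule.mem_iSup_of_mem χ (Submodule.mem_iSup_of_mem
    ⟨u, fun h => hu (Subtype.ext h), fun s => congrArg Subtype.val (huχ s)⟩ ?_)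
  exact Submodule.subset_span ⟨U.toSubmodule, inferInstance, inferInstance, U.toRepresentation,
    φ ∘ₗ U.toSubmodule.subtype, ⟨w, hw⟩, hρ.toRepresentation U, hU, hχ, rfl⟩

theorem isWeight_tprod {ρ : Representation ℂ G V} {σ : Representation ℂ G W}
    (hρ : ∀ v, v ∈ ⨆ ψ ∈ {ψ | IsWeight T.subtype ρ ψ},
      weightSpace (MonoidHom.comp ρ T.subtype) ψ)
    (hσ : ∀ v, v ∈ ⨆ ψ ∈ {ψ | IsWeight T.subtype σ ψ},
      weightSpace (MonoidHom.comp σ T.subtype) ψ) {ν : Weight T}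
    (hν : IsWeight T.subtype (ρ.tprod σ) ν) :
    ∃ ψ ψ', IsWeight T.subtype ρ ψ ∧ IsWeight T.subtype σ ψ' ∧ ν = ψ + ψ' := by
  obtain ⟨x, hx, hxν⟩ := hν
  refine weight_mem_of_mem_iSup (σ := MonoidHom.comp (ρ.tprod σ) T.subtype)
    (Q := {ν | ∃ ψ ψ', IsWeight T.subtype ρ ψ ∧ IsWeight T.subtype σ ψ' ∧ ν = ψ + ψ'})
    ?_ hx hxν
  clear hxν hx
  set Z := ⨆ χ ∈ {ν | ∃ ψ ψ', IsWeight T.subtype ρ ψ ∧ IsWeight T.subtype σ ψ' ∧ ν = ψ + ψ'},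
    weightSpace (MonoidHom.comp (ρ.tprod σ) T.subtype) χ with hZ
  have key : ∀ (v : V) (w : W), v ⊗ₜ[ℂ] w ∈ Z := by
    intro v w
    have h1 : (⨆ ψ ∈ {ψ | IsWeight T.subtype ρ ψ}, weightSpace (MonoidHom.comp ρ T.subtype) ψ) ≤
        Z.comap ((TensorProduct.mk ℂ V W).flip w) := by
      refine iSup₂_le fun ψ hψ v hv => ?_
      have h2 : (⨆ ψ ∈ {ψ | IsWeight T.subtype σ ψ},
          weightSpace (MonoidHom.comp σ T.subtype) ψ) ≤ Z.comap (TensorProduct.mk ℂ V W v) := by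
        refine iSup₂_le fun ψ' hψ' w hw => ?_
        refine Submodule.mem_iSup_of_mem (ψ + ψ') (Submodule.mem_iSup_of_mem
          ⟨ψ, ψ', hψ, hψ', rfl⟩ fun s => ?_)
        have h3 : ρ (T.subtype s) v = (ψ.toHom s : ℂ) • v := hv s
        have h4 : σ (T.subtype s) w = (ψ'.toHom s : ℂ) • w := hw s
        simp only [MonoidHom.comp_apply, Representation.tprod_apply, TensorProduct.mk_apply,
          TensorProduct.map_tmul, h3, h4, Weight.toHom_add, Units.val_mul]
        rw [TensorProduct.smul_tmul_smul]
      exact h2 (hσ w)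
    exact h1 (hρ v)
  induction x using TensorProduct.induction_on with
  | zero => exact zero_mem _
  | tmul v w => exact key v w
  | add x y hx hy => exact add_mem hx hy

theorem mem_regularWeights_of_mem_isotypic {lam : Weight T} {f : G → ℂ} (hf : f ∈ isotypic P lam)
    (h0 : f ≠ 0) : lam ∈ regularWeights T := by
  by_contra hn
  have h : isotypic P lam ≤ ⊥ := by
    refine Submodule.span_le.2 ?_
    rintro _ ⟨V, _, _, ρ, φ, v, hρ, -, hw, rfl⟩
    exact absurd (hw.1.mem_regularWeights hρ) hn
  exact h0 (h hf)

theorem mul_mem_iSup_isotypic (hG : IsZariskiClosed G) (hconn : IsConnectedGroup G)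
    (hred : IsLinearlyReductive G) (hT : IsTorus T) (hP : IsPositiveSystem T P)
    {lam mu : Weight T} {f f' : G → ℂ} (hf : f ∈ isotypic P lam) (hf' : f' ∈ isotypic P mu) :
    f * f' ∈ ⨆ (ν : Weight T) (_ : lam + mu - ν ∈ AddSubmonoid.closure P), isotypic P ν := by
  set Z := ⨆ (ν : Weight T) (_ : lam + mu - ν ∈ AddSubmonoid.closure P), isotypic P ν
  suffices h : isotypic P lam ≤ Z.comap (LinearMap.mulRight ℂ f') from h hf
  refine Submodule.span_le.2 ?_
  rintro _ ⟨V, _, _, ρ, φ, v, hρ, hirr, hw, rfl⟩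
  suffices h : isotypic P mu ≤ Z.comap (LinearMap.mulLeft ℂ (matrixCoeff ρ φ v)) from h hf'
  refine Submodule.span_le.2 ?_
  rintro _ ⟨V', _, _, ρ', φ', v', hρ', hirr', hw', rfl⟩
  have hmul : matrixCoeff ρ φ v * matrixCoeff ρ' φ' v' =
      matrixCoeff (ρ.tprod ρ') (TensorProduct.dualDistrib ℂ V V' (φ ⊗ₜ φ')) (v ⊗ₜ v') := by
    ext g
    simp [matrixCoeff]
  change matrixCoeff ρ φ v * matrixCoeff ρ' φ' v' ∈ Z
  rw [hmul]
  refine (iSup₂_le fun ν hν => ?_ : (⨆ (ν : Weight T) (_ : IsWeight T.subtype (ρ.tprod ρ') ν),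
    isotypic P ν) ≤ Z) (matrixCoeff_mem_iSup_isotypic hG hconn hred hT hP (hρ.tprod hρ') _ _)
  obtain ⟨-, -, hs⟩ := exists_highestWeight hG hconn hred hT hP hρ hirr
  obtain ⟨-, -, hs'⟩ := exists_highestWeight hG hconn hred hT hP hρ' hirr'
  obtain ⟨ψ, ψ', hψ, hψ', rfl⟩ := isWeight_tprod hs hs' hν
  refine le_iSup₂_of_le (ψ + ψ') ?_ le_rfl
  rw [add_sub_add_comm]
  exact add_mem (hw.2 ψ hψ) (hw'.2 ψ' hψ')

end Isotypic

/-! ### Independence of the isotypic components -/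

theorem iSupIndep_sSup_simple {ι R M : Type*} [Ring R] [AddCommGroup M] [Module R M]
    {s : ι → Set (Submodule R M)} (hs : ∀ i, ∀ N ∈ s i, IsSimpleModule R N)
    (hd : ∀ i j, ∀ N ∈ s i, ∀ N' ∈ s j, Nonempty (N ≃ₗ[R] N') → i = j) :
    iSupIndep fun i => sSup (s i) := by
  intro i
  rw [disjoint_iff]
  have h1 : ∀ m : s i, IsSimpleModule R m := fun m => hs i m m.2
  have hss : IsSemisimpleModule R ↥(sSup (s i)) := by
    rw [sSup_eq_iSup]
    exact isSemisimpleModule_biSup_of_isSemisimpleModule_submodule fun m hm =>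
      have := hs i m hm
      inferInstance
  have := IsSemisimpleModule.of_injective _ (Submodule.inclusion_injective
    (inf_le_left : sSup (s i) ⊓ (⨆ (j) (_ : j ≠ i), sSup (s j)) ≤ sSup (s i)))
  by_contra hne
  obtain ⟨S, hS, hSs⟩ := (IsSemisimpleModule.eq_bot_or_exists_simple_le _).resolve_left hne
  obtain ⟨N, hN, ⟨e⟩⟩ := S.linearEquiv_of_le_sSup _ (hS.trans inf_le_left)
  let t : Set (Submodule R M) := {N' | ∃ j, j ≠ i ∧ N' ∈ s j}
  have h2 : ∀ m : t, IsSimpleModule R m := fun ⟨m, j, _, hm⟩ => hs j m hm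
  have hle : (⨆ (j) (_ : j ≠ i), sSup (s j)) ≤ sSup t :=
    iSup₂_le fun j hj => sSup_le_sSup fun N' hN' => ⟨j, hj, hN'⟩
  obtain ⟨N', ⟨j, hj, hN'⟩, ⟨e'⟩⟩ := S.linearEquiv_of_le_sSup t ((hS.trans inf_le_right).trans hle)
  exact hj (hd j i N' hN' N hN ⟨e'.symm.trans e⟩)

/-- The action of a group on the functions on it by right translation. -/
def rightRegular (H : Type) [Group H] : Representation ℂ H (H → ℂ) where
  toFun g :=
    { toFun := fun f x => f (x * g)
      map_add' := fun _ _ => rfl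
      map_smul' := fun _ _ => rfl }
  map_one' := by ext f x; simp
  map_mul' g g' := by ext f x; simp [mul_assoc]

section Independence

variable {n : ℕ} {G : Subgroup (GL (Fin n) ℂ)} {T : Subgroup G} {P : Set (Weight T)}

theorem isWeight_of_linearEquiv {H S V W : Type} [Group H] [Group S] [AddCommGroup V] [Module ℂ V]
    [AddCommGroup W] [Module ℂ W] {j : S →* H} {ρ : Representation ℂ H V}
    {σ : Representation ℂ H W} (e : ρ.asModule ≃ₗ[MonoidAlgebra ℂ H] σ.asModule) {χ : Weight S}
    (hχ : IsWeight j ρ χ) : IsWeight j σ χ := by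
  obtain ⟨v, hv, h⟩ := hχ
  let E := (Representation.IntertwiningMap.equivLinearMapAsModule ρ σ).symm e.toLinearMap
  have hE : ∀ x, E x = σ.asModuleEquiv (e (ρ.asModuleEquiv.symm x)) := fun _ => rfl
  refine ⟨E v, ?_, fun s => ?_⟩
  · rw [hE]
    simpa using hv
  · rw [← E.isIntertwining, h s, map_smul]

theorem IsPositiveSystem.highestWeight_eq (hP : IsPositiveSystem T P) {V W : Type}
    [AddCommGroup V] [Module ℂ V] [AddCommGroup W] [Module ℂ W] {ρ : Representation ℂ G V}
    {σ : Representation ℂ G W} (e : ρ.asModule ≃ₗ[MonoidAlgebra ℂ G] σ.asModule)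
    {χ ψ : Weight T} (hχ : IsHighestWeight T.subtype P ρ χ)
    (hψ : IsHighestWeight T.subtype P σ ψ) : χ = ψ := by
  rw [← sub_eq_zero]
  refine hP.antisymm (hχ.2 ψ (isWeight_of_linearEquiv e.symm hψ.1)) ?_
  rw [neg_sub]
  exact hψ.2 χ (isWeight_of_linearEquiv e hχ.1)

/-- Matrix coefficients for irreducible representations with different highest weights are
linearly independent. -/
theorem IsPositiveSystem.iSupIndep_isotypic (hP : IsPositiveSystem T P) :
    iSupIndep (isotypic P) := by
  classical
  let s : Weight T → Set (Submodule (MonoidAlgebra ℂ G) (rightRegular G).asModule) := fun lam =>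
    {N | IsSimpleModule (MonoidAlgebra ℂ G) N ∧
      ∃ (V : Type) (_ : AddCommGroup V) (_ : Module ℂ V) (ρ : Representation ℂ G V),
        IsHighestWeight T.subtype P ρ lam ∧ Nonempty (ρ.asModule ≃ₗ[MonoidAlgebra ℂ G] N)}
  have hind : iSupIndep fun lam => sSup (s lam) := by
    refine iSupIndep_sSup_simple (fun _ N hN => hN.1) ?_
    rintro lam mu N ⟨-, V, _, _, ρ, hρ, ⟨e⟩⟩ N' ⟨-, V', _, _, ρ', hρ', ⟨e'⟩⟩ ⟨f⟩
    exact hP.highestWeight_eq (e.trans (f.trans e'.symm)) hρ hρ'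
  have hle : ∀ lam, ∀ f ∈ isotypic P lam,
      (rightRegular G).asModuleEquiv.symm f ∈ sSup (s lam) := by
    intro lam f hf
    induction hf using Submodule.span_induction with
    | zero => exact zero_mem _
    | add x y _ _ hx hy => rw [map_add]; exact add_mem hx hy
    | smul c x _ hx =>
      rw [Representation.asModuleEquiv_symm_map_smul]
      exact Submodule.smul_mem _ _ hx
    | mem f hf =>
      obtain ⟨V, _, _, ρ, φ, v, hρ, hirr, hw, rfl⟩ := hf
      let E : Representation.IntertwiningMap ρ (rightRegular G) :=
        { toFun := matrixCoeff ρ φ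
          map_add' := fun x y => by ext g; simp [matrixCoeff]
          map_smul' := fun c x => by ext g; simp [matrixCoeff]
          isIntertwining' := fun g => by
            ext v x
            simp [matrixCoeff, rightRegular] }
      let F := Representation.IntertwiningMap.equivLinearMapAsModule ρ (rightRegular G) E
      have hF : F (ρ.asModuleEquiv.symm v) =
        (rightRegular G).asModuleEquiv.symm (matrixCoeff ρ φ v) := rfl
      rw [← hF]
      have := (Representation.irreducible_iff_isSimpleModule_asModule ρ).1 hirr
      rcases LinearMap.injective_or_eq_zero F with hi | h0
      · have e := LinearEquiv.ofInjective F hi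
        have hN : LinearMap.range F ∈ s lam :=
          ⟨IsSimpleModule.congr e.symm, V, inferInstance, inferInstance, ρ, hw, ⟨e⟩⟩
        exact (le_sSup hN : LinearMap.range F ≤ sSup (s lam)) ⟨_, rfl⟩
      · rw [h0]
        exact zero_mem _
  rw [iSupIndep_iff_finsetSum_eq_zero_imp_eq_zero] at hind ⊢
  intro t v hv h0 i hi
  exact hind t (fun i => (rightRegular G).asModuleEquiv.symm (v i)) (fun i hi => hle i _ (hv i hi))
    (by rw [← map_sum, h0, map_zero]) i hi

end Independence

/-! ### The Rees algebra -/

section Rees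

variable {n : ℕ} {G : Subgroup (GL (Fin n) ℂ)} {T : Subgroup G} {P : Set (Weight T)}

theorem one_mem_isotypic : (1 : G → ℂ) ∈ isotypic P 0 := one_mem_matrixCoeffs _ _ _

theorem isotypic_le_filtration {h : ℂˣ →* T} {lam : Weight T} {m : ℤ} (hm : pairing lam h ≤ m) :
    isotypic P lam ≤ filtration P h m :=
  le_iSup₂_of_le lam hm le_rfl

theorem mul_mem_filtration (hG : IsZariskiClosed G) (hconn : IsConnectedGroup G)
    (hred : IsLinearlyReductive G) (hT : IsTorus T) (hP : IsPositiveSystem T P)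
    {h : ℂˣ →* T} (hh : IsCocharacter h) (hdom : IsDominant P h) {m k : ℤ} {f f' : G → ℂ}
    (hf : f ∈ filtration P h m) (hf' : f' ∈ filtration P h k) :
    f * f' ∈ filtration P h (m + k) := by
  suffices h1 : filtration P h m ≤ (filtration P h (m + k)).comap (LinearMap.mulRight ℂ f') from
    h1 hf
  refine iSup₂_le fun lam hlam f hf => ?_
  suffices h1 : filtration P h k ≤ (filtration P h (m + k)).comap (LinearMap.mulLeft ℂ f) from
    h1 hf'
  refine iSup₂_le fun mu hmu f' hf' => ?_
  change f * f' ∈ filtration P h (m + k)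
  by_cases h0 : f = 0
  · rw [h0, zero_mul]; exact zero_mem _
  by_cases h0' : f' = 0
  · rw [h0', mul_zero]; exact zero_mem _
  have hl := mem_regularWeights_of_mem_isotypic hf h0
  have hm := mem_regularWeights_of_mem_isotypic hf' h0'
  refine (iSup₂_le fun ν hν => isotypic_le_filtration ?_ : (⨆ (ν : Weight T)
    (_ : lam + mu - ν ∈ AddSubmonoid.closure P), isotypic P ν) ≤ filtration P h (m + k))
    (mul_mem_iSup_isotypic hG hconn hred hT hP hf hf')
  have h1 := hP.pairing_nonneg hh hdom hν
  have h2 := pairing_sub hh (add_mem hl hm) (hP.closure_le_regularWeights hν)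
  rw [sub_sub_cancel, pairing_add hh hl hm] at h2
  omega

theorem single_mem_reesModule {h : ℂˣ →* T} {m : ℤ} {f : G → ℂ} (hf : f ∈ filtration P h m) :
    (AddMonoidAlgebra.single m f : LaurentPolynomial (G → ℂ)) ∈ reesModule P h := by
  intro k
  rw [AddMonoidAlgebra.coeff_single]
  by_cases hk : k = m
  · subst hk; simpa using hf
  · rw [Finsupp.single_eq_of_ne hk]; exact zero_mem _

/-- The filtration is multiplicative, so that the Rees module is a subalgebra. -/
theorem toSubmodule_reesAlgebra (hG : IsZariskiClosed G) (hconn : IsConnectedGroup G)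
    (hred : IsLinearlyReductive G) (hT : IsTorus T) (hP : IsPositiveSystem T P)
    {h : ℂˣ →* T} (hh : IsCocharacter h) (hdom : IsDominant P h) :
    Subalgebra.toSubmodule (reesAlgebra P h) = reesModule P h := by
  refine le_antisymm ?_ fun p hp => Algebra.subset_adjoin hp
  have hone : (1 : LaurentPolynomial (G → ℂ)) ∈ reesModule P h := by
    rw [← LaurentPolynomial.single_zero_one_eq_one]
    exact single_mem_reesModule (isotypic_le_filtration (pairing_zero h).le one_mem_isotypic)
  let S : Subalgebra ℂ (LaurentPolynomial (G → ℂ)) :=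
    { carrier := reesModule P h
      add_mem' := fun hp hq => add_mem hp hq
      algebraMap_mem' := fun c => by
        rw [Algebra.algebraMap_eq_smul_one]
        exact Submodule.smul_mem _ c hone
      mul_mem' := fun {p q} hp hq => by
        rw [← AddMonoidAlgebra.sum_coeff_single p, ← AddMonoidAlgebra.sum_coeff_single q,
          Finsupp.sum, Finsupp.sum, Finset.sum_mul]
        refine sum_mem fun m _ => ?_
        rw [Finset.mul_sum]
        refine sum_mem fun k _ => ?_
        rw [AddMonoidAlgebra.single_mul_single]
        exact single_mem_reesModule
          (mul_mem_filtration hG hconn hred hT hP hh hdom (hp m) (hq k)) }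
  have hle : reesAlgebra P h ≤ S := Algebra.adjoin_le fun p hp => hp
  exact fun p hp => hle hp

theorem linearIndependent_zpow :
    LinearIndependent ℂ (fun (k : ℤ) (z : ℂˣ) => ((z ^ k : ℂˣ) : ℂ)) := by
  refine linearIndependent_weight.comp (fun k : ℤ => (Weight.ofHom (zpowGroupHom k) : Weight ℂˣ))
    fun k l hkl => ?_
  have h1 : (Units.mk0 2 two_ne_zero : ℂˣ) ^ k = (Units.mk0 2 two_ne_zero : ℂˣ) ^ l :=
    congrArg (fun w : Weight ℂˣ => w.toHom (Units.mk0 2 two_ne_zero)) hkl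
  have h2 : (2 : ℝ) ^ k = (2 : ℝ) ^ l := by
    have := congrArg (fun u : ℂˣ => ‖(u : ℂ)‖) h1
    simpa using this
  exact zpow_right_injective₀ (by norm_num) (by norm_num) h2

/-- Evaluation at `z ∈ ℂˣ` of a Laurent polynomial whose coefficients are functions. -/
def laurentEval {H : Type} (z : ℂˣ) : LaurentPolynomial (H → ℂ) →ₐ[ℂ] (H → ℂ) :=
  { LaurentPolynomial.eval₂ (RingHom.id (H → ℂ))
      (Units.map (algebraMap ℂ (H → ℂ)).toMonoidHom z) with
    commutes' := fun c => by
      change LaurentPolynomial.eval₂ (RingHom.id (H → ℂ))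
        (Units.map (algebraMap ℂ (H → ℂ)).toMonoidHom z)
        (LaurentPolynomial.C (algebraMap ℂ (H → ℂ) c)) = _
      rw [LaurentPolynomial.eval₂_C]
      rfl }

theorem laurentEval_apply {H : Type} (z : ℂˣ) (p : LaurentPolynomial (H → ℂ)) (g : H) :
    laurentEval z p g = p.coeff.sum fun k a => a g * ((z ^ k : ℂˣ) : ℂ) := by
  change LaurentPolynomial.eval₂ (RingHom.id (H → ℂ))
        (Units.map (algebraMap ℂ (H → ℂ)).toMonoidHom z) p g = _
  rw [laurent_eval₂_eq_sum, Finsupp.sum, Finset.sum_apply]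
  refine Finset.sum_congr rfl fun k _ => ?_
  rw [← map_zpow]
  rfl

theorem laurentEval_single {H : Type} (z : ℂˣ) (k : ℤ) (f : H → ℂ) :
    laurentEval z (AddMonoidAlgebra.single k f) = ((z ^ k : ℂˣ) : ℂ) • f := by
  ext g
  rw [laurentEval_apply, AddMonoidAlgebra.coeff_single, Finsupp.sum_single_index (by simp),
    Pi.smul_apply, smul_eq_mul, mul_comm]

theorem laurent_ext {H : Type} {p q : LaurentPolynomial (H → ℂ)}
    (hpq : ∀ z, laurentEval z p = laurentEval z q) : p = q := by
  rw [← sub_eq_zero]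
  refine LaurentPolynomial.ext fun k => funext fun g => ?_
  by_cases hk : k ∈ (p - q).coeff.support
  · refine linearIndependent_iff'.1 linearIndependent_zpow (p - q).coeff.support
      (fun k => (p - q).coeff k g) ?_ k hk
    ext z
    have h1 : laurentEval z (p - q) g = 0 := by rw [map_sub, hpq, sub_self]; rfl
    rw [laurentEval_apply, Finsupp.sum] at h1
    simpa [Finset.sum_apply] using h1
  · rw [Finsupp.notMem_support_iff.1 hk]
    rfl

end Rees

/-! ### Base change along bases -/

section BaseChange

open CategoryTheory

theorem exists_algHom_lift {A B C : Type*} [Semiring A] [Semiring B] [Semiring C] [Algebra ℂ A]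
    [Algebra ℂ B] [Algebra ℂ C] (i : A →ₐ[ℂ] C) (hi : Function.Injective i) (j : B →ₐ[ℂ] C)
    (hj : ∀ b, j b ∈ i.range) : ∃ θ : B →ₐ[ℂ] A, ∀ b, i (θ b) = j b :=
  ⟨(AlgEquiv.ofInjective i hi).symm.toAlgHom.comp (j.codRestrict i.range hj), fun b =>
    congrArg Subtype.val ((AlgEquiv.ofInjective i hi).apply_symm_apply
      (j.codRestrict i.range hj b))⟩

/-- A commutative square of rings is cocartesian if the horizontal map on the right carries a basis
of the source to a basis of the target. -/
theorem isPushout_of_bases {A B S R : Type} [CommRing A] [CommRing B] [CommRing S] [CommRing R]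
    {θ : A →+* B} {i : A →+* S} {s : B →+* R} {ψ : S →+* R} (hcomm : ψ.comp i = s.comp θ)
    {ι : Type} (b : ι → S)
    (hli : ∀ a : ι →₀ A, (a.sum fun k x => i x * b k) = 0 → a = 0)
    (hsp : ∀ x : S, ∃ a : ι →₀ A, (a.sum fun k x => i x * b k) = x)
    (hli' : ∀ a : ι →₀ B, (a.sum fun k x => s x * ψ (b k)) = 0 → a = 0)
    (hsp' : ∀ x : R, ∃ a : ι →₀ B, (a.sum fun k x => s x * ψ (b k)) = x) :
    IsPushout (CommRingCat.ofHom θ) (CommRingCat.ofHom i) (CommRingCat.ofHom s)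
      (CommRingCat.ofHom ψ) := by
  let _ : Algebra A B := θ.toAlgebra
  let _ : Algebra A S := i.toAlgebra
  let _ : Algebra B R := s.toAlgebra
  let _ : Algebra S R := ψ.toAlgebra
  let _ : Algebra A R := (s.comp θ).toAlgebra
  have : IsScalarTower A B R := IsScalarTower.of_algebraMap_eq fun x => rfl
  have : IsScalarTower A S R := IsScalarTower.of_algebraMap_eq fun x =>
    (DFunLike.congr_fun hcomm x).symm
  let β : Module.Basis ι A S := Module.Basis.mk (v := b)
    (linearIndependent_iff.2 fun a ha => hli a ha) fun x _ => by
      obtain ⟨a, rfl⟩ := hsp x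
      exact sum_mem fun k _ => Submodule.smul_mem _ (a k) (Submodule.subset_span ⟨k, rfl⟩)
  let γ : Module.Basis ι B R := Module.Basis.mk (v := fun k => ψ (b k))
    (linearIndependent_iff.2 fun a ha => hli' a ha) fun x _ => by
      obtain ⟨a, rfl⟩ := hsp' x
      exact sum_mem fun k _ => Submodule.smul_mem _ (a k) (Submodule.subset_span ⟨k, rfl⟩)
  have hbc : IsBaseChange B (IsScalarTower.toAlgHom A S R).toLinearMap := by
    let e : B ⊗[A] S ≃ₗ[B] R := (β.baseChange B).equiv γ (Equiv.refl ι)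
    refine IsBaseChange.of_equiv e fun x => ?_
    have h : (e.toLinearMap.restrictScalars A) ∘ₗ (TensorProduct.mk A B S 1) =
        (IsScalarTower.toAlgHom A S R).toLinearMap := by
      refine β.ext fun k => ?_
      have h1 : (1 : B) ⊗ₜ[A] β k = β.baseChange B k := by simp
      simp only [LinearMap.comp_apply, TensorProduct.mk_apply, h1]
      change (β.baseChange B).equiv γ (Equiv.refl ι) (β.baseChange B k) = ψ (β k)
      rw [Module.Basis.equiv_apply, Module.Basis.mk_apply, Module.Basis.mk_apply]
      rfl
    exact DFunLike.congr_fun h x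
  exact CommRingCat.isPushout_iff_isPushout.2 (⟨hbc⟩ : Algebra.IsPushout A B S R)

end BaseChange

/-! ### Isotypic components of the enhanced group -/

section Enhanced

variable {n : ℕ} {G : Subgroup (GL (Fin n) ℂ)} {T : Subgroup G} {P : Set (Weight T)}

/-- A central element acts on an irreducible representation by its eigenvalue on any
eigenvector. -/
theorem apply_eq_smul_of_mem_center {H V : Type} [Group H] [AddCommGroup V] [Module ℂ V]
    {ρ : Representation ℂ H V} (hirr : ρ.IsIrreducible) {z : H} (hz : z ∈ Subgroup.center H)
    {c : ℂ} {v : V} (hv : v ≠ 0) (hc : ρ z v = c • v) (w : V) : ρ z w = c • w := by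
  let U : Subrepresentation ρ :=
    { toSubmodule := LinearMap.ker (ρ z - c • LinearMap.id)
      apply_mem_toSubmodule := fun g u hu => by
        have h1 : ρ z u = c • u := sub_eq_zero.1 (by simpa using hu)
        have h2 : ρ z (ρ g u) = c • ρ g u := by
          rw [← Module.End.mul_apply, ← map_mul, ← Subgroup.mem_center_iff.1 hz g, map_mul,
            Module.End.mul_apply, h1, map_smul]
        simp [h2] }
  have hU : ∀ u, u ∈ U ↔ ρ z u = c • u := fun u => by
    change u ∈ LinearMap.ker (ρ z - c • LinearMap.id) ↔ _
    rw [LinearMap.mem_ker]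
    simp [sub_eq_zero]
  rcases hirr.eq_bot_or_eq_top U with h | h
  · have h1 := (hU v).2 hc
    rw [h] at h1
    exact absurd h1 hv
  · rw [← hU, h]
    trivial

/-- Irreducibility only depends on the collection of stable subspaces. -/
theorem isIrreducible_of_stable {H K V : Type} [Group H] [Group K] [AddCommGroup V] [Module ℂ V]
    {ρ : Representation ℂ H V} {σ : Representation ℂ K V} (hirr : ρ.IsIrreducible)
    (hst : ∀ U : Subrepresentation σ, ∀ x, ∀ u ∈ U.toSubmodule, ρ x u ∈ U.toSubmodule) :
    σ.IsIrreducible := by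
  refine { exists_pair_ne := ⟨⊥, ⊤, fun h => ?_⟩, eq_bot_or_eq_top := fun U => ?_ }
  · have h1 : (⊥ : Submodule ℂ V) = ⊤ := congrArg Subrepresentation.toSubmodule h
    have h2 : (⊥ : Subrepresentation ρ) = ⊤ := Subrepresentation.toSubmodule_injective h1
    obtain ⟨a, b, hab⟩ := hirr.exists_pair_ne
    exact hab (((eq_bot_or_eq_top a).elim id (·.trans h2.symm)).trans
      ((eq_bot_or_eq_top b).elim id (·.trans h2.symm)).symm)
  · let U' : Subrepresentation ρ :=
      { toSubmodule := U.toSubmodule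
        apply_mem_toSubmodule := fun x u hu => hst U x u hu }
    rcases hirr.eq_bot_or_eq_top U' with h | h
    · exact Or.inl (Subrepresentation.toSubmodule_injective
        (show U'.toSubmodule = ⊥ from congrArg Subrepresentation.toSubmodule h))
    · exact Or.inr (Subrepresentation.toSubmodule_injective
        (show U'.toSubmodule = ⊤ from congrArg Subrepresentation.toSubmodule h))

theorem comp_subtype_mem_regularFunctions {f : G → ℂ} (hf : f ∈ coordRing G) :
    (fun t : T => f t) ∈ regularFunctions (G.subtype.comp T.subtype) := by
  induction hf using Algebra.adjoin_induction with
  | mem f hf =>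
    refine Algebra.subset_adjoin ?_
    rcases hf with ⟨ij, rfl⟩ | rfl
    · exact Or.inl ⟨ij, rfl⟩
    · exact Or.inr rfl
  | algebraMap c => exact Subalgebra.algebraMap_mem _ c
  | add f f' _ _ h h' => exact add_mem h h'
  | mul f f' _ _ h h' => exact mul_mem h h'

theorem restrict_mem_coordRing {F : G × T → ℂ} (hF : F ∈ prodCoordRing T) :
    (fun g : G => F (g, 1)) ∈ coordRing G := by
  induction hF using Algebra.adjoin_induction with
  | mem f hf =>
    rcases hf with ⟨a, ha, rfl⟩ | ⟨b, -, rfl⟩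
    · exact ha
    · exact Subalgebra.algebraMap_mem _ (b 1)
  | algebraMap c => exact Subalgebra.algebraMap_mem _ c
  | add f f' _ _ h h' => exact add_mem h h'
  | mul f f' _ _ h h' => exact mul_mem h h'

theorem toEnhanced_surjective (x : EnhancedGroup T) : ∃ g t, toEnhanced T (g, t) = x := by
  obtain ⟨⟨g, t⟩, rfl⟩ := QuotientGroup.mk'_surjective (antidiagonalCenter T) x
  exact ⟨g, t, rfl⟩

theorem toEnhanced_one_mem_center (hT : IsTorus T) (t : T) :
    toEnhanced T (1, t) ∈ Subgroup.center (EnhancedGroup T) := by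
  refine Subgroup.mem_center_iff.2 fun x => ?_
  obtain ⟨g, s, rfl⟩ := toEnhanced_surjective x
  rw [← map_mul, ← map_mul, Prod.mk_mul_mk, Prod.mk_mul_mk, hT.mul_comm s t, one_mul, mul_one]

/-- Restriction of a character of `T × T` to the first factor. -/
def Weight.fst (χ : Weight (T × T)) : Weight T :=
  Weight.ofHom (χ.toHom.comp (MonoidHom.inl T T))

theorem pairWeight_toHom (lam mu : Weight T) (s t : T) :
    (pairWeight lam mu).toHom (s, t) = lam.toHom s * mu.toHom t := rfl

theorem fst_pairWeight (lam mu : Weight T) : (pairWeight lam mu).fst = lam :=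
  Weight.ext fun s => by
    change (((pairWeight lam mu).toHom (s, 1) : ℂˣ) : ℂ) = _
    rw [pairWeight_toHom, map_one, mul_one]

theorem pairWeight_sub (lam lam' mu : Weight T) :
    pairWeight lam mu - pairWeight lam' mu = pairWeight (lam - lam') 0 :=
  Weight.ext fun ⟨s, t⟩ => by
    rw [sub_eq_add_neg, Weight.toHom_add, Weight.toHom_neg, pairWeight_toHom, pairWeight_toHom,
      pairWeight_toHom, sub_eq_add_neg, Weight.toHom_add, Weight.toHom_neg, Weight.toHom_zero]
    push_cast
    field_simp

theorem pairWeight_mem_closure_iff {γ : Weight T} :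
    pairWeight γ 0 ∈ AddSubmonoid.closure ((fun α : Weight T => pairWeight α 0) '' P) ↔
      γ ∈ AddSubmonoid.closure P := by
  constructor
  · intro hγ
    let f : Weight (T × T) →+ Weight T :=
      { toFun := Weight.fst, map_zero' := rfl, map_add' := fun _ _ => rfl }
    have h1 : f (pairWeight γ 0) ∈ (AddSubmonoid.closure
        ((fun α : Weight T => pairWeight α 0) '' P)).map f := ⟨_, hγ, rfl⟩
    rw [AddMonoidHom.map_mclosure, Set.image_image] at h1
    have h2 : (fun α : Weight T => f (pairWeight α 0)) '' P = P := by
      have : (fun α : Weight T => f (pairWeight α 0)) = id := funext fun α => fst_pairWeight α 0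
      rw [this, Set.image_id]
    rw [h2] at h1
    exact fst_pairWeight γ 0 ▸ h1
  · intro hγ
    let f : Weight T →+ Weight (T × T) :=
      { toFun := fun α => pairWeight α 0
        map_zero' := Weight.ext fun ⟨s, t⟩ => by
          rw [pairWeight_toHom, Weight.toHom_zero, Weight.toHom_zero, Weight.toHom_zero, mul_one]
        map_add' := fun α β => Weight.ext fun ⟨s, t⟩ => by
          rw [Weight.toHom_add, pairWeight_toHom, pairWeight_toHom, pairWeight_toHom,
            Weight.toHom_add, Weight.toHom_zero, mul_one, mul_one, mul_one] }
    have h1 : f γ ∈ (AddSubmonoid.closure P).map f := ⟨_, hγ, rfl⟩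
    rw [AddMonoidHom.map_mclosure] at h1
    exact h1

theorem exists_isotypic_of_mem_enhancedIsotypic (hT : IsTorus T) {lam mu : Weight T}
    {F : EnhancedGroup T → ℂ} (hF : F ∈ enhancedIsotypic P lam mu) :
    ∃ f ∈ isotypic P lam, ∀ g t, F (toEnhanced T (g, t)) = f g * mu.toHom t := by
  induction hF using Submodule.span_induction with
  | zero => exact ⟨0, zero_mem _, fun g t => by simp⟩
  | add F F' _ _ h h' =>
    obtain ⟨f, hf, hFf⟩ := h
    obtain ⟨f', hf', hFf'⟩ := h'
    exact ⟨f + f', add_mem hf hf', fun g t => by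
      rw [Pi.add_apply, Pi.add_apply, hFf, hFf', add_mul]⟩
  | smul c F _ h =>
    obtain ⟨f, hf, hFf⟩ := h
    exact ⟨c • f, Submodule.smul_mem _ c hf, fun g t => by
      rw [Pi.smul_apply, Pi.smul_apply, hFf, smul_eq_mul, smul_eq_mul, mul_assoc]⟩
  | mem F hF =>
    obtain ⟨V, _, _, ρ, φ, v, hρ, hirr, hw, rfl⟩ := hF
    obtain ⟨⟨w, hw0, hww⟩, hmax⟩ := hw
    have hscal : ∀ (t : T) (x : V), ρ (toEnhanced T (1, t)) x = (mu.toHom t : ℂ) • x := by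
      intro t x
      refine apply_eq_smul_of_mem_center hirr (toEnhanced_one_mem_center hT t) hw0 ?_ x
      have h1 := hww (1, t)
      rw [pairWeight_toHom, map_one, one_mul] at h1
      exact h1
    let σ : Representation ℂ G V := MonoidHom.comp ρ ((toEnhanced T).comp (MonoidHom.inl G T))
    have hσ : ∀ g, σ g = ρ (toEnhanced T (g, 1)) := fun _ => rfl
    have hρσ : ∀ g t x, ρ (toEnhanced T (g, t)) x = (mu.toHom t : ℂ) • σ g x := by
      intro g t x
      have h1 : toEnhanced T (g, t) = toEnhanced T (1, t) * toEnhanced T (g, 1) := by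
        rw [← map_mul, Prod.mk_mul_mk, one_mul, mul_one]
      rw [h1, map_mul, Module.End.mul_apply, hscal, hσ]
    refine ⟨matrixCoeff σ φ v, Submodule.subset_span ⟨V, inferInstance, inferInstance, σ, φ, v,
      ⟨hρ.1, fun φ x => restrict_mem_coordRing (hρ.2 φ x)⟩, ?_,
      ⟨⟨w, hw0, fun s => ?_⟩, ?_⟩, rfl⟩, ?_⟩
    · refine isIrreducible_of_stable hirr fun U x u hu => ?_
      obtain ⟨g, t, rfl⟩ := toEnhanced_surjective x
      rw [hρσ]
      exact Submodule.smul_mem _ _ (U.apply_mem_toSubmodule g hu)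
    · have h1 := hww (s, 1)
      rw [pairWeight_toHom, map_one, mul_one] at h1
      exact h1
    · rintro ψ ⟨x, hx0, hx⟩
      rw [← pairWeight_mem_closure_iff, ← pairWeight_sub lam ψ mu]
      refine hmax _ ⟨x, hx0, fun ⟨s, t⟩ => ?_⟩
      change ρ (toEnhanced T ((s : G), t)) x = _
      rw [hρσ, pairWeight_toHom, Units.val_mul, mul_comm, mul_smul]
      exact congrArg _ (hx s)
    · intro g t
      change φ (ρ (toEnhanced T (g, t)) v) = φ (σ g v) * _
      rw [hρσ, map_smul, smul_eq_mul, mul_comm]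

theorem exists_mem_enhancedIsotypic (hG : IsZariskiClosed G)
    (hP : IsPositiveSystem T P) {lam mu : Weight T} (hmu : mu - lam ∈ rootLattice P) {f : G → ℂ}
    (hf : f ∈ isotypic P lam) :
    ∃ F ∈ enhancedIsotypic P lam mu, ∀ g t, F (toEnhanced T (g, t)) = f g * mu.toHom t := by
  induction hf using Submodule.span_induction with
  | zero => exact ⟨0, zero_mem _, fun g t => by simp⟩
  | add F F' _ _ h h' =>
    obtain ⟨f, hf, hFf⟩ := h
    obtain ⟨f', hf', hFf'⟩ := h'
    exact ⟨f + f', add_mem hf hf', fun g t => by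
      rw [Pi.add_apply, Pi.add_apply, hFf, hFf', add_mul]⟩
  | smul c F _ h =>
    obtain ⟨f, hf, hFf⟩ := h
    exact ⟨c • f, Submodule.smul_mem _ c hf, fun g t => by
      rw [Pi.smul_apply, Pi.smul_apply, hFf, smul_eq_mul, smul_eq_mul, mul_assoc]⟩
  | mem F hF =>
    obtain ⟨V, _, _, σ, φ, v, hσ, hirr, hw, rfl⟩ := hF
    have hlam := hw.1.mem_regularWeights hσ
    have hmureg : mu ∈ regularWeights T := by
      have := add_mem (hP.rootLattice_le_regularWeights hmu) hlam
      rwa [sub_add_cancel] at this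
    obtain ⟨⟨w, hw0, hww⟩, hmax⟩ := hw
    let τ : G × T →* Module.End ℂ V :=
      { toFun := fun x => (mu.toHom x.2 : ℂ) • σ x.1
        map_one' := by simp
        map_mul' := fun x y => by
          rw [Prod.snd_mul, Prod.fst_mul, map_mul, map_mul, Units.val_mul, smul_mul_smul_comm] }
    have hker : ∀ x ∈ antidiagonalCenter T, τ x = 1 := by
      rintro ⟨z, t⟩ ⟨hz, hzt⟩
      have hz' : z = ((t⁻¹ : T) : G) := by
        rw [Subgroup.coe_inv]; exact eq_inv_of_mul_eq_one_left hzt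
      have hscal : ∀ x, σ z x = (lam.toHom t⁻¹ : ℂ) • x := fun x =>
        apply_eq_smul_of_mem_center hirr hz hw0 (by
          have := hww t⁻¹
          rw [hz']; exact this) x
      have htc : (t : G) ∈ Subgroup.center G := by
        have := inv_mem hz
        rwa [hz', Subgroup.coe_inv, inv_inv] at this
      have h1 : mu.toHom t = lam.toHom t := by
        have := hP.rootLattice_toHom_eq_one hG hmu htc
        rw [sub_eq_add_neg, Weight.toHom_add, Weight.toHom_neg, mul_inv_eq_one] at this
        exact this
      ext x
      change (mu.toHom t : ℂ) • σ z x = x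
      rw [hscal, smul_smul, h1, map_inv, ← Units.val_mul, mul_inv_cancel, Units.val_one, one_smul]
    let ρ : Representation ℂ (EnhancedGroup T) V := QuotientGroup.lift _ τ hker
    have hρ : ∀ g t x, ρ (toEnhanced T (g, t)) x = (mu.toHom t : ℂ) • σ g x := fun _ _ _ => rfl
    refine ⟨matrixCoeff ρ φ v, Submodule.subset_span ⟨V, inferInstance, inferInstance, ρ, φ, v,
      ⟨hσ.1, fun φ x => ?_⟩, ?_, ⟨⟨w, hw0, ?_⟩, ?_⟩, rfl⟩, ?_⟩
    · obtain ⟨m, hm, hmm⟩ := hmureg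
      have h1 : matrixCoeff ρ φ x ∘ toEnhanced T =
          (fun y => m (y.2 : G)) * fun y => matrixCoeff σ φ x y.1 := by
        ext ⟨g, t⟩
        change φ (ρ (toEnhanced T (g, t)) x) = m (t : G) * φ (σ g x)
        rw [hρ, map_smul, smul_eq_mul, hmm]
      change matrixCoeff ρ φ x ∘ toEnhanced T ∈ prodCoordRing T
      rw [h1]
      exact mul_mem
        (Algebra.subset_adjoin (Or.inr ⟨_, comp_subtype_mem_regularFunctions hm, rfl⟩))
        (Algebra.subset_adjoin (Or.inl ⟨_, hσ.2 φ x, rfl⟩))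
    · refine isIrreducible_of_stable hirr fun U g u hu => ?_
      have := U.apply_mem_toSubmodule (toEnhanced T (g, 1)) hu
      rwa [hρ, map_one, Units.val_one, one_smul] at this
    · rintro ⟨s, t⟩
      change ρ (toEnhanced T ((s : G), t)) w = _
      rw [hρ, pairWeight_toHom, Units.val_mul, mul_comm, mul_smul]
      exact congrArg _ (hww s)
    · rintro χ ⟨x, hx0, hx⟩
      have hx1 : ∀ s t, (mu.toHom t : ℂ) • σ (s : T) x = (χ.toHom (s, t) : ℂ) • x :=
        fun s t => hx (s, t)
      have hx2 : ∀ s : T, σ s x = (χ.fst.toHom s : ℂ) • x := fun s => by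
        have := hx1 s 1
        rw [map_one, Units.val_one, one_smul] at this
        exact this
      have hχ : χ = pairWeight χ.fst mu := Weight.ext fun ⟨s, t⟩ => by
        have h1 := hx1 s t
        rw [hx2, smul_smul] at h1
        rw [pairWeight_toHom, Units.val_mul, mul_comm]
        exact (smul_left_injective ℂ hx0 h1).symm
      rw [hχ, pairWeight_sub, pairWeight_mem_closure_iff]
      exact hmax _ ⟨x, hx0, hx2⟩
    · intro g t
      change φ (ρ (toEnhanced T (g, t)) v) = φ (σ g v) * _
      rw [hρ, map_smul, smul_eq_mul, mul_comm]

end Enhanced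

/-! ### The coordinate ring of the Vinberg monoid and its invariants -/

section VinbergAlgebra

variable {n : ℕ} {G : Subgroup (GL (Fin n) ℂ)} {T : Subgroup G} {P : Set (Weight T)}

/-- The monoid of elements of the root lattice in the cone of the simple roots. -/
def rootMonoid (P : Set (Weight T)) : AddSubmonoid (Weight T) where
  carrier := {χ | χ ∈ rootLattice P ∧ InRootCone P χ}
  zero_mem' := ⟨zero_mem _, inRootCone_zero⟩
  add_mem' := fun hχ hψ => ⟨add_mem hχ.1 hψ.1, hχ.2.add hψ.2⟩

theorem IsPositiveSystem.closure_le_rootMonoid (hP : IsPositiveSystem T P) :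
    AddSubmonoid.closure P ≤ rootMonoid P :=
  fun _ hγ => ⟨hP.closure_le_rootLattice hγ, hP.inRootCone hγ⟩

theorem enhanced_ext {F F' : EnhancedGroup T → ℂ}
    (h : ∀ g t, F (toEnhanced T (g, t)) = F' (toEnhanced T (g, t))) : F = F' := by
  ext x
  obtain ⟨g, t, rfl⟩ := toEnhanced_surjective x
  exact h g t

theorem enhancedIsotypic_le_vinbergModule {lam mu : Weight T} (h : mu - lam ∈ rootMonoid P) :
    enhancedIsotypic P lam mu ≤ vinbergModule P :=
  le_iSup₂_of_le lam mu (le_iSup₂_of_le h.1 h.2 le_rfl)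

theorem vinbergModule_le {X : Submodule ℂ (EnhancedGroup T → ℂ)}
    (h : ∀ lam mu, mu - lam ∈ rootMonoid P → enhancedIsotypic P lam mu ≤ X) :
    vinbergModule P ≤ X :=
  iSup₂_le fun lam mu => iSup₂_le fun h1 h2 => h lam mu ⟨h1, h2⟩

/-- The functions `f` on `G` for which `f ⊗ κ` is a function on the Vinberg monoid. -/
def vinbergSlice (P : Set (Weight T)) (κ : Weight T) : Submodule ℂ (G → ℂ) where
  carrier := {f | ∃ F ∈ vinbergModule P, ∀ g t, F (toEnhanced T (g, t)) = f g * κ.toHom t}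
  zero_mem' := ⟨0, zero_mem _, fun g t => by simp⟩
  add_mem' := by
    rintro f f' ⟨F, hF, hFf⟩ ⟨F', hF', hFf'⟩
    exact ⟨F + F', add_mem hF hF', fun g t => by
      rw [Pi.add_apply, Pi.add_apply, hFf, hFf', add_mul]⟩
  smul_mem' := by
    rintro c f ⟨F, hF, hFf⟩
    exact ⟨c • F, Submodule.smul_mem _ c hF, fun g t => by
      rw [Pi.smul_apply, Pi.smul_apply, hFf, smul_eq_mul, smul_eq_mul, mul_assoc]⟩

theorem isotypic_le_vinbergSlice (hG : IsZariskiClosed G) (hP : IsPositiveSystem T P)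
    {lam κ : Weight T} (h : κ - lam ∈ rootMonoid P) : isotypic P lam ≤ vinbergSlice P κ := by
  intro f hf
  obtain ⟨F, hF, hFf⟩ := exists_mem_enhancedIsotypic hG hP h.1 hf
  exact ⟨F, enhancedIsotypic_le_vinbergModule h hF, hFf⟩

theorem toSubmodule_vinbergAlgebra (hG : IsZariskiClosed G) (hconn : IsConnectedGroup G)
    (hred : IsLinearlyReductive G) (hT : IsTorus T) (hP : IsPositiveSystem T P) :
    Subalgebra.toSubmodule (vinbergAlgebra P) = vinbergModule P := by
  refine le_antisymm ?_ fun p hp => Algebra.subset_adjoin hp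
  have hone : (1 : EnhancedGroup T → ℂ) ∈ vinbergModule P := by
    obtain ⟨F, hF, h1⟩ := isotypic_le_vinbergSlice (κ := 0) hG hP
      (by rw [sub_zero]; exact zero_mem _) (one_mem_isotypic (P := P))
    have : F = 1 := enhanced_ext fun g t => by
      rw [h1, Weight.toHom_zero, Units.val_one, mul_one]
      rfl
    exact this ▸ hF
  have hmul : ∀ F ∈ vinbergModule P, ∀ F' ∈ vinbergModule P, F * F' ∈ vinbergModule P := by
    intro F hF F' hF'
    suffices h : vinbergModule P ≤ (vinbergModule P).comap (LinearMap.mulRight ℂ F') from h hF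
    refine vinbergModule_le fun lam mu hl F hF => ?_
    suffices h : vinbergModule P ≤ (vinbergModule P).comap (LinearMap.mulLeft ℂ F) from h hF'
    refine vinbergModule_le fun lam' mu' hl' F' hF' => ?_
    change F * F' ∈ vinbergModule P
    obtain ⟨f, hf, hFf⟩ := exists_isotypic_of_mem_enhancedIsotypic hT hF
    obtain ⟨f', hf', hFf'⟩ := exists_isotypic_of_mem_enhancedIsotypic hT hF'
    have hle : (⨆ (ν : Weight T) (_ : lam + lam' - ν ∈ AddSubmonoid.closure P), isotypic P ν) ≤
        vinbergSlice P (mu + mu') := by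
      refine iSup₂_le fun ν hν => isotypic_le_vinbergSlice hG hP ?_
      have h1 : mu + mu' - ν = (mu - lam) + (mu' - lam') + (lam + lam' - ν) := by abel
      rw [h1]
      exact add_mem (add_mem hl hl') (hP.closure_le_rootMonoid hν)
    obtain ⟨E, hE, hEf⟩ := hle (mul_mem_iSup_isotypic hG hconn hred hT hP hf hf')
    have : F * F' = E := enhanced_ext fun g t => by
      rw [hEf, Pi.mul_apply, hFf, hFf', Weight.toHom_add, Units.val_mul, Pi.mul_apply]
      ring
    exact this ▸ hE
  let S : Subalgebra ℂ (EnhancedGroup T → ℂ) :=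
    { carrier := vinbergModule P
      add_mem' := fun hp hq => add_mem hp hq
      algebraMap_mem' := fun c => by
        rw [Algebra.algebraMap_eq_smul_one]
        exact Submodule.smul_mem _ c hone
      mul_mem' := fun {p q} hp hq => hmul p hp q hq }
  have hle : vinbergAlgebra P ≤ S := Algebra.adjoin_le fun p hp => hp
  exact fun p hp => hle hp

/-- The characters in `rootMonoid P`, as invariant functions on the Vinberg monoid. -/
theorem exists_character (hG : IsZariskiClosed G) (hP : IsPositiveSystem T P)
    {χ : Weight T} (hχ : χ ∈ rootMonoid P) : ∃ E : abelizationAlgebra P,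
      ∀ g t, abelEval E (toEnhanced T (g, t)) = χ.toHom t := by
  obtain ⟨F, hF, h1⟩ := isotypic_le_vinbergSlice (κ := χ) hG hP (by rwa [sub_zero])
    (one_mem_isotypic (P := P))
  have h2 : ∀ g t, F (toEnhanced T (g, t)) = χ.toHom t := fun g t => by
    rw [h1, Pi.one_apply, one_mul]
  refine ⟨⟨⟨F, Algebra.subset_adjoin hF⟩, fun a b x => ?_⟩, h2⟩
  obtain ⟨g, t, rfl⟩ := toEnhanced_surjective x
  change F _ = F _
  rw [← map_mul, ← map_mul, Prod.mk_mul_mk, Prod.mk_mul_mk, h2, h2, one_mul, mul_one]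

theorem abelEval_toEnhanced (F : abelizationAlgebra P) (g : G) (t : T) :
    abelEval F (toEnhanced T (g, t)) = abelEval F (toEnhanced T (1, t)) := by
  have h1 : toEnhanced T (g, t) =
      toEnhanced T (g, 1) * toEnhanced T (1, t) * toEnhanced T (1, 1) := by
    rw [← map_mul, ← map_mul, Prod.mk_mul_mk, Prod.mk_mul_mk, mul_one, one_mul, mul_one, mul_one]
  rw [h1]
  exact F.2 g 1 _

theorem abelEval_ext {F F' : abelizationAlgebra P}
    (h : ∀ t, abelEval F (toEnhanced T (1, t)) = abelEval F' (toEnhanced T (1, t))) : F = F' :=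
  Subtype.ext (Subtype.ext (enhanced_ext fun g t => by
    have h1 := h t
    rw [← abelEval_toEnhanced F g, ← abelEval_toEnhanced F' g] at h1
    exact h1))

/-- The invariant functions on the Vinberg monoid are combinations of the characters in
`rootMonoid P`. -/
theorem abelEval_mem_span (hG : IsZariskiClosed G) (hconn : IsConnectedGroup G)
    (hred : IsLinearlyReductive G) (hT : IsTorus T) (hP : IsPositiveSystem T P)
    (F : abelizationAlgebra P) : (fun t : T => abelEval F (toEnhanced T (1, t))) ∈
      Submodule.span ℂ ((fun (χ : Weight T) (t : T) => (χ.toHom t : ℂ)) '' rootMonoid P) := by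
  let X : Weight T → Submodule ℂ (EnhancedGroup T → ℂ) := fun lam =>
    ⨆ (mu : Weight T) (_ : mu - lam ∈ rootMonoid P), enhancedIsotypic P lam mu
  have hFmod : ((F : vinbergAlgebra P) : EnhancedGroup T → ℂ) ∈ vinbergModule P := by
    rw [← toSubmodule_vinbergAlgebra hG hconn hred hT hP]
    exact (F : vinbergAlgebra P).2
  have hle : vinbergModule P ≤ ⨆ lam, X lam := vinbergModule_le fun lam mu h =>
    le_iSup_of_le lam (le_iSup₂_of_le mu h le_rfl)
  obtain ⟨f, hf, hfF⟩ := (Submodule.mem_iSup_iff_exists_finsupp _ _).1 (hle hFmod)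
  let slice : T → (EnhancedGroup T → ℂ) →ₗ[ℂ] (G → ℂ) := fun t =>
    { toFun := fun E g => E (toEnhanced T (g, t))
      map_add' := fun _ _ => rfl
      map_smul' := fun _ _ => rfl }
  have hslice : ∀ lam t, X lam ≤ (isotypic P lam).comap (slice t) := fun lam t =>
    iSup₂_le fun mu _ E hE => by
      obtain ⟨e, he, hEe⟩ := exists_isotypic_of_mem_enhancedIsotypic hT hE
      have h1 : slice t E = (mu.toHom t : ℂ) • e := by
        ext g
        change E (toEnhanced T (g, t)) = _
        rw [hEe, Pi.smul_apply, smul_eq_mul, mul_comm]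
      change slice t E ∈ isotypic P lam
      rw [h1]
      exact Submodule.smul_mem _ _ he
  have hzero : ∀ t, slice t (f 0) = slice t ((F : vinbergAlgebra P) : EnhancedGroup T → ℂ) := by
    classical
    intro t
    have hconst : slice t ((F : vinbergAlgebra P) : EnhancedGroup T → ℂ) ∈ isotypic P 0 := by
      have h1 : slice t ((F : vinbergAlgebra P) : EnhancedGroup T → ℂ) =
          abelEval F (toEnhanced T (1, t)) • (1 : G → ℂ) := by
        ext g
        change abelEval F (toEnhanced T (g, t)) = _
        rw [abelEval_toEnhanced, Pi.smul_apply, Pi.one_apply, smul_eq_mul, mul_one]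
      rw [h1]
      exact Submodule.smul_mem _ _ one_mem_isotypic
    have hind := (iSupIndep_iff_finsetSum_eq_zero_imp_eq_zero _).1 hP.iSupIndep_isotypic
      (insert 0 f.support) (fun lam => slice t (f lam) - if lam = 0 then
        slice t ((F : vinbergAlgebra P) : EnhancedGroup T → ℂ) else 0) (fun lam _ => by
          refine sub_mem (hslice lam t (hf lam)) ?_
          split_ifs with h
          · exact h ▸ hconst
          · exact zero_mem _) (by
        rw [Finset.sum_sub_distrib, Finset.sum_ite_eq' (insert 0 f.support),
          if_pos (Finset.mem_insert_self _ _), ← map_sum, sub_eq_zero, ← hfF, Finsupp.sum]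
        congr 1
        refine (Finset.sum_subset (Finset.subset_insert _ _) fun lam _ h => ?_).symm
        exact Finsupp.notMem_support_iff.1 h) 0 (Finset.mem_insert_self _ _)
    rw [if_pos rfl, sub_eq_zero] at hind
    exact hind
  let res : (EnhancedGroup T → ℂ) →ₗ[ℂ] (T → ℂ) :=
    { toFun := fun E t => E (toEnhanced T (1, t))
      map_add' := fun _ _ => rfl
      map_smul' := fun _ _ => rfl }
  have hres : X 0 ≤ (Submodule.span ℂ ((fun (χ : Weight T) (t : T) => (χ.toHom t : ℂ)) ''
      rootMonoid P)).comap res := by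
    refine iSup₂_le fun mu hmu E hE => ?_
    obtain ⟨e, he, hEe⟩ := exists_isotypic_of_mem_enhancedIsotypic hT hE
    have h1 : res E = e 1 • fun t => (mu.toHom t : ℂ) := by
      ext t
      exact hEe 1 t
    rw [Submodule.mem_comap, h1]
    exact Submodule.smul_mem _ _ (Submodule.subset_span ⟨mu, by rwa [sub_zero] at hmu, rfl⟩)
  have h1 : (fun t : T => abelEval F (toEnhanced T (1, t))) = res (f 0) := by
    ext t
    exact (congrFun (hzero t) 1).symm
  rw [h1]
  exact hres (hf 0)

end VinbergAlgebra

/-! ### The morphism from the affine line -/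

section AffineLine

variable {n : ℕ} {G : Subgroup (GL (Fin n) ℂ)} {T : Subgroup G} {P : Set (Weight T)}

theorem exists_character_sum (hG : IsZariskiClosed G) (hconn : IsConnectedGroup G)
    (hred : IsLinearlyReductive G) (hT : IsTorus T) (hP : IsPositiveSystem T P)
    (F : abelizationAlgebra P) : ∃ (d : ℕ) (c : Fin d → ℂ) (χ : Fin d → rootMonoid P),
      ∀ g t, abelEval F (toEnhanced T (g, t)) = ∑ i, c i * ((χ i : Weight T).toHom t : ℂ) := by
  obtain ⟨d, c, χ, h⟩ := Submodule.mem_span_set'.1 (abelEval_mem_span hG hconn hred hT hP F)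
  choose χ' hχ' hχ using fun i => (χ i).2
  refine ⟨d, c, fun i => ⟨χ' i, hχ' i⟩, fun g t => ?_⟩
  rw [abelEval_toEnhanced]
  refine (congrFun h t).symm.trans ?_
  rw [Finset.sum_apply]
  refine Finset.sum_congr rfl fun i _ => ?_
  rw [Pi.smul_apply, ← hχ i, smul_eq_mul]

theorem polynomial_eq_of_eval_units {p q : ℂ[X]} (h : ∀ z : ℂˣ, p.eval (z : ℂ) = q.eval (z : ℂ)) :
    p = q := by
  refine mul_left_cancel₀ Polynomial.X_ne_zero (Polynomial.funext fun z => ?_)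
  rw [Polynomial.eval_mul, Polynomial.eval_mul, Polynomial.eval_X]
  by_cases hz : z = 0
  · rw [hz, zero_mul, zero_mul]
  · rw [show p.eval z = q.eval z from h (Units.mk0 z hz)]

theorem toHom_eq_pow (hP : IsPositiveSystem T P) {h : ℂˣ →* T} (hh : IsCocharacter h)
    (hdom : IsDominant P h) {χ : Weight T} (hχ : χ ∈ rootMonoid P) (z : ℂˣ) :
    (χ.toHom (h z) : ℂ) = (z : ℂ) ^ (pairing χ h).toNat := by
  rw [pairing_spec hh (hP.rootLattice_le_regularWeights hχ.1), ← Units.val_pow_eq_pow_val,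
    ← zpow_natCast, Int.toNat_of_nonneg (hP.pairing_nonneg_of_inRootCone hh hdom hχ.1 hχ.2)]

/-- Evaluation at a point of `G_enh`, as an algebra homomorphism. -/
def abelEvalHom (x : EnhancedGroup T) : abelizationAlgebra P →ₐ[ℂ] ℂ where
  toFun F := abelEval F x
  map_one' := rfl
  map_mul' _ _ := rfl
  map_zero' := rfl
  map_add' _ _ := rfl
  commutes' _ := rfl

theorem exists_isInducedBy (hG : IsZariskiClosed G) (hconn : IsConnectedGroup G)
    (hred : IsLinearlyReductive G) (hT : IsTorus T) (hP : IsPositiveSystem T P) {h : ℂˣ →* T}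
    (hh : IsCocharacter h) (hdom : IsDominant P h) :
    ∃ θ : abelizationAlgebra P →ₐ[ℂ] ℂ[X], IsInducedBy h θ := by
  let i : ℂ[X] →ₐ[ℂ] (ℂˣ → ℂ) := AlgHom.pi fun z => Polynomial.aeval (z : ℂ)
  have hi : ∀ p z, i p z = p.eval (z : ℂ) := fun p z =>
    congrFun (Polynomial.coe_aeval_eq_eval (z : ℂ)) p
  let j : abelizationAlgebra P →ₐ[ℂ] (ℂˣ → ℂ) := 
    AlgHom.pi fun z => abelEvalHom (toEnhanced T (1, h z))
  have hj : ∀ F z, j F z = abelEval F (toEnhanced T (1, h z)) := fun _ _ => rfl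
  have hrange : ∀ F, j F ∈ i.range := fun F => by
    obtain ⟨d, c, χ, hF⟩ := exists_character_sum hG hconn hred hT hP F
    refine ⟨∑ k, Polynomial.C (c k) * Polynomial.X ^ (pairing (χ k : Weight T) h).toNat, ?_⟩
    refine funext fun z => (hi _ z).trans ?_
    rw [hj, hF, Polynomial.eval_finsetSum]
    refine Finset.sum_congr rfl fun k _ => ?_
    rw [toHom_eq_pow hP hh hdom (χ k).2]
    simp
  have hinj : Function.Injective i := fun p q hpq =>
    polynomial_eq_of_eval_units fun z => by rw [← hi, ← hi, hpq]
  obtain ⟨θ, hθ⟩ := exists_algHom_lift i hinj j hrange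
  exact ⟨θ, fun F z => by rw [← hi, hθ, hj]⟩

theorem IsInducedBy.isMonoidMorphism (hG : IsZariskiClosed G) (hconn : IsConnectedGroup G)
    (hred : IsLinearlyReductive G) (hT : IsTorus T) (hP : IsPositiveSystem T P) {h : ℂˣ →* T}
    (hh : IsCocharacter h) (hdom : IsDominant P h) {θ : abelizationAlgebra P →ₐ[ℂ] ℂ[X]}
    (hθ : IsInducedBy h θ) : IsMonoidMorphism θ := by
  intro F
  obtain ⟨d, c, χ, hF⟩ := exists_character_sum hG hconn hred hT hP F
  choose E hE using fun i => exists_character hG hP (χ i).2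
  have hθE : ∀ i, θ (E i) = Polynomial.X ^ (pairing (χ i : Weight T) h).toNat := fun i =>
    polynomial_eq_of_eval_units fun z => by
      rw [hθ, hE, toHom_eq_pow hP hh hdom (χ i).2, Polynomial.eval_pow, Polynomial.eval_X]
  have habel : ∀ i x, abelEval (c i • E i) x = c i * abelEval (E i) x := fun _ _ => rfl
  have hFE : F = ∑ i, c i • E i := by
    refine abelEval_ext fun t => ?_
    have h1 : abelEval (∑ i, c i • E i) (toEnhanced T (1, t)) =
        ∑ i, abelEval (c i • E i) (toEnhanced T (1, t)) :=
      map_sum (abelEvalHom (toEnhanced T (1, t))) _ _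
    rw [hF, h1]
    exact Finset.sum_congr rfl fun i _ => by rw [habel, hE]
  refine ⟨?_, d, fun i => c i • E i, E, fun x y => ?_, fun z w => ?_⟩
  · have h1 := hθ F 1
    rw [Units.val_one, map_one] at h1
    exact h1
  · obtain ⟨g, s, rfl⟩ := toEnhanced_surjective x
    obtain ⟨g', t, rfl⟩ := toEnhanced_surjective y
    rw [← map_mul, Prod.mk_mul_mk, hF]
    refine Finset.sum_congr rfl fun i _ => ?_
    rw [habel, hE, hE, map_mul, Units.val_mul, mul_assoc]
  · conv_lhs => rw [hFE]
    rw [map_sum, Polynomial.eval_finsetSum]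
    refine Finset.sum_congr rfl fun i _ => ?_
    rw [map_smul, hθE, Polynomial.eval_smul, Polynomial.eval_smul, Polynomial.eval_pow,
      Polynomial.eval_pow, Polynomial.eval_pow, Polynomial.eval_X, Polynomial.eval_X,
      Polynomial.eval_X, mul_pow, smul_eq_mul, smul_eq_mul, mul_assoc]

end AffineLine

/-! ### The Rees family as a base change of the abelization -/

section BaseChange

open AlgebraicGeometry CategoryTheory

variable {n : ℕ} {G : Subgroup (GL (Fin n) ℂ)} {T : Subgroup G} {P : Set (Weight T)}

/-- An independent family of subspaces has a basis of its sum that consists of bases of the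
members. -/
theorem exists_basis_of_iSupIndep {ι V : Type} [AddCommGroup V] [Module ℂ V]
    {p : ι → Submodule ℂ V} (hp : iSupIndep p) :
    ∃ (κ : Type) (wt : κ → ι) (b : κ → V), LinearIndependent ℂ b ∧ (∀ k, b k ∈ p (wt k)) ∧
      ∀ i, p i ≤ Submodule.span ℂ (b '' {k | wt k = i}) := by
  classical
  let β := fun i : ι => Module.Basis.ofVectorSpace ℂ (p i)
  refine ⟨Σ i : ι, Module.Basis.ofVectorSpaceIndex ℂ (p i), fun k => k.1,
    fun k => (β k.1 k.2 : V), ?_, fun k => (β k.1 k.2).2, fun i f hf => ?_⟩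
  · have h1 := DFinsupp.linearIndependent_single (R := ℂ) (fun i => β i)
      fun i => (β i).linearIndependent
    have h2 := h1.map' (DFinsupp.lsum ℕ fun i => (p i).subtype)
      (LinearMap.ker_eq_bot.2 hp.dfinsupp_lsum_injective)
    have h3 : (fun k : Σ i : ι, Module.Basis.ofVectorSpaceIndex ℂ (p i) => (β k.1 k.2 : V)) =
        (DFinsupp.lsum ℕ fun i => (p i).subtype) ∘ fun k => DFinsupp.single k.1 (β k.1 k.2) :=
      funext fun k => by rw [Function.comp_apply, DFinsupp.lsum_single]; rfl
    rw [h3]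
    exact h2
  · have h1 := (β i).mem_span ⟨f, hf⟩
    have h2 : (p i).subtype ⟨f, hf⟩ ∈
        (Submodule.span ℂ (Set.range (β i))).map (p i).subtype := ⟨_, h1, rfl⟩
    rw [Submodule.map_span] at h2
    refine Submodule.span_mono ?_ h2
    rintro _ ⟨_, ⟨j, rfl⟩, rfl⟩
    exact ⟨⟨i, j⟩, rfl, rfl⟩

theorem laurentEval_reesStructureMap {h : ℂˣ →* T} (z : ℂˣ) (q : ℂ[X]) :
    laurentEval z (reesStructureMap P h q : LaurentPolynomial (G → ℂ)) =
      q.eval (z : ℂ) • (1 : G → ℂ) := by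
  have h1 : (laurentEval z).comp ((reesAlgebra P h).val.comp (reesStructureMap P h)) =
      (Algebra.ofId ℂ (G → ℂ)).comp (Polynomial.aeval (z : ℂ)) := by
    refine Polynomial.algHom_ext ?_
    simp only [AlgHom.comp_apply, reesStructureMap, Polynomial.aeval_X, Subalgebra.coe_val,
      Algebra.ofId_apply]
    rw [LaurentPolynomial.T, laurentEval_single, zpow_one, Algebra.algebraMap_eq_smul_one]
  have h2 := DFunLike.congr_fun h1 q
  simp only [AlgHom.comp_apply, Subalgebra.coe_val, Algebra.ofId_apply,
    Polynomial.coe_aeval_eq_eval] at h2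
  rw [h2, Algebra.algebraMap_eq_smul_one]

/-- Pullback of functions along `(g, z) ↦ [g, h(z)]` maps `ℂ[S_G]` to the Rees algebra. -/
theorem exists_reesHom (hG : IsZariskiClosed G) (hconn : IsConnectedGroup G)
    (hred : IsLinearlyReductive G) (hT : IsTorus T) (hP : IsPositiveSystem T P) {h : ℂˣ →* T}
    (hh : IsCocharacter h) (hdom : IsDominant P h) :
    ∃ ψ : vinbergAlgebra P →ₐ[ℂ] reesAlgebra P h, ∀ F z g,
      laurentEval z (ψ F : LaurentPolynomial (G → ℂ)) g =
        (F : EnhancedGroup T → ℂ) (toEnhanced T (g, h z)) := by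
  let ev : LaurentPolynomial (G → ℂ) →ₐ[ℂ] (ℂˣ → G → ℂ) := AlgHom.pi fun z => laurentEval z
  let pull : (EnhancedGroup T → ℂ) →ₐ[ℂ] (ℂˣ → G → ℂ) := AlgHom.pi fun z =>
    AlgHom.pi fun g => Pi.evalAlgHom ℂ (fun _ : EnhancedGroup T => ℂ) (toEnhanced T (g, h z))
  let i : reesAlgebra P h →ₐ[ℂ] (ℂˣ → G → ℂ) := ev.comp (reesAlgebra P h).val
  let j : vinbergAlgebra P →ₐ[ℂ] (ℂˣ → G → ℂ) := pull.comp (vinbergAlgebra P).val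
  have hi : Function.Injective i := fun p q hpq =>
    Subtype.ext (laurent_ext fun z => congrFun hpq z)
  have hle : vinbergModule P ≤ ((reesModule P h).map ev.toLinearMap).comap pull.toLinearMap := by
    refine vinbergModule_le fun lam mu hmu F hF => ?_
    obtain ⟨f, hf, hFf⟩ := exists_isotypic_of_mem_enhancedIsotypic hT hF
    by_cases h0 : f = 0
    · have : F = 0 := enhanced_ext fun g t => by rw [hFf, h0]; simp
      rw [this]
      exact zero_mem _
    have hlam := mem_regularWeights_of_mem_isotypic hf h0
    have hsub := hP.rootLattice_le_regularWeights hmu.1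
    have hmureg : mu ∈ regularWeights T := sub_add_cancel mu lam ▸ add_mem hsub hlam
    have hle : pairing lam h ≤ pairing mu h := by
      have h1 := hP.pairing_nonneg_of_inRootCone hh hdom hmu.1 hmu.2
      rw [pairing_sub hh hmureg hlam] at h1
      omega
    refine ⟨AddMonoidAlgebra.single (pairing mu h) f,
      single_mem_reesModule (isotypic_le_filtration hle hf), ?_⟩
    ext z g
    change laurentEval z _ g = F (toEnhanced T (g, h z))
    rw [laurentEval_single, hFf, pairing_spec hh hmureg, Pi.smul_apply, smul_eq_mul, mul_comm]
  have hrange : ∀ F, j F ∈ i.range := fun F => by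
    have hF : (F : EnhancedGroup T → ℂ) ∈ vinbergModule P := by
      rw [← toSubmodule_vinbergAlgebra hG hconn hred hT hP]
      exact F.2
    obtain ⟨p, hp, hpF⟩ := hle hF
    exact ⟨⟨p, Algebra.subset_adjoin hp⟩, hpF⟩
  obtain ⟨ψ, hψ⟩ := exists_algHom_lift i hi j hrange
  exact ⟨ψ, fun F z g => congrFun (congrFun (hψ F) z) g⟩

theorem isPushout_rees (hG : IsZariskiClosed G) (hconn : IsConnectedGroup G)
    (hred : IsLinearlyReductive G) (hT : IsTorus T) (hP : IsPositiveSystem T P) {h : ℂˣ →* T}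
    (hh : IsCocharacter h) (hdom : IsDominant P h) {θ : abelizationAlgebra P →ₐ[ℂ] ℂ[X]}
    (hθ : IsInducedBy h θ) {ψ : vinbergAlgebra P →ₐ[ℂ] reesAlgebra P h}
    (hψ : ∀ F z g, laurentEval z (ψ F : LaurentPolynomial (G → ℂ)) g =
        (F : EnhancedGroup T → ℂ) (toEnhanced T (g, h z))) :
    IsPushout
      (CommRingCat.ofHom (R := abelizationAlgebra P) (S := ℂ[X]) θ.toRingHom)
      (CommRingCat.ofHom (R := abelizationAlgebra P) (S := vinbergAlgebra P)
        (abelizationAlgebra P).val.toRingHom)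
      (CommRingCat.ofHom (R := ℂ[X]) (S := reesAlgebra P h) (reesStructureMap P h).toRingHom)
      (CommRingCat.ofHom (R := vinbergAlgebra P) (S := reesAlgebra P h) ψ.toRingHom) := by
  obtain ⟨ι, wt, b, hli, hb, hspan⟩ := exists_basis_of_iSupIndep hP.iSupIndep_isotypic
  have hreg : ∀ k, wt k ∈ regularWeights T := fun k =>
    mem_regularWeights_of_mem_isotypic (hb k) (hli.ne_zero k)
  have hB : ∀ k, ∃ B : vinbergAlgebra P, ∀ g t,
      (B : EnhancedGroup T → ℂ) (toEnhanced T (g, t)) = b k g * (wt k).toHom t := fun k => by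
    obtain ⟨F, hF, hFb⟩ := isotypic_le_vinbergSlice (κ := wt k) hG hP
      (by rw [sub_self]; exact zero_mem _) (hb k)
    exact ⟨⟨F, Algebra.subset_adjoin hF⟩, hFb⟩
  choose B hB using hB
  have hψB : ∀ k z, laurentEval z (ψ (B k) : LaurentPolynomial (G → ℂ)) =
      ((z ^ pairing (wt k) h : ℂˣ) : ℂ) • b k := fun k z => by
    ext g
    rw [hψ, hB, pairing_spec hh (hreg k), Pi.smul_apply, smul_eq_mul, mul_comm]
  refine isPushout_of_bases (RingHom.ext fun F => Subtype.ext (laurent_ext fun z => ?_)) B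
    (fun a ha => ?_) (fun x => ?_) (fun a ha => ?_) fun x => ?_
  · ext g
    change laurentEval z (ψ (F : vinbergAlgebra P) : LaurentPolynomial (G → ℂ)) g =
      laurentEval z (reesStructureMap P h (θ F) : LaurentPolynomial (G → ℂ)) g
    rw [hψ, laurentEval_reesStructureMap, hθ, Pi.smul_apply, Pi.one_apply, smul_eq_mul, mul_one]
    exact abelEval_toEnhanced F g (h z)
  · ext1 k
    refine abelEval_ext fun t => ?_
    change _ = (0 : ℂ)
    by_cases hk : k ∈ a.support
    · have h1 := linearIndependent_iff'.1 hli a.support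
        (fun k => abelEval (a k) (toEnhanced T (1, t)) * (wt k).toHom t) (by
          ext g
          have h2 : (Pi.evalAlgHom ℂ (fun _ : EnhancedGroup T => ℂ) (toEnhanced T (g, t)))
            ((vinbergAlgebra P).val
              (a.sum fun k x => (abelizationAlgebra P).val.toRingHom x * B k)) = 0 := by rw [ha]; rfl
          rw [Finsupp.sum, map_sum, map_sum] at h2
          rw [Finset.sum_apply, Pi.zero_apply, ← h2]
          refine Finset.sum_congr rfl fun k _ => ?_
          change _ = abelEval (a k) (toEnhanced T (g, t)) *
            (B k : EnhancedGroup T → ℂ) (toEnhanced T (g, t))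
          rw [abelEval_toEnhanced (a k) g, hB, Pi.smul_apply, smul_eq_mul]
          ring) k hk
      exact (mul_eq_zero.1 h1).resolve_right (Units.ne_zero _)
    · rw [Finsupp.notMem_support_iff.1 hk]
      rfl
  · let Φ : (ι →₀ abelizationAlgebra P) →ₗ[ℂ] vinbergAlgebra P := Finsupp.lsum ℂ fun k =>
      LinearMap.mulRight ℂ (B k) ∘ₗ (abelizationAlgebra P).val.toLinearMap
    have hle : vinbergModule P ≤ (LinearMap.range Φ).map (vinbergAlgebra P).val.toLinearMap := by
      refine vinbergModule_le fun lam mu hmu F hF => ?_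
      obtain ⟨f, hf, hFf⟩ := exists_isotypic_of_mem_enhancedIsotypic hT hF
      obtain ⟨E, hE⟩ := exists_character hG hP hmu
      have key : ∀ f ∈ Submodule.span ℂ (b '' {k | wt k = lam}), ∃ y ∈ LinearMap.range Φ, ∀ g t,
          (y : EnhancedGroup T → ℂ) (toEnhanced T (g, t)) = f g * mu.toHom t := by
        intro f hf
        induction hf using Submodule.span_induction with
        | mem f hf =>
          obtain ⟨k, rfl, rfl⟩ := hf
          refine ⟨Φ (Finsupp.single k E), ⟨_, rfl⟩, fun g t => ?_⟩
          rw [Finsupp.lsum_single]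
          change abelEval E (toEnhanced T (g, t)) *
            (B k : EnhancedGroup T → ℂ) (toEnhanced T (g, t)) = _
          rw [hE, hB, mul_left_comm, ← Units.val_mul, ← Weight.toHom_add, sub_add_cancel]
        | zero => exact ⟨0, zero_mem _, fun g t => by simp⟩
        | add f f' _ _ h h' =>
          obtain ⟨y, hy, hyf⟩ := h
          obtain ⟨y', hy', hyf'⟩ := h'
          exact ⟨y + y', add_mem hy hy', fun g t => by
            rw [Subalgebra.coe_add, Pi.add_apply, hyf, hyf', Pi.add_apply, add_mul]⟩
        | smul c f _ h =>
          obtain ⟨y, hy, hyf⟩ := h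
          exact ⟨c • y, Submodule.smul_mem _ c hy, fun g t => by
            rw [Subalgebra.coe_smul, Pi.smul_apply, hyf, Pi.smul_apply, smul_eq_mul, smul_eq_mul,
              mul_assoc]⟩
      obtain ⟨y, hy, hyf⟩ := key f (hspan lam hf)
      exact ⟨y, hy, enhanced_ext fun g t => (hyf g t).trans (hFf g t).symm⟩
    have hx : (x : EnhancedGroup T → ℂ) ∈ vinbergModule P := by
      rw [← toSubmodule_vinbergAlgebra hG hconn hred hT hP]
      exact x.2
    obtain ⟨_, ⟨a, rfl⟩, ha⟩ := hle hx
    exact ⟨a, Subtype.ext ha⟩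
  · ext1 k
    refine polynomial_eq_of_eval_units fun z => ?_
    rw [Finsupp.zero_apply, Polynomial.eval_zero]
    by_cases hk : k ∈ a.support
    · have h1 := linearIndependent_iff'.1 hli a.support
        (fun k => (a k).eval (z : ℂ) * ((z ^ pairing (wt k) h : ℂˣ) : ℂ)) (by
          have h2 : laurentEval z ((reesAlgebra P h).val
            (a.sum fun k x => (reesStructureMap P h).toRingHom x * ψ.toRingHom (B k))) = 0 := by
              rw [ha, map_zero, map_zero]
          rw [Finsupp.sum, map_sum, map_sum] at h2
          rw [← h2]
          refine Finset.sum_congr rfl fun k _ => ?_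
          rw [map_mul, map_mul]
          change _ = laurentEval z (reesStructureMap P h (a k) : LaurentPolynomial (G → ℂ)) *
            laurentEval z (ψ (B k) : LaurentPolynomial (G → ℂ))
          rw [laurentEval_reesStructureMap, hψB, smul_mul_smul_comm, one_mul]) k hk
      exact (mul_eq_zero.1 h1).resolve_right (Units.ne_zero _)
    · rw [Finsupp.notMem_support_iff.1 hk, Polynomial.eval_zero]
  · let Φ : (ι →₀ ℂ[X]) →ₗ[ℂ] reesAlgebra P h := Finsupp.lsum ℂ fun k =>
      LinearMap.mulRight ℂ (ψ (B k)) ∘ₗ (reesStructureMap P h).toLinearMap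
    let N := (LinearMap.range Φ).map (reesAlgebra P h).val.toLinearMap
    have hsingle : ∀ m, filtration P h m ≤ N.comap
        (AddMonoidAlgebra.lsingle m : (G → ℂ) →ₗ[ℂ] LaurentPolynomial (G → ℂ)) := fun m => by
      refine iSup₂_le fun lam hlam => (hspan lam).trans (Submodule.span_le.2 ?_)
      rintro _ ⟨k, rfl, rfl⟩
      refine ⟨_, ⟨Finsupp.single k (Polynomial.X ^ (m - pairing (wt k) h).toNat), rfl⟩,
        laurent_ext fun z => ?_⟩
      rw [Finsupp.lsum_single]
      change laurentEval z ((reesStructureMap P h _ : LaurentPolynomial (G → ℂ)) *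
        (ψ (B k) : LaurentPolynomial (G → ℂ))) = laurentEval z (AddMonoidAlgebra.single m (b k))
      rw [map_mul, laurentEval_reesStructureMap, hψB, laurentEval_single, smul_mul_smul_comm,
        one_mul, Polynomial.eval_pow, Polynomial.eval_X, ← Units.val_pow_eq_pow_val,
        ← Units.val_mul, ← zpow_natCast, Int.toNat_of_nonneg (sub_nonneg.2 hlam),
        ← _root_.zpow_add, sub_add_cancel]
    have hx : (x : LaurentPolynomial (G → ℂ)) ∈ reesModule P h := by
      rw [← toSubmodule_reesAlgebra hG hconn hred hT hP hh hdom]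
      exact x.2
    have hxN : (x : LaurentPolynomial (G → ℂ)) ∈ N := by
      rw [← AddMonoidAlgebra.sum_coeff_single (x : LaurentPolynomial (G → ℂ))]
      exact sum_mem fun m _ => hsingle m (hx m)
    obtain ⟨_, ⟨a, rfl⟩, ha⟩ := hxN
    exact ⟨a, Subtype.ext ha⟩

end BaseChange

end Vinberg

end

open Vinberg in
theorem mainTheorem10 {n : ℕ} (G : Subgroup (Matrix.GeneralLinearGroup (Fin n) ℂ))
    (hclosed : IsZariskiClosed G) (hconn : IsConnectedGroup G) (hred : IsLinearlyReductive G)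
    (T : Subgroup G) (hT : IsMaximalTorus T)
    (P : Set (Weight T)) (hP : IsPositiveSystem T P)
    (h : ℂˣ →* T) (hh : IsCocharacter h) (hdom : IsDominant P h) :
    Subalgebra.toSubmodule (reesAlgebra P h) = reesModule P h ∧
    Subalgebra.toSubmodule (vinbergAlgebra P) = vinbergModule P ∧
    ∃ θ : abelizationAlgebra P →ₐ[ℂ] Polynomial ℂ,
      IsInducedBy h θ ∧ IsMonoidMorphism θ ∧
      ∃ e : AlgebraicGeometry.Spec (CommRingCat.of (reesAlgebra P h)) ≅
          CategoryTheory.Limits.pullback (lineMap θ) (abelization P),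
        CategoryTheory.CategoryStruct.comp e.hom
          (CategoryTheory.Limits.pullback.fst (lineMap θ) (abelization P)) = reesFamily P h := by
  obtain ⟨θ, hθ⟩ := exists_isInducedBy hclosed hconn hred hT.1 hP hh hdom
  obtain ⟨ψ, hψ⟩ := exists_reesHom hclosed hconn hred hT.1 hP hh hdom
  have hpb := AlgebraicGeometry.isPullback_SpecMap_of_isPushout _ _ _ _
    (isPushout_rees hclosed hconn hred hT.1 hP hh hdom hθ hψ)
  exact ⟨toSubmodule_reesAlgebra hclosed hconn hred hT.1 hP hh hdom,
    toSubmodule_vinbergAlgebra hclosed hconn hred hT.1 hP, θ, hθ,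
    hθ.isMonoidMorphism hclosed hconn hred hT.1 hP hh hdom, hpb.isoPullback,
    hpb.isoPullback_hom_fst⟩
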